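/- **Setting.** For $0<\eta<1$, a real random variable $x$ is *$\eta$-HC* if $0<\mathbf E[x^4]<\infty$ and $\mathbf E[(c+\eta x)^4]\le \mathbf E[(c+x)^2]^2$ for all $c\in\mathbb R$. Let $n,d\ge 1$, $0<\epsilon<1/2$, let $\Omega_1,\dots,\Omega_n$ be multisets of reals, all of the same size $|\Omega|=2^b$, and let $X=(x_1,\dots,x_n)$ where the $x_j$ are independent, $x_j$ is uniform on $\Omega_j$, and every $x_j$ is $\eta$-HC. A *function of $d$ halfspaces* is a function $F:\mathbb R^n\to\{0,1\}$ of the form $F(x)=f(\mathrm{sgn}(\ell_1(x)),\dots,\mathrm{sgn}(\ell_d(x)))$, where $f:\{-1,1\}^d\to\{0,1\}$ is arbitrary, each $\ell_i(x)=\sum_j x_jW_j[i]-\Theta[i]$ is affine, and $\mathrm{sgn}(u)=1$ for $u\ge0$, $\mathrm{sgn}(u)=-1$ for $u<0$. A generator $G$, run on a uniformly random seed, $\gamma$-fools $F$ if $|\Pr[F(X)=1]-\Pr[F(G(\text{seed}))=1]|\le\gamma$; its seed length is the number of bits of the seed. **Generator.** The modified Meka–Zuckerman generator with $t$ buckets draws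 a uniformly random $h:[n]\to[t]$ from a hash family that is 1-collision preserving, i.e. $\Pr[h(i)=l]\le 1/t$ for all $i,l$ and $\Pr[h(i)=h(j)]\le 1/t$ for all $i\neq j$; then, independently for the buckets $H_l=h^{-1}(l)$, it draws $(y_j)_{j\in H_l}$ from a 5-wise independent distribution (any at most 5 of these $y_j$ have the same joint law as the corresponding $x_j$), and outputs $(y_1,\dots,y_n)$. In the *explicit* version $t=2^\tau$, the hash functions are $h_a(x)=(a\cdot x)\bmod t$, where $a$ is a random element of the field with $2^{m_0}$ elements, $m_0$ least with $2^{m_0}\ge\max(n+1,t)$, the indices are represented by nonzero field elements, and field elements are read as natural numbers below $2^{m_0}$ through an $\mathbb F_2$-basis; the 5-wise independent distributions are given by the first $b$ bits of the values, at the elements representing the indices, of random polynomials of degree less than $5$ over the field with $2^m$ elements, $m$ least with $2^m\ge\max(n,2^b)$, where the $b$ bits index the elements of $\Omega_j$. **Parameters.** $s=\dfrac1{\eta^2\sqrt\epsilon}$, $\ \delta=\dfrac{\eta^4\epsilon^8}{d^7}$, $\ L=\Bigl\lceil\dfrac{2}{\eta^4}\ln\dfrac1\epsilon\Bigr\rceil\cdot\Bigl\lceil\dfrac{1}{\eta^4\delta}\ln(1+16s^2)\Bigr\rceil$,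 $\ t_0=\dfrac{(dL)^2}{d\epsilon}$. **Theorem.** There is a universal constant $K>0$ such that the following holds for all data as above. 1. For every integer $t\ge t_0$, every 1-collision preserving hash family and all 5-wise independent distributions for the buckets, the modified Meka–Zuckerman generator with $t$ buckets $(Kd\epsilon)$-fools every function of $d$ halfspaces under $X$. 2. For every power of two $t=2^\tau\ge t_0$, the explicit version is an instance of the generator (its hash family is 1-collision preserving and its distributions are 5-wise independent), it $(Kd\epsilon)$-fools every function of $d$ halfspaces under $X$, and its seed length is at most $K\,t\log\max(n,|\Omega|)$. 3. If $t$ is the least power of two with $t\ge t_0$ and $|\Omega|$ is polynomially bounded, $|\Omega|\le (n/(\epsilon\eta))^{A}$ with $A\in\mathbb N$, then the seed length of the explicit version is at most $$C_A\cdot\frac{d^{15}\,\log^4(1/(\epsilon\eta))\,\log(n/(\epsilon\eta))}{\eta^{24}\epsilon^{17}},$$ where $C_A$ depends only on $A$. -/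

import Mathlib

open scoped BigOperators

noncomputable section

namespace MZ

/-- Bit strings of length `m`; bits are elements of the two-element field. -/
abbrev Bits (m : ℕ) : Type := Fin m → ZMod 2

/-- Probability of the event `p` for a uniformly random element of the finite set `α`. -/
def prob {α : Type} [Fintype α] (p : α → Prop) : ℝ :=
  (Nat.card {a : α // p a} : ℝ) / (Fintype.card α : ℝ)

/-- The real random variable `x`, on the uniform probability space `α`, is `η`-HC:
`0 < η < 1`, `0 < ‖x‖₄`, and `‖c + η x‖₄ ≤ ‖c + x‖₂` for every real `c`
(the last inequality raised to the fourth power). Finiteness of `‖x‖₄` is automatic here. -/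
def IsHC {α : Type} [Fintype α] (η : ℝ) (x : α → ℝ) : Prop :=
  0 < η ∧ η < 1 ∧ 0 < (𝔼 a, x a ^ 4) ∧
    ∀ c : ℝ, (𝔼 a, (c + η * x a) ^ 4) ≤ (𝔼 a, (c + x a) ^ 2) ^ 2

/-! ### Functions of halfspaces and fooling -/

/-- The sign with `sgn x = 1` for `x ≥ 0` and `sgn x = -1` for `x < 0`. The type `ℤˣ` is the
two-element set `{1, -1}`. -/
def sgn (x : ℝ) : ℤˣ := if 0 ≤ x then 1 else -1

/-- `F : ℝⁿ → {0,1}` is a function of `d` halfspaces: there are vectors `W₁, …, W_n, Θ ∈ ℝᵈ` and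
`f : {-1,1}ᵈ → {0,1}` such that `F x` is `f` of the sign vector of `x₁ W₁ + ⋯ + x_n W_n - Θ`. -/
def IsFunctionOfHalfspaces {n : ℕ} (d : ℕ) (F : (Fin n → ℝ) → Bool) : Prop :=
  ∃ (W : Fin n → Fin d → ℝ) (Θ : Fin d → ℝ) (f : (Fin d → ℤˣ) → Bool),
    ∀ x : Fin n → ℝ, F x = f (fun i => sgn ((∑ j, x j * W j i) - Θ i))

/-- The product distribution whose `j`-th coordinate is uniform on the multiset
`{Ω j u : u ∈ {0,1}ᵇ}` of size `2 ^ b`: feed it uniformly random independent `u j`. -/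
def productSample {n b : ℕ} (Ω : Fin n → Bits b → ℝ) (u : Fin n → Bits b) : Fin n → ℝ :=
  fun j => Ω j (u j)

/-- The generator `G`, run on a uniformly random seed from `S`, fools `F` with error `err` under
the product distribution of `Ω`. -/
def Fools {n b : ℕ} {S : Type} [Fintype S] (Ω : Fin n → Bits b → ℝ) (G : S → Fin n → ℝ)
    (err : ℝ) (F : (Fin n → ℝ) → Bool) : Prop :=
  |prob (fun u : Fin n → Bits b => F (productSample Ω u) = true)
    - prob (fun z : S => F (G z) = true)| ≤ err

/-- Number of random bits needed for a uniformly random seed from `S`. -/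
def seedLength (S : Type) [Fintype S] : ℝ := Real.logb 2 (Fintype.card S)

/-! ### The generator -/

/-- A family `h k`, `k ∈ κ`, of hash functions `[n] → [t]` is `B`-collision preserving. -/
def IsCollisionPreserving {κ : Type} [Fintype κ] {n t : ℕ} (B : ℝ) (h : κ → Fin n → Fin t) :
    Prop :=
  (∀ (i : Fin n) (l : Fin t), prob (fun k => h k i = l) ≤ B / t) ∧
    ∀ i j : Fin n, i ≠ j → prob (fun k => h k i = h k j) ≤ B / t

/-- The coordinates in `H` of the random vector `y` (on the uniform space `σ`) are `k`-wise
independent with the marginals prescribed by `Ω`: for at most `k` coordinates in `H`, their joint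
law is that of the product distribution of `Ω`. -/
def IsKWise {σ : Type} [Fintype σ] {n b : ℕ} (k : ℕ) (Ω : Fin n → Bits b → ℝ)
    (H : Finset (Fin n)) (y : σ → Fin n → ℝ) : Prop :=
  ∀ S : Finset (Fin n), S ⊆ H → S.card ≤ k → ∀ v : Fin n → ℝ,
    prob (fun z => ∀ j ∈ S, y z j = v j) = ∏ j ∈ S, prob (fun a => Ω j a = v j)

/-- The bucket `{j : h j = l}`. -/
def bucket {n t : ℕ} (h : Fin n → Fin t) (l : Fin t) : Finset (Fin n) :=
  Finset.univ.filter (fun j => h j = l)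

/-- The modified Meka-Zuckerman generator. Its seed consists of a hash seed `s.1` and of one
independent seed `s.2 l` for every bucket `l`. It hashes the coordinates into buckets and fills
the coordinates of the bucket `H` with those of `gen H`, run on the seed of that bucket. -/
def mzGenerator {κ σ : Type} {n t : ℕ} (hash : κ → Fin n → Fin t)
    (gen : Finset (Fin n) → σ → Fin n → ℝ) (s : κ × (Fin t → σ)) : Fin n → ℝ :=
  fun j => gen (bucket (hash s.1) (hash s.1 j)) (s.2 (hash s.1 j)) j

/-! ### Explicit hash functions and explicit five-wise independence -/

/-- The field `𝔽` with `2 ^ m` elements. -/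
abbrev GF (m : ℕ) : Type := GaloisField 2 m

/-- An identification of the field with `2 ^ m` elements with bit strings of length `m`,
given by a basis over the prime field. -/
abbrev Coords (m : ℕ) : Type := GF m ≃ₗ[ZMod 2] Bits m

theorem nonempty_coords {m : ℕ} (hm : m ≠ 0) : Nonempty (Coords m) := by
  have h : Module.finrank (ZMod 2) (GF m) = Module.finrank (ZMod 2) (Bits m) := by
    rw [GaloisField.finrank 2 hm]; simp
  have : Module.Finite (ZMod 2) (GF m) :=
    Module.finite_of_finrank_pos (by rw [GaloisField.finrank 2 hm]; omega)
  exact ⟨LinearEquiv.ofFinrankEq _ _ h⟩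

/-- The `m` low-order binary digits of `x`. -/
def natToBits (m x : ℕ) : Bits m := fun i => if x.testBit i then 1 else 0

/-- The natural number with binary digits `v`. -/
def bitsToNat {m : ℕ} (v : Bits m) : ℕ := ∑ i, (v i).val * 2 ^ (i : ℕ)

/-- Least `m` with `n + 1 ≤ 2 ^ m` and `2 ^ τ ≤ 2 ^ m`. -/
def hashBits (n τ : ℕ) : ℕ := max τ (Nat.clog 2 (n + 1))

/-- Least `m` with `n ≤ 2 ^ m` and `2 ^ b ≤ 2 ^ m`. -/
def genBits (n b : ℕ) : ℕ := max b (Nat.clog 2 n)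

/-- The hash family `h_a(x) = (a x) mod 2 ^ τ`: multiply in the field with `2 ^ m` elements, read
the product as a natural number below `2 ^ m`, and reduce. The indices `0, …, n - 1` are
represented by the field elements with binary representations `1, …, n`. -/
def mzHash (n τ : ℕ) (e : Coords (hashBits n τ)) (a : Bits (hashBits n τ)) (j : Fin n) :
    Fin (2 ^ τ) :=
  ⟨bitsToNat (e (e.symm a * e.symm (natToBits _ ((j : ℕ) + 1)))) % 2 ^ τ,
    Nat.mod_lt _ (by positivity)⟩

/-- Five-wise independent sampling from the multisets `Ω j`: evaluate a random polynomial of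
degree less than `5`, with coefficients `c`, at the field element representing `j`, and use the
first `b` bits of the value as an index into `Ω j`. -/
def mzSampler {n b : ℕ} (Ω : Fin n → Bits b → ℝ) (e : Coords (genBits n b))
    (c : Fin 5 → Bits (genBits n b)) (j : Fin n) : ℝ :=
  Ω j (fun i => e (∑ k : Fin 5, e.symm (c k) * e.symm (natToBits _ (j : ℕ)) ^ (k : ℕ))
    (Fin.castLE (le_max_left b (Nat.clog 2 n)) i))

/-- Seeds of the explicit generator with `2 ^ τ` buckets. -/
abbrev MZSeed (n b τ : ℕ) : Type :=
  Bits (hashBits n τ) × (Fin (2 ^ τ) → Fin 5 → Bits (genBits n b))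

/-- The explicit generator with `2 ^ τ` buckets. -/
def mzExplicit {n b : ℕ} (τ : ℕ) (Ω : Fin n → Bits b → ℝ) (e₀ : Coords (hashBits n τ))
    (e : Coords (genBits n b)) : MZSeed n b τ → Fin n → ℝ :=
  mzGenerator (mzHash n τ e₀) (fun _ => mzSampler Ω e)

/-! ### Parameters -/

/-- `s = 1 / (η² √ε)`. -/
def paramS (ε η : ℝ) : ℝ := 1 / (η ^ 2 * √ε)

/-- `δ = η⁴ ε⁸ / d⁷`. -/
def paramδ (d : ℕ) (ε η : ℝ) : ℝ := η ^ 4 * ε ^ 8 / (d : ℝ) ^ 7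

/-- `L = ⌈(2 / η⁴) ln (1 / ε)⌉ · ⌈(1 / (η⁴ δ)) ln (1 + 16 s²)⌉`. -/
def paramL (d : ℕ) (ε η : ℝ) : ℕ :=
  ⌈2 / η ^ 4 * Real.log (1 / ε)⌉₊ *
    ⌈1 / (η ^ 4 * paramδ d ε η) * Real.log (1 + 16 * paramS ε η ^ 2)⌉₊

/-- Lower bound `(d L)² / (d ε)` on the number of buckets. -/
def minBuckets (d : ℕ) (ε η : ℝ) : ℝ := ((d : ℝ) * paramL d ε η) ^ 2 / (d * ε)

/-- The least `τ` such that `2 ^ τ` is at least `minBuckets d ε η`. -/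
def bucketBits (d : ℕ) (ε η : ℝ) : ℕ := Nat.clog 2 ⌈minBuckets d ε η⌉₊

end MZ

end

open scoped BigOperators

noncomputable section

namespace MZ

open Finset

/-! ### Expectations over finite uniform spaces -/

/-! To each halfspace attach the variances `wvar` of its summands x_j W_j[i]. It is regular outside
a set H of coordinates if none of these variances outside H exceeds ρ = η⁴δ times their total T.
Moving offending coordinates into H one at a time yields a common head H with at most dL elements,
outside which every halfspace either is regular or has lost a fraction ρ of its tail variance L
times (`exists_regular_or_decays`). The hash function fails to separate H with probability at most
(dL)²/t ≤ dε. Otherwise each bucket holds at most one head coordinate. Then 5-wise independence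
reproduces the law of the head exactly, and leaves four further coordinates per bucket for matching
moments.

A decayed halfspace is replaced by the sign of its head. The L = r·m steps group into r blocks, each
with far more variance than everything after it. By Paley–Zygmund each block has a chance of at
least η⁴/2 to push the head away from the threshold, so the head is rarely within s√T of it
(`Decays.small_ball`). Second moments suffice to show that the tail rarely reaches s√T.

For the regular halfspaces the signs are smoothed at scale ε√T and the Boolean function is extended
multi-affinely. Buckets are replaced one by one (`lindeberg`): Taylor terms of order at most 3 agree
under both laws, and the remainder is a sum of fourth moments of bucket sums, which
hypercontractivity bounds by squared bucket variances. On average over the hash these squares add up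
to at most (ρ + 1/t)T² (`expect_bucketEnergy_le`). Multi-affinity keeps the fourth derivative
polynomial in d.

Smoothing errs only in strips of width ε√T. Under the product law such strips are light by a Fourier
estimate (`regular_small_ball`). Under the generator no separate anticoncentration is needed: a
smooth majorant of the strip is itself transferred by Lindeberg's method.

For the explicit version, hash values and polynomial values are images of the seed under surjective
additive maps, hence uniform; surjectivity is invertibility of field multiplication and Lagrange
interpolation respectively. -/

open Classical in
/-- The indicator of a proposition. -/
def ind (p : Prop) : ℝ := if p then 1 else 0

theorem ind_nonneg (p : Prop) : 0 ≤ ind p := by unfold ind; split_ifs <;> norm_num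

theorem ind_le_one (p : Prop) : ind p ≤ 1 := by unfold ind; split_ifs <;> norm_num

theorem ind_of {p : Prop} (h : p) : ind p = 1 := by simp [ind, h]

theorem ind_of_not {p : Prop} (h : ¬p) : ind p = 0 := by simp [ind, h]

theorem prob_eq_expect {α : Type} [Fintype α] (p : α → Prop) : prob p = 𝔼 a, ind (p a) := by
  classical
  rw [prob, Fintype.expect_eq_sum_div_card]
  congr 1
  rw [Nat.card_eq_fintype_card, Fintype.card_subtype, Finset.card_eq_sum_ones, Finset.sum_filter]
  push_cast
  refine Finset.sum_congr rfl fun a _ => ?_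
  by_cases h : p a <;> simp [ind, h]

theorem expect_mono {α : Type*} [Fintype α] {f g : α → ℝ} (h : ∀ a, f a ≤ g a) :
    (𝔼 a, f a) ≤ 𝔼 a, g a := Finset.expect_le_expect fun a _ => h a

theorem expect_le_of_le {α : Type*} [Fintype α] [Nonempty α] {f : α → ℝ} {c : ℝ}
    (h : ∀ a, f a ≤ c) : (𝔼 a, f a) ≤ c :=
  (expect_mono h).trans (Fintype.expect_const c).le

theorem abs_expect_le_of_le {α : Type*} [Fintype α] [Nonempty α] {f : α → ℝ} {c : ℝ}
    (h : ∀ a, |f a| ≤ c) : |𝔼 a, f a| ≤ c :=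
  (Finset.abs_expect_le _ _).trans (expect_le_of_le h)

theorem expect_prod {α β M : Type*} [Fintype α] [Fintype β] [AddCommMonoid M] [Module ℚ≥0 M]
    (f : α × β → M) :
    (𝔼 p, f p) = 𝔼 a, 𝔼 b, f (a, b) := by
  rw [← Finset.univ_product_univ, Finset.expect_product]

/-- Resampling the coordinates in `S` does not change the expectation. -/
theorem expect_resample {ι α M : Type*} [Fintype ι] [DecidableEq ι] [Fintype α] [Nonempty α]
    [AddCommMonoid M] [Module ℚ≥0 M]
    (S : Finset ι) (Q : (ι → α) → M) :
    (𝔼 u, Q u) = 𝔼 u' : ι → α, 𝔼 u : ι → α, Q (S.piecewise u' u) := by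
  have h1 : (𝔼 u, Q u) = 𝔼 p : (ι → α) × (ι → α), Q p.2 := by
    rw [expect_prod]; simp
  -- Exchanging the coordinates in S between two independent copies is an involution of the product
  -- space.
  let e : (ι → α) × (ι → α) ≃ (ι → α) × (ι → α) :=
    { toFun := fun p => (S.piecewise p.2 p.1, S.piecewise p.1 p.2)
      invFun := fun p => (S.piecewise p.2 p.1, S.piecewise p.1 p.2)
      left_inv := fun p => by
        ext j <;> by_cases hj : j ∈ S <;> simp [hj]
      right_inv := fun p => by
        ext j <;> by_cases hj : j ∈ S <;> simp [hj] }
  rw [h1, ← expect_prod (fun p : (ι → α) × (ι → α) => Q (S.piecewise p.1 p.2))]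
  refine Fintype.expect_equiv e.symm _ _ fun p => ?_
  simp only [e, Equiv.symm, Equiv.coe_fn_mk]
  congr 1
  ext j; by_cases hj : j ∈ S <;> simp [hj]

/-- Resampling one coordinate does not change the expectation. -/
theorem expect_resample_update {ι α M : Type*} [Fintype ι] [DecidableEq ι] [Fintype α]
    [Nonempty α] [AddCommMonoid M] [Module ℚ≥0 M] (l : ι) (Q : (ι → α) → M) :
    (𝔼 u, Q u) = 𝔼 u : ι → α, 𝔼 w : α, Q (Function.update u l w) := by
  have h1 : (𝔼 u, Q u) = 𝔼 p : (ι → α) × α, Q p.1 := by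
    rw [expect_prod]; simp
  let e : (ι → α) × α ≃ (ι → α) × α :=
    { toFun := fun p => (Function.update p.1 l p.2, p.1 l)
      invFun := fun p => (Function.update p.1 l p.2, p.1 l)
      left_inv := fun p => by simp
      right_inv := fun p => by simp }
  rw [h1, ← expect_prod (fun p : (ι → α) × α => Q (Function.update p.1 l p.2))]
  refine Fintype.expect_equiv e.symm _ _ fun p => ?_
  simp [e, Equiv.symm]

/-- The expectation of a product of functions of different coordinates. -/
theorem expect_pi_prod {ι α K : Type*} [Fintype ι] [DecidableEq ι] [Fintype α] [Semifield K]
    [CharZero K] (f : ι → α → K) :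
    (𝔼 u : ι → α, ∏ j, f j (u j)) = ∏ j, 𝔼 a, f j a := by
  simp only [Fintype.expect_eq_sum_div_card, Finset.prod_div_distrib, Fintype.prod_sum]
  simp

/-- Markov's inequality. -/
theorem expect_ind_le {α : Type*} [Fintype α] {f : α → ℝ} (p : α → Prop) {c : ℝ} (hc : 0 < c)
    (hf : ∀ a, 0 ≤ f a) (h : ∀ a, p a → c ≤ f a) : (𝔼 a, ind (p a)) ≤ (𝔼 a, f a) / c := by
  rw [Finset.expect_div]
  refine expect_mono fun a => ?_
  by_cases ha : p a
  · rw [ind_of ha, le_div_iff₀ hc, one_mul]; exact h a ha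
  · rw [ind_of_not ha]; exact div_nonneg (hf a) hc.le

/-! ### Moments of hypercontractive variables -/

/-- A cubic with nonzero leading coefficient is unbounded above at one of the two ends of the line.
This extracts information from hypercontractivity at large |c|. -/
theorem eq_zero_of_cubic_nonpos {a A B C : ℝ}
    (h : ∀ c : ℝ, a * c ^ 3 + A * c ^ 2 + B * c + C ≤ 0) : a = 0 := by
  have key : ∀ a A B C : ℝ, (∀ c : ℝ, a * c ^ 3 + A * c ^ 2 + B * c + C ≤ 0) → a ≤ 0 := by
    intro a A B C h
    by_contra! ha
    -- Chosen so that R ≥ 1 and aR = a + |A| + |B| + |C|; the leading term then outweighs all the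
    -- others.
    set R := 1 + (|A| + |B| + |C|) / a with hR
    have h0 : 0 ≤ (|A| + |B| + |C|) / a := by positivity
    have hR1 : 1 ≤ R := by linarith
    have haR : a * R = a + (|A| + |B| + |C|) := by rw [hR]; field_simp
    have h1 := h R
    have hA : -(|A| * R ^ 2) ≤ A * R ^ 2 := by
      nlinarith [neg_abs_le A, sq_nonneg R]
    have hB : -(|B| * R ^ 2) ≤ B * R := by
      nlinarith [neg_abs_le B, abs_nonneg B, mul_nonneg (abs_nonneg B) (sub_nonneg.2 hR1),
        mul_nonneg (mul_nonneg (abs_nonneg B) (sub_nonneg.2 hR1)) (by linarith : (0 : ℝ) ≤ R)]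
    have hC : -(|C| * R ^ 2) ≤ C := by
      nlinarith [neg_abs_le C, abs_nonneg C, mul_nonneg (abs_nonneg C) (sub_nonneg.2 hR1)]
    have : a * R ^ 3 = a * R ^ 2 + (|A| + |B| + |C|) * R ^ 2 := by
      rw [pow_succ' R 2, ← mul_assoc, haR]; ring
    have : 0 < a * R ^ 2 := by positivity
    linarith
  refine le_antisymm (key a A B C h) ?_
  have := key (-a) A (-B) C fun c => by have := h (-c); ring_nf at this ⊢; linarith
  linarith

section Single

variable {α : Type} [Fintype α] {η : ℝ} {x : α → ℝ}

theorem IsHC.nonempty (h : IsHC η x) : Nonempty α := by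
  by_contra hne
  rw [not_nonempty_iff] at hne
  have := h.2.2.1
  simp at this

theorem expect_add_mul_pow_four [Nonempty α] (c r : ℝ) (x : α → ℝ) :
    (𝔼 a, (c + r * x a) ^ 4) = c ^ 4 + 4 * c ^ 3 * r * (𝔼 a, x a) + 6 * c ^ 2 * r ^ 2 *
      (𝔼 a, x a ^ 2) + 4 * c * r ^ 3 * (𝔼 a, x a ^ 3) + r ^ 4 * 𝔼 a, x a ^ 4 := by
  simp only [Finset.mul_expect]
  rw [← Fintype.expect_const (ι := α) (c ^ 4)]
  simp only [← Finset.expect_add_distrib]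
  exact Finset.expect_congr rfl fun a _ => by ring

theorem expect_add_mul_sq [Nonempty α] (c r : ℝ) (x : α → ℝ) :
    (𝔼 a, (c + r * x a) ^ 2) = c ^ 2 + 2 * c * r * (𝔼 a, x a) + r ^ 2 * 𝔼 a, x a ^ 2 := by
  simp only [Finset.mul_expect]
  rw [← Fintype.expect_const (ι := α) (c ^ 2)]
  simp only [← Finset.expect_add_distrib]
  exact Finset.expect_congr rfl fun a _ => by ring

/-- The terms in c⁴ cancel, and the c³ coefficients of the two sides differ by 4(η - 1) times the
mean. An inequality for all real c forces this to vanish, and η < 1. -/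
theorem IsHC.mean_eq_zero (h : IsHC η x) : (𝔼 a, x a) = 0 := by
  have := h.nonempty
  obtain ⟨h0, h1, -, hc⟩ := h
  have key := eq_zero_of_cubic_nonpos (a := 4 * (η - 1) * 𝔼 a, x a)
    (A := 6 * η ^ 2 * (𝔼 a, x a ^ 2) - 4 * (𝔼 a, x a) ^ 2 - 2 * 𝔼 a, x a ^ 2)
    (B := 4 * η ^ 3 * (𝔼 a, x a ^ 3) - 4 * (𝔼 a, x a) * 𝔼 a, x a ^ 2)
    (C := η ^ 4 * (𝔼 a, x a ^ 4) - (𝔼 a, x a ^ 2) ^ 2) fun c => by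
      have := hc c
      have h2 := expect_add_mul_sq c 1 x
      simp only [one_mul] at h2
      rw [expect_add_mul_pow_four, h2] at this
      nlinarith
  rcases mul_eq_zero.1 key with h | h
  · linarith
  · exact h

theorem IsHC.fourth_moment_le (h : IsHC η x) : η ^ 4 * (𝔼 a, x a ^ 4) ≤ (𝔼 a, x a ^ 2) ^ 2 := by
  have := h.2.2.2 0
  simpa [mul_pow, ← Finset.mul_expect] using this

theorem IsHC.second_moment_pos (h : IsHC η x) : 0 < 𝔼 a, x a ^ 2 := by
  have h1 := h.fourth_moment_le
  have h2 : 0 < η ^ 4 * 𝔼 a, x a ^ 4 := mul_pos (pow_pos h.1 4) h.2.2.1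
  have h3 : 0 ≤ 𝔼 a, x a ^ 2 := Finset.expect_nonneg fun _ _ => sq_nonneg _
  by_contra! h4
  have : (𝔼 a, x a ^ 2) = 0 := le_antisymm h4 h3
  rw [this] at h1
  linarith

/-- Homogeneity: use c / w as the shift and multiply by w⁴. The mean-zero property removes the cross
term on the right. -/
theorem IsHC.expect_scaled (h : IsHC η x) (c w : ℝ) :
    (𝔼 a, (c + η * (x a * w)) ^ 4) ≤ (c ^ 2 + w ^ 2 * 𝔼 a, x a ^ 2) ^ 2 := by
  have := h.nonempty
  by_cases hw : w = 0
  · simp [hw]; ring_nf; rfl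
  have h1 := h.2.2.2 (c / w)
  have h2 := expect_add_mul_sq (c / w) 1 x
  simp only [one_mul, h.mean_eq_zero] at h2
  rw [h2] at h1
  have e1 : (𝔼 a, (c + η * (x a * w)) ^ 4) = w ^ 4 * 𝔼 a, (c / w + η * x a) ^ 4 := by
    rw [Finset.mul_expect]
    refine Finset.expect_congr rfl fun a _ => ?_
    rw [← mul_pow]; congr 1; field_simp
  have e2 : (c ^ 2 + w ^ 2 * 𝔼 a, x a ^ 2) ^ 2 =
      w ^ 4 * ((c / w) ^ 2 + 2 * (c / w) * 1 * 0 + 1 ^ 2 * 𝔼 a, x a ^ 2) ^ 2 := by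
    rw [show w ^ 4 = (w ^ 2) ^ 2 by ring, ← mul_pow]; congr 1; field_simp; ring
  rw [e1, e2]
  gcongr

end Single

/-! ### Sums of independent hypercontractive variables -/

section Sums

variable {ι α : Type} [Fintype α] {η : ℝ} {x : ι → α → ℝ}

/-- The variance of `x j * w j`. -/
def wvar (x : ι → α → ℝ) (w : ι → ℝ) (j : ι) : ℝ := w j ^ 2 * 𝔼 a, x j a ^ 2

theorem wvar_nonneg (x : ι → α → ℝ) (w : ι → ℝ) (j : ι) : 0 ≤ wvar x w j :=
  mul_nonneg (sq_nonneg _) (Finset.expect_nonneg fun _ _ => sq_nonneg _)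

theorem sum_wvar_nonneg (x : ι → α → ℝ) (w : ι → ℝ) (S : Finset ι) :
    0 ≤ ∑ j ∈ S, wvar x w j := Finset.sum_nonneg fun j _ => wvar_nonneg x w j

variable [Fintype ι] [DecidableEq ι]

theorem expect_sum_insert [Nonempty α] (w : ι → ℝ) {S : Finset ι} {j : ι} (hj : j ∉ S)
    (g : ℝ → ℝ) :
    (𝔼 u : ι → α, g (∑ i ∈ insert j S, x i (u i) * w i)) =
      𝔼 u : ι → α, 𝔼 a, g (x j a * w j + ∑ i ∈ S, x i (u i) * w i) := by
  rw [expect_resample_update j]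
  refine Finset.expect_congr rfl fun u _ => Finset.expect_congr rfl fun a _ => ?_
  rw [Finset.sum_insert hj, Function.update_self]
  congr 2
  refine Finset.sum_congr rfl fun i hi => ?_
  rw [Function.update_of_ne (by rintro rfl; exact hj hi)]

theorem expect_add_sum_sq [Nonempty α] (hx : ∀ j, IsHC η (x j)) (w : ι → ℝ) (S : Finset ι)
    (c : ℝ) :
    (𝔼 u : ι → α, (c + ∑ j ∈ S, x j (u j) * w j) ^ 2) = c ^ 2 + ∑ j ∈ S, wvar x w j := by
  induction S using Finset.induction_on generalizing c with
  | empty => simp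
  | insert j S hj ih =>
    rw [expect_sum_insert w hj (fun s => (c + s) ^ 2), Finset.sum_insert hj]
    have hu : ∀ u : ι → α, (𝔼 a : α, (c + (x j a * w j + ∑ i ∈ S, x i (u i) * w i)) ^ 2) =
        (c + ∑ i ∈ S, x i (u i) * w i) ^ 2 + wvar x w j := by
      intro u
      have := expect_add_mul_sq (c + ∑ i ∈ S, x i (u i) * w i) (w j) (x j)
      rw [(hx j).mean_eq_zero] at this
      rw [wvar]
      convert this using 1
      · exact Finset.expect_congr rfl fun a _ => by ring
      · ring
    simp only [hu, Finset.expect_add_distrib, ih, Fintype.expect_const]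
    ring

theorem expect_sum_sq [Nonempty α] (hx : ∀ j, IsHC η (x j)) (w : ι → ℝ) (S : Finset ι) :
    (𝔼 u : ι → α, (∑ j ∈ S, x j (u j) * w j) ^ 2) = ∑ j ∈ S, wvar x w j := by
  simpa using expect_add_sum_sq hx w S 0

/-- Hypercontractivity tensorizes. -/
theorem expect_add_mul_sum_pow_four [Nonempty α] (hx : ∀ j, IsHC η (x j)) (w : ι → ℝ)
    (S : Finset ι) (c : ℝ) :
    (𝔼 u : ι → α, (c + η * ∑ j ∈ S, x j (u j) * w j) ^ 4) ≤ (c ^ 2 + ∑ j ∈ S, wvar x w j) ^ 2 := by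
  induction S using Finset.induction_on generalizing c with
  | empty => simp; ring_nf; rfl
  | insert j S hj ih =>
    have hη := (hx j).1
    have hη1 := (hx j).2.1
    rw [expect_sum_insert w hj (fun s => (c + η * s) ^ 4), Finset.sum_insert hj]
    set m := wvar x w j with hm
    have hm0 : 0 ≤ m := wvar_nonneg x w j
    -- Hypercontractivity of the new variable alone, with the old partial sum frozen as part of the
    -- shift.
    have h1 : ∀ u : ι → α, (𝔼 a, (c + η * (x j a * w j + ∑ i ∈ S, x i (u i) * w i)) ^ 4) ≤
        (c + η * ∑ i ∈ S, x i (u i) * w i) ^ 4 +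
          2 * m * (c + η * ∑ i ∈ S, x i (u i) * w i) ^ 2 + m ^ 2 := by
      intro u
      have := (hx j).expect_scaled (c + η * ∑ i ∈ S, x i (u i) * w i) (w j)
      calc _ = 𝔼 a, (c + η * ∑ i ∈ S, x i (u i) * w i + η * (x j a * w j)) ^ 4 :=
            Finset.expect_congr rfl fun a _ => by ring
        _ ≤ _ := this
        _ = _ := by rw [hm, wvar]; ring
    -- The induction closes because the cross term carries η²V, which is at most the V appearing in
    -- the square on the right.
    have h2 : (𝔼 u : ι → α, (c + η * ∑ i ∈ S, x i (u i) * w i) ^ 2) =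
        c ^ 2 + η ^ 2 * ∑ i ∈ S, wvar x w i := by
      have := expect_add_sum_sq hx (fun i => η * w i) S c
      convert this using 1
      · refine Finset.expect_congr rfl fun u _ => ?_
        rw [Finset.mul_sum]; congr 2
        exact Finset.sum_congr rfl fun i _ => by ring
      · rw [Finset.mul_sum]; congr 1
        exact Finset.sum_congr rfl fun i _ => by rw [wvar, wvar]; ring
    refine (expect_mono h1).trans ?_
    rw [Finset.expect_add_distrib, Finset.expect_add_distrib, ← Finset.mul_expect, h2,
      Fintype.expect_const]
    have hV := sum_wvar_nonneg x w S
    have hη2 : η ^ 2 ≤ 1 := pow_le_one₀ hη.le hη1.le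
    have := ih c
    nlinarith [mul_nonneg hm0 (mul_nonneg hV (sub_nonneg.2 hη2))]

/-- Apply the tensorized inequality with shift ηc, so that η⁴ factors out on the left; on the right
the shift only shrinks. -/
theorem expect_add_sum_pow_four_le [Nonempty α] (hx : ∀ j, IsHC η (x j)) (hη : 0 < η)
    (hη1 : η < 1) (w : ι → ℝ) (S : Finset ι) (c : ℝ) :
    η ^ 4 * (𝔼 u : ι → α, (c + ∑ j ∈ S, x j (u j) * w j) ^ 4) ≤
      (c ^ 2 + ∑ j ∈ S, wvar x w j) ^ 2 := by
  have h := expect_add_mul_sum_pow_four hx w S (η * c)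
  have e : (𝔼 u : ι → α, (η * c + η * ∑ j ∈ S, x j (u j) * w j) ^ 4) =
      η ^ 4 * (𝔼 u : ι → α, (c + ∑ j ∈ S, x j (u j) * w j) ^ 4) := by
    rw [Finset.mul_expect]
    exact Finset.expect_congr rfl fun u _ => by ring
  rw [e] at h
  refine h.trans ?_
  have hV := sum_wvar_nonneg x w S
  have : (η * c) ^ 2 ≤ c ^ 2 := by
    rw [mul_pow]; exact mul_le_of_le_one_left (sq_nonneg c) (pow_le_one₀ hη.le hη1.le)
  gcongr

/-- Paley–Zygmund: a shifted sum is unlikely to be much smaller than its standard deviation. -/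
theorem expect_ind_add_sum_sq_lt [Nonempty α] (hx : ∀ j, IsHC η (x j)) (hη : 0 < η)
    (hη1 : η < 1) (w : ι → ℝ) (S : Finset ι) (hS : 0 < ∑ j ∈ S, wvar x w j) (c : ℝ) :
    (𝔼 u : ι → α, ind ((c + ∑ j ∈ S, x j (u j) * w j) ^ 2 < (∑ j ∈ S, wvar x w j) / 4)) ≤
      1 - η ^ 4 / 2 := by
  set V := ∑ j ∈ S, wvar x w j with hV
  set Z : (ι → α) → ℝ := fun u => c + ∑ j ∈ S, x j (u j) * w j with hZ
  set P := 𝔼 u : ι → α, ind (Z u ^ 2 < V / 4) with hP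
  change P ≤ _
  have hM : 0 < c ^ 2 + V := by positivity
  have h2 : (𝔼 u, Z u ^ 2) = c ^ 2 + V := expect_add_sum_sq hx w S c
  have h4 : η ^ 4 * (𝔼 u, Z u ^ 4) ≤ (c ^ 2 + V) ^ 2 := expect_add_sum_pow_four_le hx hη hη1 w S c
  have hcs := Finset.expect_mul_sq_le_sq_mul_sq (univ : Finset (ι → α)) (fun u => Z u ^ 2)
    (fun u => 1 - ind (Z u ^ 2 < V / 4))
  have e1 : (𝔼 u, (1 - ind (Z u ^ 2 < V / 4)) ^ 2) = 1 - P := by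
    rw [hP, ← Fintype.expect_const (ι := ι → α) (1 : ℝ), ← Finset.expect_sub_distrib]
    refine Finset.expect_congr rfl fun u _ => ?_
    by_cases h : Z u ^ 2 < V / 4
    · rw [ind_of h]; norm_num
    · rw [ind_of_not h]; norm_num
  -- The event Z² < V/4 accounts for at most a quarter of the second moment c² + V. Cauchy–Schwarz
  -- compares the remaining three quarters with the fourth moment, and (3/4)² = 9/16 exceeds 1/2.
  have e2 : c ^ 2 + V ≤ (c ^ 2 + V) / 4 + 𝔼 u, Z u ^ 2 * (1 - ind (Z u ^ 2 < V / 4)) := by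
    rw [← Fintype.expect_const (ι := ι → α) ((c ^ 2 + V) / 4), ← Finset.expect_add_distrib]
    refine h2.ge.trans (expect_mono fun u => ?_)
    by_cases h : Z u ^ 2 < V / 4
    · rw [ind_of h]; nlinarith [sq_nonneg c]
    · rw [ind_of_not h]; linarith
  rw [e1] at hcs
  have e3 : (𝔼 u, (Z u ^ 2) ^ 2) = 𝔼 u, Z u ^ 4 :=
    Finset.expect_congr rfl fun u _ => by ring
  rw [e3] at hcs
  have e4 : (3 / 4 * (c ^ 2 + V)) ^ 2 ≤ (𝔼 u, Z u ^ 2 * (1 - ind (Z u ^ 2 < V / 4))) ^ 2 := by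
    refine pow_le_pow_left₀ (by positivity) ?_ 2
    linarith
  have hP1 : 0 ≤ 1 - P := by
    rw [← e1]; exact Finset.expect_nonneg fun u _ => sq_nonneg _
  have e5 : η ^ 4 * (3 / 4 * (c ^ 2 + V)) ^ 2 ≤ (c ^ 2 + V) ^ 2 * (1 - P) :=
    calc η ^ 4 * (3 / 4 * (c ^ 2 + V)) ^ 2 ≤ η ^ 4 * ((𝔼 u, Z u ^ 4) * (1 - P)) := by
          gcongr; exact e4.trans hcs
      _ = (η ^ 4 * 𝔼 u, Z u ^ 4) * (1 - P) := by ring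
      _ ≤ _ := by gcongr
  have e6 : (c ^ 2 + V) ^ 2 * (9 / 16 * η ^ 4) ≤ (c ^ 2 + V) ^ 2 * (1 - P) := by linarith
  have := le_of_mul_le_mul_left e6 (by positivity)
  have : 0 < η ^ 4 := by positivity
  linarith

end Sums

/-! ### The critical index -/

section Decay

variable {ι : Type} [Fintype ι] [DecidableEq ι]

/-- The total weight outside `H`. -/
def tailSum (v : ι → ℝ) (H : Finset ι) : ℝ := ∑ j ∈ Hᶜ, v j

/-- There is a chain of `k` steps from `A` to `H` in each of which the weight outside shrinks
strictly and by a factor of at most `θ`. -/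
inductive Decays (v : ι → ℝ) (θ : ℝ) : ℕ → Finset ι → Finset ι → Prop
  | nil {A H : Finset ι} : A ⊆ H → Decays v θ 0 A H
  | cons {k : ℕ} {A A' H : Finset ι} : A ⊆ A' → tailSum v A' ≤ θ * tailSum v A →
      tailSum v A' < tailSum v A → Decays v θ k A' H → Decays v θ (k + 1) A H

variable {v : ι → ℝ} {θ : ℝ}

theorem tailSum_nonneg (hv : ∀ j, 0 ≤ v j) (H : Finset ι) : 0 ≤ tailSum v H :=
  Finset.sum_nonneg fun j _ => hv j

theorem tailSum_anti (hv : ∀ j, 0 ≤ v j) {A B : Finset ι} (h : A ⊆ B) :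
    tailSum v B ≤ tailSum v A :=
  Finset.sum_le_sum_of_subset_of_nonneg (Finset.compl_subset_compl.2 h) fun j _ _ => hv j

theorem tailSum_add_sum_sdiff {A B : Finset ι} (h : A ⊆ B) :
    tailSum v B + ∑ j ∈ B \ A, v j = tailSum v A := by
  rw [tailSum, tailSum, ← Finset.sum_union]
  · congr 1
    ext j
    simp only [mem_union, mem_compl, mem_sdiff]
    have := @h j
    tauto
  · rw [Finset.disjoint_left]
    intro j hj
    simp only [mem_compl, mem_sdiff] at hj ⊢
    tauto

theorem Decays.subset {k : ℕ} {A H : Finset ι} (h : Decays v θ k A H) : A ⊆ H := by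
  induction h with
  | nil h => exact h
  | cons h _ _ _ ih => exact h.trans ih

theorem Decays.mono {k : ℕ} {A H H' : Finset ι} (h : Decays v θ k A H) (hH : H ⊆ H') :
    Decays v θ k A H' := by
  induction h with
  | nil h => exact .nil (h.trans hH)
  | cons h1 h2 h3 _ ih => exact .cons h1 h2 h3 (ih hH)

theorem Decays.snoc {k : ℕ} {A H H' : Finset ι} (hv : ∀ j, 0 ≤ v j) (hθ : 0 ≤ θ)
    (h : Decays v θ k A H) (hH : H ⊆ H') (h1 : tailSum v H' ≤ θ * tailSum v H)
    (h2 : tailSum v H' < tailSum v H) : Decays v θ (k + 1) A H' := by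
  induction h with
  | nil h =>
    have := tailSum_anti hv h
    exact .cons (h.trans hH) (h1.trans (by gcongr)) (h2.trans_le this) (.nil subset_rfl)
  | cons h3 h4 h5 _ ih => exact .cons h3 h4 h5 (ih hH h1 h2)

theorem Decays.split {b : ℕ} (a : ℕ) {A H : Finset ι} (h : Decays v θ (a + b) A H) :
    ∃ B, Decays v θ a A B ∧ Decays v θ b B H := by
  induction a generalizing A with
  | zero => exact ⟨A, .nil subset_rfl, by simpa using h⟩
  | succ a ih =>
    rw [Nat.add_right_comm] at h
    cases h with
    | cons h1 h2 h3 h4 =>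
      obtain ⟨B, hB, hB'⟩ := ih h4
      exact ⟨B, .cons h1 h2 h3 hB, hB'⟩

theorem Decays.tailSum_le {k : ℕ} {A H : Finset ι} (hv : ∀ j, 0 ≤ v j) (hθ : 0 ≤ θ)
    (h : Decays v θ k A H) : tailSum v H ≤ θ ^ k * tailSum v A := by
  induction h with
  | nil h => simpa using tailSum_anti hv h
  | @cons k _ _ _ _ h2 _ _ ih =>
    refine ih.trans ?_
    rw [pow_succ, mul_assoc]
    gcongr

theorem Decays.tailSum_lt {k : ℕ} {A H : Finset ι} (hv : ∀ j, 0 ≤ v j)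
    (h : Decays v θ (k + 1) A H) : tailSum v H < tailSum v A := by
  cases h with
  | cons _ _ h3 h4 => exact (tailSum_anti hv h4.subset).trans_lt h3

/-- Merging m consecutive steps multiplies their factors; the decrease stays strict because m > 0.
-/
theorem Decays.group {r m : ℕ} {A H : Finset ι} (hv : ∀ j, 0 ≤ v j) (hθ : 0 ≤ θ) {θ' : ℝ}
    (hm : 0 < m) (hθ' : θ ^ m ≤ θ') (h : Decays v θ (r * m) A H) : Decays v θ' r A H := by
  induction r generalizing A with
  | zero => exact .nil h.subset
  | succ r ih =>
    rw [Nat.succ_mul, Nat.add_comm] at h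
    obtain ⟨B, hB, hB'⟩ := h.split
    refine .cons hB.subset ((hB.tailSum_le hv hθ).trans ?_) ?_ (ih hB')
    · have := tailSum_nonneg hv A
      gcongr
    · obtain ⟨m, rfl⟩ := Nat.exists_eq_succ_of_ne_zero hm.ne'
      exact hB.tailSum_lt hv

theorem tailSum_insert {H : Finset ι} {j : ι} (hj : j ∉ H) :
    tailSum v (insert j H) = tailSum v H - v j := by
  have := tailSum_add_sum_sdiff (v := v) (Finset.subset_insert j H)
  rw [Finset.insert_sdiff_cancel hj, Finset.sum_singleton] at this
  linarith

/-- A set of at most `d L` coordinates outside of which each of `d` weight vectors is either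
regular or has decayed along a chain of `L` steps. -/
theorem exists_regular_or_decays {d : ℕ} (v : Fin d → ι → ℝ) (hv : ∀ i j, 0 ≤ v i j) {ρ : ℝ}
    (hρ : 0 ≤ ρ) (hρ1 : ρ ≤ 1) (L : ℕ) :
    ∃ H : Finset ι, H.card ≤ d * L ∧ ∀ i, (∀ j ∉ H, v i j ≤ ρ * tailSum (v i) H) ∨
      Decays (v i) (1 - ρ) L ∅ H := by
  classical
  -- The largest total chain length N attainable with at most N head coordinates, each chain being
  -- capped at L. Maximality forces regularity wherever the cap is not reached.
  let P : ℕ → Prop := fun N => ∃ (H : Finset ι) (k : Fin d → ℕ), ∑ i, k i = N ∧ (∀ i, k i ≤ L) ∧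
    H.card ≤ N ∧ ∀ i, Decays (v i) (1 - ρ) (k i) ∅ H
  have hP0 : P 0 := ⟨∅, fun _ => 0, by simp, by simp, by simp, fun i => .nil subset_rfl⟩
  have hP := Nat.findGreatest_spec (P := P) (Nat.zero_le (d * L)) hP0
  have hN := Nat.findGreatest_le (P := P) (d * L)
  have hmax : ∀ N, P N → N ≤ d * L → N ≤ Nat.findGreatest P (d * L) :=
    fun N h1 h2 => Nat.le_findGreatest h2 h1
  set N := Nat.findGreatest P (d * L)
  obtain ⟨H, k, hk, hkL, hH, hdec⟩ := hP
  refine ⟨H, hH.trans hN, fun i => ?_⟩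
  rcases (hkL i).eq_or_lt with hi | hi
  · right; rw [← hi]; exact hdec i
  left
  by_contra! hreg
  obtain ⟨j, hj, hlt⟩ := hreg
  have hv' := tailSum_nonneg (hv i) H
  -- Adding the coordinate j that violates regularity removes more than a fraction ρ of the tail of
  -- halfspace i, so its chain grows by one; the other chains survive enlarging H.
  have hPN : P (N + 1) := by
    refine ⟨insert j H, Function.update k i (k i + 1), ?_, ?_, ?_, ?_⟩
    · rw [Finset.sum_update_of_mem (mem_univ i), ← hk,
        ← Finset.add_sum_erase univ k (mem_univ i), Finset.sdiff_singleton_eq_erase]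
      ring
    · intro i'
      by_cases h : i' = i
      · subst h; simpa using hi
      · simpa [h] using hkL i'
    · rw [Finset.card_insert_of_notMem hj]; omega
    · intro i'
      by_cases h : i' = i
      · subst h
        rw [Function.update_self]
        refine (hdec i').snoc (hv i') (by linarith) (Finset.subset_insert j H) ?_ ?_
        · rw [tailSum_insert hj]; nlinarith
        · rw [tailSum_insert hj]; nlinarith
      · rw [Function.update_of_ne h]
        exact (hdec i').mono (Finset.subset_insert j H)
  have hsum : N + 1 ≤ d * L := by
    rw [← hk]
    have : ∑ i', k i' < ∑ _i' : Fin d, L :=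
      Finset.sum_lt_sum (fun i' _ => hkL i') ⟨i, mem_univ i, hi⟩
    simpa using this
  have := hmax _ hPN hsum
  omega

end Decay

/-! ### Anticoncentration of the head under decaying weights -/

section Head

variable {ι α : Type} [Fintype α] [Fintype ι] [DecidableEq ι] {η : ℝ} {x : ι → α → ℝ}

/-- The head of a linear form whose weights decay is unlikely to be within `s` standard deviations
of the tail of any given point. -/
theorem Decays.small_ball [Nonempty α] (hx : ∀ j, IsHC η (x j)) (hη : 0 < η) (hη1 : η < 1)
    (w : ι → ℝ) {s : ℝ} (hs : 0 < s) {r : ℕ} {A H : Finset ι}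
    (h : Decays (wvar x w) (1 / (1 + 16 * s ^ 2)) r A H) (c : ℝ) :
    (𝔼 u : ι → α, ind ((c + ∑ j ∈ H \ A, x j (u j) * w j) ^ 2 ≤
      s ^ 2 * tailSum (wvar x w) H)) ≤ (1 - η ^ 4 / 2) ^ r + 1 / s ^ 2 := by
  have hq : 0 ≤ 1 - η ^ 4 / 2 := by
    have : η ^ 4 ≤ 1 := pow_le_one₀ hη.le hη1.le
    linarith
  have hv := wvar_nonneg x w
  induction h generalizing c with
  | nil h =>
    refine (expect_le_of_le fun u => ind_le_one _).trans ?_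
    have : 0 ≤ 1 / s ^ 2 := by positivity
    simpa using this
  | @cons r A A' H h1 h2 h3 h4 ih =>
    have hsplit := tailSum_add_sum_sdiff (v := wvar x w) h1
    set V := ∑ j ∈ A' \ A, wvar x w j with hV
    have hVpos : 0 < V := by linarith
    -- Losing the factor 1 + 16s² means that the block A' \ A has at least 16s² times the variance
    -- of all that follows.
    have hT' : 16 * s ^ 2 * tailSum (wvar x w) A' ≤ V := by
      rw [← hsplit, div_mul_eq_mul_div, le_div_iff₀ (by positivity)] at h2
      nlinarith
    have hTH := tailSum_anti hv h4.subset
    have hsub := h4.subset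
    set R : (ι → α) → ℝ := fun u => ∑ j ∈ H \ A', x j (u j) * w j with hR
    set B : (ι → α) → ℝ := fun u => ∑ j ∈ A' \ A, x j (u j) * w j with hB
    have hdec : ∀ u u' : ι → α, ∑ j ∈ H \ A, x j ((A' \ A).piecewise u' u j) * w j =
        B u' + R u := by
      intro u u'
      have : H \ A = (A' \ A) ∪ (H \ A') := by
        ext j
        simp only [mem_union, mem_sdiff]
        have := @h1 j
        have := @hsub j
        tauto
      rw [this, Finset.sum_union]
      · congr 1
        · exact Finset.sum_congr rfl fun j hj => by rw [Finset.piecewise_eq_of_mem _ _ _ hj]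
        · refine Finset.sum_congr rfl fun j hj => ?_
          rw [Finset.piecewise_eq_of_notMem]
          simp only [mem_sdiff] at hj ⊢
          tauto
      · rw [Finset.disjoint_left]
        intro j hj
        simp only [mem_sdiff] at hj ⊢
        tauto
    have hRvar : (𝔼 u, R u ^ 2) ≤ tailSum (wvar x w) A' := by
      rw [hR, expect_sum_sq hx w]
      refine Finset.sum_le_sum_of_subset_of_nonneg ?_ fun j _ _ => hv j
      intro j hj
      simp only [mem_sdiff, mem_compl] at hj ⊢
      tauto
    -- If the partial sum is at least √V/2 in absolute value, returning within s√T ≤ √V/4 of zero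
    -- requires R² ≥ V/16, while the second moment of R is at most V/(16s²).
    have hfar : ∀ c' : ℝ, V / 4 ≤ c' ^ 2 →
        (𝔼 u, ind ((c' + R u) ^ 2 ≤ s ^ 2 * tailSum (wvar x w) H)) ≤ 1 / s ^ 2 := by
      intro c' hc'
      refine (expect_ind_le (f := fun u => R u ^ 2) _ (c := V / 16) (by positivity)
        (fun u => sq_nonneg _) ?_).trans ?_
      · intro u hu
        have h5 : (c' + R u) ^ 2 ≤ V / 16 := by nlinarith
        have h6 : c' ^ 2 ≤ 2 * ((c' + R u) ^ 2 + R u ^ 2) := by nlinarith [sq_nonneg (c' + 2 * R u)]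
        nlinarith
      · rw [div_le_div_iff₀ (by positivity) (by positivity)]
        nlinarith
    rw [expect_resample (A' \ A)]
    simp only [hdec, ← add_assoc]
    -- Only the near case falls back on the induction hypothesis, so 1/s² is paid once and not once
    -- per block.
    have hnear : ∀ u' : ι → α,
        (𝔼 u, ind ((c + B u' + R u) ^ 2 ≤ s ^ 2 * tailSum (wvar x w) H)) ≤
          1 / s ^ 2 + (1 - η ^ 4 / 2) ^ r * ind ((c + B u') ^ 2 < V / 4) := by
      intro u'
      by_cases hc : (c + B u') ^ 2 < V / 4
      · rw [ind_of hc, mul_one]; exact (ih _).trans (add_comm _ _).le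
      · rw [ind_of_not hc, mul_zero, add_zero]; exact hfar _ (not_lt.1 hc)
    refine (expect_mono hnear).trans ?_
    rw [Finset.expect_add_distrib, Fintype.expect_const, ← Finset.mul_expect, pow_succ _ r,
      add_comm (_ * _)]
    gcongr
    exact expect_ind_add_sum_sq_lt hx hη hη1 w _ hVpos c

end Head

section SmallBall

open MeasureTheory

/-! ### Small ball probabilities of regular linear forms -/

/-- Taylor's bound for |z| ≤ 1; for larger |z| the right side is already at least 1. -/
theorem cos_le_quartic (z : ℝ) : Real.cos z ≤ 1 - z ^ 2 / 2 + z ^ 4 / 2 := by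
  rcases le_or_gt |z| 1 with h | h
  · have h1 := (abs_le.1 (Real.cos_bound h)).2
    have h2 : |z| ^ 4 = z ^ 4 := by rw [pow_abs, abs_of_nonneg (by positivity)]
    rw [h2] at h1
    have : 0 ≤ z ^ 4 := by positivity
    linarith
  · have h1 := Real.cos_le_one z
    have h2 : 1 ≤ z ^ 2 := by rw [← sq_abs]; nlinarith
    nlinarith

/-- The exponential `exp (-a² / 2)` as a Fourier integral. -/
theorem gaussian_eq_integral (a : ℝ) :
    ((Real.sqrt (2 * Real.pi) * Real.exp (-a ^ 2 / 2) : ℝ) : ℂ) =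
      ∫ ξ : ℝ, Complex.exp (Complex.I * a * ξ) * (Real.exp (-ξ ^ 2 / 2) : ℝ) := by
  have h := fourierIntegral_gaussian (b := 1 / 2) (by norm_num) (a : ℂ)
  have e : ∀ ξ : ℝ, ((Real.exp (-ξ ^ 2 / 2) : ℝ) : ℂ) = Complex.exp (-(1 / 2) * ξ ^ 2) := by
    intro ξ; push_cast; congr 1; ring
  simp only [e]
  rw [h]
  push_cast
  congr 1
  · rw [Real.sqrt_eq_rpow, Complex.ofReal_cpow (by positivity)]
    push_cast
    congr 1
    ring
  · congr 1; ring

variable {ι α : Type} [Fintype α] {η : ℝ} {x : ι → α → ℝ}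

/-- The characteristic function of `y`. -/
def charF (y : α → ℝ) (ξ : ℝ) : ℂ := 𝔼 a, Complex.exp (Complex.I * ξ * y a)

theorem norm_cexp_I_mul (r s : ℝ) : ‖Complex.exp (Complex.I * r * s)‖ = 1 := by
  rw [show Complex.I * r * s = ((r * s : ℝ) : ℂ) * Complex.I by push_cast; ring]
  exact Complex.norm_exp_ofReal_mul_I _

theorem norm_expect_le {β : Type*} [Fintype β] (f : β → ℂ) : ‖𝔼 a, f a‖ ≤ 𝔼 a, ‖f a‖ := by
  rw [Fintype.expect_eq_sum_div_card, Fintype.expect_eq_sum_div_card, norm_div,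
    Complex.norm_natCast]
  gcongr
  exact norm_sum_le _ _

theorem norm_charF_le_one [Nonempty α] (y : α → ℝ) (ξ : ℝ) : ‖charF y ξ‖ ≤ 1 :=
  (norm_expect_le _).trans (expect_le_of_le fun _ => (norm_cexp_I_mul _ _).le)

/-- Symmetrization: the squared modulus is the characteristic function of the difference of two
independent copies, which is real. -/
theorem norm_charF_sq (y : α → ℝ) (ξ : ℝ) :
    ‖charF y ξ‖ ^ 2 = 𝔼 a, 𝔼 a', Real.cos (ξ * (y a - y a')) := by
  have h1 : ((‖charF y ξ‖ ^ 2 : ℝ) : ℂ) =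
      𝔼 a, 𝔼 a', Complex.exp (Complex.I * (ξ * (y a - y a') : ℝ)) := by
    rw [Complex.ofReal_pow, ← Complex.mul_conj', charF, map_expect (starRingEnd ℂ)]
    rw [Finset.expect_mul_expect]
    refine Finset.expect_congr rfl fun a _ => Finset.expect_congr rfl fun a' _ => ?_
    rw [← Complex.exp_conj, ← Complex.exp_add]
    congr 1
    simp
    ring
  have h2 := congrArg Complex.re h1
  rw [Complex.ofReal_re] at h2
  rw [h2]
  have hre : ∀ f : α → ℂ, (𝔼 a, f a).re = 𝔼 a, (f a).re := fun f => by
    rw [Fintype.expect_eq_sum_div_card, Fintype.expect_eq_sum_div_card, Complex.div_natCast_re,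
      Complex.re_sum]
  rw [hre]
  refine Finset.expect_congr rfl fun a _ => ?_
  rw [hre]
  refine Finset.expect_congr rfl fun a' _ => ?_
  rw [mul_comm, Complex.exp_ofReal_mul_I_re]

/-- Apply `cos_le_quartic` to the symmetrized form. The mixed term vanishes since the mean is zero,
and (y - y')⁴ ≤ 8(y⁴ + y'⁴). -/
theorem norm_charF_sq_le [Nonempty α] (y : α → ℝ) (hy : (𝔼 a, y a) = 0) (ξ : ℝ) :
    ‖charF y ξ‖ ^ 2 ≤
      Real.exp (-(ξ ^ 2 * 𝔼 a, y a ^ 2) + 8 * ξ ^ 4 * 𝔼 a, y a ^ 4) := by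
  refine le_trans ?_ (Real.add_one_le_exp _)
  rw [norm_charF_sq]
  have hpt : ∀ a a', Real.cos (ξ * (y a - y a')) ≤
      1 - ξ ^ 2 / 2 * (y a ^ 2 + y a' ^ 2) + ξ ^ 2 * (y a * y a') +
        8 * ξ ^ 4 * (y a ^ 4 + y a' ^ 4) / 2 := by
    intro a a'
    refine (cos_le_quartic _).trans ?_
    have h8 : (y a - y a') ^ 4 ≤ 8 * (y a ^ 4 + y a' ^ 4) := by
      nlinarith [sq_nonneg (y a ^ 2 - y a' ^ 2), sq_nonneg (y a + y a'), sq_nonneg (y a - y a'),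
        mul_nonneg (sq_nonneg (y a + y a')) (sq_nonneg (y a - y a')),
        sq_nonneg ((y a + y a') ^ 2)]
    have : 0 ≤ ξ ^ 4 := by positivity
    have := mul_le_mul_of_nonneg_left h8 this
    nlinarith
  calc (𝔼 a, 𝔼 a', Real.cos (ξ * (y a - y a')))
      ≤ 𝔼 a, 𝔼 a', (1 - ξ ^ 2 / 2 * (y a ^ 2 + y a' ^ 2) + ξ ^ 2 * (y a * y a') +
        8 * ξ ^ 4 * (y a ^ 4 + y a' ^ 4) / 2) := expect_mono fun a => expect_mono fun a' => hpt a a'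
    _ = _ := by
      simp only [Finset.expect_add_distrib, Finset.expect_sub_distrib, Fintype.expect_const,
        ← Finset.mul_expect, ← Finset.expect_div, hy, mul_zero, Finset.expect_const_zero]
      ring

theorem expect_sum_cexp [Fintype ι] [DecidableEq ι] (w : ι → ℝ) (c lam ξ : ℝ) :
    (𝔼 u : ι → α, Complex.exp (Complex.I * (((c + ∑ j, x j (u j) * w j) / lam : ℝ) : ℂ) * ξ)) =
      Complex.exp (Complex.I * ((c / lam : ℝ) : ℂ) * ξ) *
        ∏ j, charF (x j) (w j * ξ / lam) := by
  simp only [charF]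
  rw [← expect_pi_prod, Finset.mul_expect]
  refine Finset.expect_congr rfl fun u _ => ?_
  rw [← Complex.exp_sum, ← Complex.exp_add]
  congr 1
  push_cast
  rw [add_div, mul_add, add_mul, Finset.sum_div, Finset.mul_sum, Finset.sum_mul]
  congr 1
  exact Finset.sum_congr rfl fun j _ => by ring

/-- Factors outside T have modulus at most 1 and are dropped. In the squared product the quadratic
exponent is -ξ²/ε², and for |ξ| ≤ 1/ε the quartic correction 8δξ⁴/ε⁴ ≤ ξ⁴/2 eats at most half of it.
-/
theorem norm_prod_charF_le [Fintype ι] [DecidableEq ι] [Nonempty α] (hx : ∀ j, IsHC η (x j))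
    (w : ι → ℝ) (T : Finset ι) {V δ ε : ℝ} (hV : 0 < V) (hT : ∑ j ∈ T, wvar x w j = V)
    (hq : ∑ j ∈ T, w j ^ 4 * (𝔼 a, x j a ^ 4) ≤ δ * V ^ 2) (hε : 0 < ε)
    (hδ : 16 * δ ≤ ε ^ 4) {ξ : ℝ} (hξ : ξ ^ 2 * ε ^ 2 ≤ 1) :
    ‖∏ j, charF (x j) (w j * ξ / (ε * √V))‖ ≤ Real.exp (-(1 / (4 * ε ^ 2)) * ξ ^ 2) := by
  rw [norm_prod]
  have h1 : ∏ j, ‖charF (x j) (w j * ξ / (ε * √V))‖ ≤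
      ∏ j ∈ T, ‖charF (x j) (w j * ξ / (ε * √V))‖ := by
    rw [← Finset.prod_mul_prod_compl T]
    exact mul_le_of_le_one_right (Finset.prod_nonneg fun j _ => norm_nonneg _)
      (Finset.prod_le_one (fun j _ => norm_nonneg _) fun j _ => norm_charF_le_one _ _)
  refine h1.trans ?_
  refine (sq_le_sq₀ (Finset.prod_nonneg fun j _ => norm_nonneg _) (Real.exp_pos _).le).1 ?_
  rw [← Finset.prod_pow]
  refine (Finset.prod_le_prod (fun j _ => sq_nonneg _)
    fun j _ => norm_charF_sq_le (x j) (hx j).mean_eq_zero _).trans ?_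
  rw [← Real.exp_sum, ← Real.exp_nat_mul, Real.exp_le_exp]
  have hsq : √V ^ 2 = V := Real.sq_sqrt hV.le
  have e : ∀ j, -((w j * ξ / (ε * √V)) ^ 2 * 𝔼 a, x j a ^ 2) +
      8 * (w j * ξ / (ε * √V)) ^ 4 * (𝔼 a, x j a ^ 4) =
      -(ξ ^ 2 / (ε ^ 2 * V)) * wvar x w j +
        8 * ξ ^ 4 / (ε ^ 4 * V ^ 2) * (w j ^ 4 * 𝔼 a, x j a ^ 4) := by
    intro j
    have h4 : √V ^ 4 = V ^ 2 := by rw [show √V ^ 4 = (√V ^ 2) ^ 2 by ring, hsq]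
    rw [wvar, div_pow, div_pow, mul_pow ε, mul_pow ε, hsq, h4]
    ring
  simp only [e]
  rw [Finset.sum_add_distrib, ← Finset.mul_sum, ← Finset.mul_sum, hT]
  have h2 : 8 * ξ ^ 4 / (ε ^ 4 * V ^ 2) * ∑ j ∈ T, w j ^ 4 * (𝔼 a, x j a ^ 4) ≤
      8 * ξ ^ 4 / (ε ^ 4 * V ^ 2) * (δ * V ^ 2) := by gcongr
  have h3 : 8 * ξ ^ 4 / (ε ^ 4 * V ^ 2) * (δ * V ^ 2) = 8 * ξ ^ 4 * δ / ε ^ 4 := by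
    field_simp
  have h4 : 8 * ξ ^ 4 * δ / ε ^ 4 ≤ ξ ^ 2 / (2 * ε ^ 2) := by
    rw [div_le_div_iff₀ (by positivity) (by positivity)]
    have h5 : 0 ≤ ξ ^ 4 * ε ^ 2 := by positivity
    have h6 := mul_le_mul_of_nonneg_left hδ h5
    have h7 : ξ ^ 2 * ε ^ 4 * (ξ ^ 2 * ε ^ 2) ≤ ξ ^ 2 * ε ^ 4 * 1 := by gcongr
    nlinarith
  have h5 : -(ξ ^ 2 / (ε ^ 2 * V)) * V = -(ξ ^ 2 / ε ^ 2) := by field_simp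
  rw [h5]
  have h6 : ((2 : ℕ) : ℝ) * (-(1 / (4 * ε ^ 2)) * ξ ^ 2) = -(ξ ^ 2 / ε ^ 2) + ξ ^ 2 / (2 * ε ^ 2) := by
    push_cast; field_simp; ring
  rw [h6]
  linarith

/-- A regular linear form of standard deviation `σ` is unlikely to be within `ε σ` of any given
point. -/
theorem regular_small_ball [Fintype ι] [DecidableEq ι] [Nonempty α] (hx : ∀ j, IsHC η (x j))
    (w : ι → ℝ) (T : Finset ι) {V δ ε : ℝ} (hV : 0 < V) (hT : ∑ j ∈ T, wvar x w j = V)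
    (hq : ∑ j ∈ T, w j ^ 4 * (𝔼 a, x j a ^ 4) ≤ δ * V ^ 2) (hε : 0 < ε) (hε1 : ε ≤ 1)
    (hδ : 16 * δ ≤ ε ^ 4) (c : ℝ) :
    (𝔼 u : ι → α, Real.exp (-((c + ∑ j, x j (u j) * w j) / (ε * √V)) ^ 2 / 2)) ≤ 8 * ε := by
  set lam := ε * √V with hlam
  set Y : (ι → α) → ℝ := fun u => (c + ∑ j, x j (u j) * w j) / lam with hY
  -- The Gaussian test function is written as a Fourier integral, which turns its expectation into
  -- an integral of the characteristic function of Y against a Gaussian.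
  set G : ℝ → ℂ := fun ξ => (𝔼 u, Complex.exp (Complex.I * (Y u : ℂ) * ξ)) *
    (Real.exp (-ξ ^ 2 / 2) : ℝ) with hG
  have hgi : Integrable (fun ξ : ℝ => Real.exp (-ξ ^ 2 / 2)) := by
    have := integrable_exp_neg_mul_sq (b := 1 / 2) (by norm_num)
    refine this.congr (Filter.Eventually.of_forall fun ξ => ?_)
    simp only; congr 1; ring
  have hint : ∀ u, Integrable (fun ξ : ℝ => Complex.exp (Complex.I * (Y u : ℂ) * ξ) *
      (Real.exp (-ξ ^ 2 / 2) : ℝ)) := by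
    intro u
    refine hgi.mono' (by fun_prop) (Filter.Eventually.of_forall fun ξ => ?_)
    rw [norm_mul, norm_cexp_I_mul, one_mul, Complex.norm_real, Real.norm_eq_abs, Real.abs_exp]
  have h1 : ((√(2 * Real.pi) * (𝔼 u, Real.exp (-(Y u) ^ 2 / 2)) : ℝ) : ℂ) = ∫ ξ, G ξ := by
    have hc : (((𝔼 u, √(2 * Real.pi) * Real.exp (-(Y u) ^ 2 / 2)) : ℝ) : ℂ) =
        𝔼 u, ((√(2 * Real.pi) * Real.exp (-(Y u) ^ 2 / 2) : ℝ) : ℂ) := by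
      rw [Fintype.expect_eq_sum_div_card, Fintype.expect_eq_sum_div_card]
      push_cast
      rfl
    rw [Finset.mul_expect, hc]
    simp only [gaussian_eq_integral, hG]
    simp only [Fintype.expect_eq_sum_div_card]
    rw [← integral_finsetSum _ (fun u _ => hint u), ← integral_div]
    congr 1
    ext ξ
    rw [div_mul_eq_mul_div, Finset.sum_mul]
  have hbi : Integrable (fun ξ : ℝ => Real.exp (-(1 / (4 * ε ^ 2)) * ξ ^ 2) +
      4 * ε ^ 2 * Real.exp (-(1 / 4) * ξ ^ 2)) :=
    (integrable_exp_neg_mul_sq (by positivity)).add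
      ((integrable_exp_neg_mul_sq (by norm_num)).const_mul _)
  have hbound : ∀ ξ, ‖G ξ‖ ≤ Real.exp (-(1 / (4 * ε ^ 2)) * ξ ^ 2) +
      4 * ε ^ 2 * Real.exp (-(1 / 4) * ξ ^ 2) := by
    intro ξ
    rw [hG, norm_mul, hY, expect_sum_cexp, norm_mul, norm_cexp_I_mul, one_mul, Complex.norm_real,
      Real.norm_eq_abs, Real.abs_exp]
    -- Low frequencies use the decay of the characteristic function; high frequencies bound it by 1
    -- and use the Gaussian weight.
    rcases le_or_gt (ξ ^ 2 * ε ^ 2) 1 with h | h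
    · have h2 := norm_prod_charF_le hx w T hV hT hq hε hδ h
      have h3 : Real.exp (-ξ ^ 2 / 2) ≤ 1 := by
        rw [Real.exp_le_one_iff]; nlinarith [sq_nonneg ξ]
      have h4 : 0 ≤ 4 * ε ^ 2 * Real.exp (-(1 / 4) * ξ ^ 2) := by positivity
      calc _ ≤ Real.exp (-(1 / (4 * ε ^ 2)) * ξ ^ 2) * 1 := by gcongr
        _ ≤ _ := by linarith
    · have h2 : ‖∏ j, charF (x j) (w j * ξ / lam)‖ ≤ 1 := by
        rw [norm_prod]
        exact Finset.prod_le_one (fun j _ => norm_nonneg _) fun j _ => norm_charF_le_one _ _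
      -- Half of the exponent is spent on exp(-ξ²/4) ≤ 4/ξ² < 4ε²; the other half keeps the bound
      -- integrable.
      have h3 : Real.exp (-ξ ^ 2 / 2) ≤ 4 * ε ^ 2 * Real.exp (-(1 / 4) * ξ ^ 2) := by
        have e : Real.exp (-ξ ^ 2 / 2) = Real.exp (-(ξ ^ 2 / 4)) * Real.exp (-(1 / 4) * ξ ^ 2) := by
          rw [← Real.exp_add]; congr 1; ring
        rw [e]
        gcongr
        rw [Real.exp_neg]
        have h4 : ξ ^ 2 / 4 ≤ Real.exp (ξ ^ 2 / 4) := by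
          have := Real.add_one_le_exp (ξ ^ 2 / 4); linarith
        refine inv_le_of_inv_le₀ (by positivity) (le_trans ?_ h4)
        rw [inv_le_iff_one_le_mul₀ (by positivity)]
        nlinarith
      calc _ ≤ 1 * Real.exp (-ξ ^ 2 / 2) := by gcongr
        _ ≤ 4 * ε ^ 2 * Real.exp (-(1 / 4) * ξ ^ 2) := by linarith
        _ ≤ _ := le_add_of_nonneg_left (Real.exp_pos _).le
  have h2 := norm_integral_le_of_norm_le hbi (Filter.Eventually.of_forall hbound)
  rw [← h1, Complex.norm_real, integral_add (integrable_exp_neg_mul_sq (by positivity))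
    ((integrable_exp_neg_mul_sq (by norm_num)).const_mul _), integral_const_mul, integral_gaussian,
    integral_gaussian] at h2
  have hpi := Real.pi_gt_three
  have h3 : √(Real.pi / (1 / (4 * ε ^ 2))) = √(2 * Real.pi) * √2 * ε := by
    rw [← Real.sqrt_mul (by positivity), ← Real.sqrt_sq hε.le, ← Real.sqrt_mul (by positivity),
      Real.sqrt_sq hε.le]
    congr 1; field_simp; ring
  have h4 : √(Real.pi / (1 / 4)) = √(2 * Real.pi) * √2 := by
    rw [← Real.sqrt_mul (by positivity)]
    congr 1; ring
  rw [h3, h4, Real.norm_eq_abs] at h2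
  have h5 := (le_abs_self _).trans h2
  have h6 : 0 < √(2 * Real.pi) := by positivity
  have h7 : √(2 * Real.pi) * (𝔼 u, Real.exp (-(Y u) ^ 2 / 2)) ≤
      √(2 * Real.pi) * (√2 * ε + 4 * ε ^ 2 * √2) := by linarith
  refine (le_of_mul_le_mul_left h7 h6).trans ?_
  have h8 : √2 ≤ 1.5 := by
    rw [Real.sqrt_le_left (by norm_num)]; norm_num
  have h9 : ε ^ 2 ≤ ε := by nlinarith
  have h10 : 0 ≤ √2 := Real.sqrt_nonneg 2
  nlinarith

end SmallBall

/-! ### Laws of finitely many coordinates -/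

/-- Only finitely many values of the coordinates in S occur, so a function of them is a finite
combination of the indicators whose expectations agree. Coordinates off S are normalized to 0 to
make these values unique. -/
theorem expect_eq_of_marginal {β γ : Type} [Fintype β] [Fintype γ] {n : ℕ}
    (S : Finset (Fin n)) (y : β → Fin n → ℝ) (x : γ → Fin n → ℝ)
    (h : ∀ v : Fin n → ℝ, (𝔼 z, ind (∀ j ∈ S, y z j = v j)) = 𝔼 u, ind (∀ j ∈ S, x u j = v j))
    (Q : (Fin n → ℝ) → ℝ) (hQ : ∀ v v' : Fin n → ℝ, (∀ j ∈ S, v j = v' j) → Q v = Q v') :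
    (𝔼 z, Q (y z)) = 𝔼 u, Q (x u) := by
  classical
  set W : Finset (Fin n → ℝ) := univ.image (fun z => S.piecewise (y z) 0) ∪
    univ.image (fun u => S.piecewise (x u) 0) with hW
  have hW0 : ∀ v ∈ W, ∀ j ∉ S, v j = 0 := by
    intro v hv j hj
    simp only [hW, mem_union, mem_image, mem_univ, true_and] at hv
    rcases hv with ⟨z, rfl⟩ | ⟨z, rfl⟩ <;> simp [hj]
  have key : ∀ v : Fin n → ℝ, S.piecewise v 0 ∈ W →
      Q v = ∑ v' ∈ W, ind (∀ j ∈ S, v j = v' j) * Q v' := by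
    intro v hv
    rw [Finset.sum_eq_single_of_mem _ hv]
    · rw [ind_of, one_mul]
      · exact hQ _ _ fun j hj => by simp [hj]
      · intro j hj; simp [hj]
    · intro v' hv' hne
      rw [ind_of_not, zero_mul]
      intro hall
      apply hne
      ext j
      by_cases hj : j ∈ S
      · simp [hj, hall j hj]
      · simp [hj, hW0 v' hv' j hj]
  have e1 : ∀ z, Q (y z) = ∑ v' ∈ W, ind (∀ j ∈ S, y z j = v' j) * Q v' := fun z =>
    key _ (mem_union_left _ (mem_image_of_mem _ (mem_univ z)))
  have e2 : ∀ u, Q (x u) = ∑ v' ∈ W, ind (∀ j ∈ S, x u j = v' j) * Q v' := fun u =>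
    key _ (mem_union_right _ (mem_image_of_mem _ (mem_univ u)))
  simp only [e1, e2, Finset.expect_sum_comm, ← Finset.expect_mul, h]

section Marginals

variable {n b : ℕ} {Ω : Fin n → Bits b → ℝ} {σ : Type} [Fintype σ]

theorem expect_ind_productSample (S : Finset (Fin n)) (v : Fin n → ℝ) :
    (𝔼 u : Fin n → Bits b, ind (∀ j ∈ S, productSample Ω u j = v j)) =
      ∏ j ∈ S, prob (fun a => Ω j a = v j) := by
  classical
  have h1 : ∀ u : Fin n → Bits b, ind (∀ j ∈ S, productSample Ω u j = v j) =
      ∏ j, if j ∈ S then ind (Ω j (u j) = v j) else 1 := by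
    intro u
    rw [Finset.prod_ite_mem, Finset.univ_inter]
    by_cases h : ∀ j ∈ S, productSample Ω u j = v j
    · rw [ind_of h]
      exact (Finset.prod_eq_one fun j hj => ind_of (h j hj)).symm
    · rw [ind_of_not h]
      push Not at h
      obtain ⟨j, hj, hne⟩ := h
      exact (Finset.prod_eq_zero hj (ind_of_not hne)).symm
  simp only [h1]
  rw [expect_pi_prod (fun j a => if j ∈ S then ind (Ω j a = v j) else 1)]
  rw [← Finset.univ_inter S, ← Finset.prod_ite_mem]
  refine Finset.prod_congr rfl fun j _ => ?_
  by_cases hj : j ∈ S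
  · simp [hj, prob_eq_expect]
  · simp [hj]

/-- A `k`-wise independent vector has the same expectation as the product distribution on functions
of at most `k` coordinates. -/
theorem IsKWise.expect_eq {k : ℕ} {H : Finset (Fin n)} {y : σ → Fin n → ℝ}
    (hy : IsKWise k Ω H y) {S : Finset (Fin n)} (hS : S ⊆ H) (hk : S.card ≤ k)
    (Q : (Fin n → ℝ) → ℝ) (hQ : ∀ v v' : Fin n → ℝ, (∀ j ∈ S, v j = v' j) → Q v = Q v') :
    (𝔼 z, Q (y z)) = 𝔼 u, Q (productSample Ω u) := by
  refine expect_eq_of_marginal S y (productSample Ω) (fun v => ?_) Q hQ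
  rw [expect_ind_productSample, ← hy S hS hk v, prob_eq_expect]

end Marginals

/-! ### Replacing the buckets one by one -/

section Hybrid

variable {n b t : ℕ} {Ω : Fin n → Bits b → ℝ} {σ : Type}

/-- The output of the generator for a fixed hash function. -/
def fillBuckets (h : Fin n → Fin t) (gen : Finset (Fin n) → σ → Fin n → ℝ) (z : Fin t → σ) :
    Fin n → ℝ := fun j => gen (bucket h (h j)) (z (h j)) j

/-- The buckets in `A` are filled by the generator, the others by the product distribution. -/
def hybrid (Ω : Fin n → Bits b → ℝ) (h : Fin n → Fin t) (gen : Finset (Fin n) → σ → Fin n → ℝ)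
    (A : Finset (Fin t)) (z : Fin t → σ) (u : Fin n → Bits b) : Fin n → ℝ :=
  fun j => if h j ∈ A then fillBuckets h gen z j else productSample Ω u j

theorem mem_bucket {h : Fin n → Fin t} {l : Fin t} {j : Fin n} : j ∈ bucket h l ↔ h j = l := by
  simp [bucket]

theorem hybrid_empty (h : Fin n → Fin t) (gen : Finset (Fin n) → σ → Fin n → ℝ) (z : Fin t → σ)
    (u : Fin n → Bits b) : hybrid Ω h gen ∅ z u = productSample Ω u := by
  ext j; simp [hybrid]

theorem hybrid_univ (h : Fin n → Fin t) (gen : Finset (Fin n) → σ → Fin n → ℝ) (z : Fin t → σ)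
    (u : Fin n → Bits b) : hybrid Ω h gen univ z u = fillBuckets h gen z := by
  ext j; simp [hybrid]

variable [Fintype σ] [Nonempty σ]

/-- Resample just the bucket l: everything outside it becomes a frozen `base`, the same in both
hybrids, so the one-bucket estimate applies pointwise. -/
theorem hybrid_step (h : Fin n → Fin t) (gen : Finset (Fin n) → σ → Fin n → ℝ)
    {A : Finset (Fin t)} {l : Fin t} (hl : l ∉ A) (Q : (Fin n → ℝ) → ℝ) {e : ℝ}
    (he : ∀ base : Fin n → ℝ,
      |(𝔼 w, Q ((bucket h l).piecewise (gen (bucket h l) w) base)) -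
        𝔼 u, Q ((bucket h l).piecewise (productSample Ω u) base)| ≤ e) :
    |(𝔼 z, 𝔼 u, Q (hybrid Ω h gen (insert l A) z u)) - 𝔼 z, 𝔼 u, Q (hybrid Ω h gen A z u)| ≤ e := by
  have h1 : (𝔼 z, 𝔼 u, Q (hybrid Ω h gen (insert l A) z u)) =
      𝔼 z, 𝔼 u, 𝔼 w, Q ((bucket h l).piecewise (gen (bucket h l) w) (hybrid Ω h gen A z u)) := by
    rw [expect_resample_update l]
    refine Finset.expect_congr rfl fun z _ => ?_
    rw [Finset.expect_comm]
    refine Finset.expect_congr rfl fun u _ => Finset.expect_congr rfl fun w _ => ?_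
    congr 1
    ext j
    by_cases hj : h j = l
    · subst hj
      rw [Finset.piecewise_eq_of_mem _ _ _ (mem_bucket.2 rfl)]
      simp [hybrid, fillBuckets]
    · rw [Finset.piecewise_eq_of_notMem _ _ _ (by rwa [mem_bucket])]
      simp [hybrid, fillBuckets, hj]
  have h2 : (𝔼 z, 𝔼 u, Q (hybrid Ω h gen A z u)) =
      𝔼 z, 𝔼 u, 𝔼 u', Q ((bucket h l).piecewise (productSample Ω u') (hybrid Ω h gen A z u)) := by
    refine Finset.expect_congr rfl fun z _ => ?_
    rw [expect_resample (bucket h l), Finset.expect_comm]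
    refine Finset.expect_congr rfl fun u _ => Finset.expect_congr rfl fun u' _ => ?_
    congr 1
    ext j
    by_cases hj : j ∈ bucket h l
    · have : h j ∉ A := by rw [mem_bucket.1 hj]; exact hl
      simp [hybrid, productSample, hj, this]
    · simp [hybrid, productSample, hj]
  rw [h1, h2, ← Finset.expect_sub_distrib]
  refine abs_expect_le_of_le fun z => ?_
  rw [← Finset.expect_sub_distrib]
  exact abs_expect_le_of_le fun u => he _

theorem expect_fillBuckets_sub_le (h : Fin n → Fin t) (gen : Finset (Fin n) → σ → Fin n → ℝ)
    (Q : (Fin n → ℝ) → ℝ) (e : Fin t → ℝ)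
    (he : ∀ l, ∀ base : Fin n → ℝ,
      |(𝔼 w, Q ((bucket h l).piecewise (gen (bucket h l) w) base)) -
        𝔼 u, Q ((bucket h l).piecewise (productSample Ω u) base)| ≤ e l) :
    |(𝔼 z, Q (fillBuckets h gen z)) - 𝔼 u, Q (productSample Ω u)| ≤ ∑ l, e l := by
  have key : ∀ A : Finset (Fin t), |(𝔼 z, 𝔼 u, Q (hybrid Ω h gen A z u)) -
      𝔼 u, Q (productSample Ω u)| ≤ ∑ l ∈ A, e l := by
    intro A
    induction A using Finset.induction_on with
    | empty => simp [hybrid_empty]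
    | insert l A hl ih =>
      rw [Finset.sum_insert hl]
      have := hybrid_step (Ω := Ω) h gen hl Q (he l)
      exact (abs_sub_le _ _ _).trans (add_le_add this ih)
  have := key univ
  simpa [hybrid_univ] using this

/-- The generator has the same expectation as the product distribution on functions of at most five
coordinates in each bucket. -/
theorem expect_fillBuckets_eq (h : Fin n → Fin t) (gen : Finset (Fin n) → σ → Fin n → ℝ)
    (hgen : ∀ H, IsKWise 5 Ω H (gen H)) (S : Finset (Fin n))
    (hS : ∀ l, (bucket h l ∩ S).card ≤ 5) (Q : (Fin n → ℝ) → ℝ)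
    (hQ : ∀ v v' : Fin n → ℝ, (∀ j ∈ S, v j = v' j) → Q v = Q v') :
    (𝔼 z, Q (fillBuckets h gen z)) = 𝔼 u, Q (productSample Ω u) := by
  have := expect_fillBuckets_sub_le (Ω := Ω) h gen Q 0 fun l base => by
    rw [(hgen (bucket h l)).expect_eq Finset.inter_subset_left (hS l)
      (fun y => Q ((bucket h l).piecewise y base)) ?_]
    · simp
    · intro v v' hv
      refine hQ _ _ fun j hj => ?_
      by_cases hjl : j ∈ bucket h l
      · simp [hjl, hv j (mem_inter.2 ⟨hjl, hj⟩)]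
      · simp [hjl]
  simpa [sub_eq_zero] using this

end Hybrid

/-! ### One bucket: Taylor expansion and moment matching -/

section Bucket

variable {n b : ℕ} {Ω : Fin n → Bits b → ℝ} {σ : Type} [Fintype σ]

/-- The vector `y` restricted to `T`. -/
def restr (T : Finset (Fin n)) (y : Fin n → ℝ) : Fin n → ℝ := T.piecewise y 0

/-- The count behind five-wise independence: one head coordinate in the coefficient plus at most
four coordinates in the monomial. -/
theorem IsKWise.expect_monomial {B H T : Finset (Fin n)} {y : σ → Fin n → ℝ}
    (hy : IsKWise 5 Ω B y) (hH : (B ∩ H).card ≤ 1) (hT : T ⊆ B) {k : ℕ} (hk : k ≤ 4)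
    (r : Fin k → Fin n) (c : (Fin n → ℝ) → ℝ)
    (hc : ∀ v v' : Fin n → ℝ, (∀ j ∈ B ∩ H, v j = v' j) → c v = c v') :
    (𝔼 z, c (y z) * ∏ i, restr T (y z) (r i)) =
      𝔼 u, c (productSample Ω u) * ∏ i, restr T (productSample Ω u) (r i) := by
  refine hy.expect_eq (S := (B ∩ H) ∪ (univ.image r ∩ T)) ?_ ?_
    (fun y => c y * ∏ i, restr T y (r i)) ?_
  · exact Finset.union_subset Finset.inter_subset_left (Finset.inter_subset_right.trans hT)
  · refine (Finset.card_union_le _ _).trans ?_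
    have : (univ.image r ∩ T).card ≤ k :=
      (Finset.card_le_card Finset.inter_subset_left).trans (Finset.card_image_le.trans (by simp))
    omega
  · intro v v' hv
    rw [hc v v' fun j hj => hv j (mem_union_left _ hj)]
    congr 1
    refine Finset.prod_congr rfl fun i _ => ?_
    by_cases hi : r i ∈ T
    · simp [restr, hi, hv (r i) (mem_union_right _ (mem_inter.2 ⟨mem_image_of_mem r (mem_univ i), hi⟩))]
    · simp [restr, hi]

theorem IsKWise.expect_form_pow_four {B T : Finset (Fin n)} {y : σ → Fin n → ℝ}
    (hy : IsKWise 5 Ω B y) (hT : T ⊆ B) (w : Fin n → ℝ) :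
    (𝔼 z, (∑ j, restr T (y z) j * w j) ^ 4) =
      𝔼 u, (∑ j, restr T (productSample Ω u) j * w j) ^ 4 := by
  have key : ∀ y : Fin n → ℝ, (∑ j, restr T y j * w j) ^ 4 =
      ∑ r : Fin 4 → Fin n, (∏ i, w (r i)) * ∏ i, restr T y (r i) := fun y => by
    rw [Fintype.sum_pow]
    exact Finset.sum_congr rfl fun r _ => by rw [Finset.prod_mul_distrib, mul_comm]
  simp only [key, Finset.expect_sum_comm]
  refine Finset.sum_congr rfl fun r _ => ?_
  exact hy.expect_monomial (H := ∅) (by simp) hT le_rfl r (fun _ => ∏ i, w (r i))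
    (fun _ _ _ => rfl)

theorem restr_eq_sum (T : Finset (Fin n)) (y : Fin n → ℝ) :
    restr T y = ∑ j, restr T y j • (Pi.single j 1 : Fin n → ℝ) := by
  ext i
  simp [Finset.sum_apply, Pi.single_apply]

/-- Only the fourth derivative along y itself enters the integral remainder; the factor 1/3! and the
weight (1 - t)³ are bounded by 1. -/
theorem abs_taylor_remainder_le {E : Type*} [NormedAddCommGroup E] [NormedSpace ℝ E] {f : E → ℝ}
    (hf : ContDiff ℝ 4 f) (x y : E) {M : ℝ}
    (hM : ∀ t : ℝ, |iteratedFDeriv ℝ 4 f (x + t • y) (fun _ => y)| ≤ M) :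
    |f (x + y) - ∑ k ∈ Finset.range 4,
      ((k.factorial : ℝ)⁻¹ * iteratedFDeriv ℝ k f x (fun _ => y))| ≤ M := by
  have h := map_add_eq_sum_add_integral_iteratedFDeriv (n := 3) (f := f) (x := x) (y := y)
    (fun t _ => by exact_mod_cast hf.contDiffAt)
  simp only [smul_eq_mul] at h
  rw [h]
  have hM0 : 0 ≤ M := (abs_nonneg _).trans (hM 0)
  have hI : |∫ t in (0 : ℝ)..1, (1 - t) ^ 3 * iteratedFDeriv ℝ 4 f (x + t • y) (fun _ => y)| ≤ M := by
    have := intervalIntegral.norm_integral_le_of_norm_le_const (a := (0 : ℝ)) (b := 1) (C := M)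
      (f := fun t => (1 - t) ^ 3 * iteratedFDeriv ℝ 4 f (x + t • y) (fun _ => y)) fun t ht => by
        rw [Set.uIoc_of_le zero_le_one] at ht
        rw [norm_mul, Real.norm_eq_abs, Real.norm_eq_abs]
        have h1 : |(1 - t) ^ 3| ≤ 1 := by
          rw [abs_of_nonneg (pow_nonneg (by linarith [ht.2]) 3)]
          exact pow_le_one₀ (by linarith [ht.2]) (by linarith [ht.1])
        calc _ ≤ 1 * M := mul_le_mul h1 (hM t) (abs_nonneg _) zero_le_one
          _ = M := one_mul M
    simpa using this
  rw [add_sub_cancel_left, abs_mul]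
  have h6 : |((Nat.factorial 3 : ℕ) : ℝ)⁻¹| ≤ 1 := by
    norm_num [Nat.factorial]
  calc _ ≤ 1 * M := mul_le_mul h6 hI (abs_nonneg _) zero_le_one
    _ = M := one_mul M

/-- The first argument of Ψ carries the head, on which the dependence may be discontinuous;
smoothness is needed only in the second. The factor 2 counts the Taylor remainder once for each law.
-/
theorem IsKWise.lindeberg_step {B H : Finset (Fin n)} {y : σ → Fin n → ℝ}
    (hy : IsKWise 5 Ω B y) (hH : (B ∩ H).card ≤ 1)
    (Ψ : (Fin n → ℝ) → (Fin n → ℝ) → ℝ)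
    (hdep : ∀ v v' : Fin n → ℝ, (∀ j ∈ H, v j = v' j) → Ψ v = Ψ v')
    (hsmooth : ∀ a, ContDiff ℝ 4 (Ψ a)) {m : Type} [Fintype m] (κ : m → ℝ)
    (w : m → Fin n → ℝ)
    (hM : ∀ a x v, (∀ j ∈ H, v j = 0) →
      |iteratedFDeriv ℝ 4 (Ψ a) x (fun _ => v)| ≤ ∑ i, κ i * (∑ j, v j * w i j) ^ 4)
    (base : Fin n → ℝ) :
    |(𝔼 z, Ψ (B.piecewise (y z) base) (B.piecewise (y z) base)) -
      𝔼 u, Ψ (B.piecewise (productSample Ω u) base) (B.piecewise (productSample Ω u) base)| ≤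
      2 * ∑ i, κ i * 𝔼 u, (∑ j ∈ B \ H, productSample Ω u j * w i j) ^ 4 := by
  set T := B \ H with hT
  have hTB : T ⊆ B := Finset.sdiff_subset
  let p : (Fin n → ℝ) → Fin n → ℝ := fun v => B.piecewise v base
  -- The expansion point zeroes the non-head coordinates of the bucket, so the Taylor coefficients
  -- depend on at most one random coordinate.
  let x0 : (Fin n → ℝ) → Fin n → ℝ := fun v => T.piecewise 0 (p v)
  let P : (Fin n → ℝ) → ℝ := fun v => ∑ k ∈ Finset.range 4,
    ((k.factorial : ℝ)⁻¹ * iteratedFDeriv ℝ k (Ψ (p v)) (x0 v) (fun _ => restr T v))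
  let R : (Fin n → ℝ) → ℝ := fun v => ∑ i, κ i * (∑ j, restr T v j * w i j) ^ 4
  have hx0 : ∀ v, x0 v + restr T v = p v := by
    intro v; ext j
    by_cases hj : j ∈ T
    · simp [x0, p, restr, hj, hTB hj]
    · simp [x0, restr, hj]
  have hrem : ∀ v, |Ψ (p v) (p v) - P v| ≤ R v := by
    intro v
    have := abs_taylor_remainder_le (hsmooth (p v)) (x0 v) (restr T v) (M := R v) fun t => by
      refine hM _ _ _ fun j hj => ?_
      have : j ∉ T := by simp [hT, hj]
      simp [restr, this]
    rwa [hx0] at this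
  have hP : (𝔼 z, P (y z)) = 𝔼 u, P (productSample Ω u) := by
    have hexp : ∀ v, P v = ∑ k ∈ Finset.range 4, ∑ r : Fin k → Fin n,
        ((k.factorial : ℝ)⁻¹ * iteratedFDeriv ℝ k (Ψ (p v)) (x0 v)
          (fun i => Pi.single (r i) 1)) * ∏ i, restr T v (r i) := by
      intro v
      refine Finset.sum_congr rfl fun k _ => ?_
      conv_lhs => rw [restr_eq_sum]
      rw [ContinuousMultilinearMap.map_sum, Finset.mul_sum]
      refine Finset.sum_congr rfl fun r _ => ?_
      rw [ContinuousMultilinearMap.map_smul_univ, smul_eq_mul]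
      ring
    simp only [hexp, Finset.expect_sum_comm]
    refine Finset.sum_congr rfl fun k hk => Finset.sum_congr rfl fun r _ => ?_
    refine hy.expect_monomial hH hTB (by have := Finset.mem_range.1 hk; omega) r
      (fun v => (k.factorial : ℝ)⁻¹ * iteratedFDeriv ℝ k (Ψ (p v)) (x0 v)
          (fun i => Pi.single (r i) 1)) ?_
    intro v v' hv
    have h1 : Ψ (p v) = Ψ (p v') := hdep _ _ fun j hj => by
      by_cases hjB : j ∈ B
      · simp [p, hjB, hv j (mem_inter.2 ⟨hjB, hj⟩)]
      · simp [p, hjB]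
    have h2 : x0 v = x0 v' := by
      ext j
      by_cases hjT : j ∈ T
      · simp [x0, hjT]
      · by_cases hjB : j ∈ B
        · have hjH : j ∈ H := by
            by_contra hjH; exact hjT (Finset.mem_sdiff.2 ⟨hjB, hjH⟩)
          simp [x0, hjT, p, hjB, hv j (mem_inter.2 ⟨hjB, hjH⟩)]
        · simp [x0, hjT, p, hjB]
    simp only [h1, h2]
  -- The remainder bound is itself a combination of degree-four monomials, so it too has the same
  -- expectation under both laws.
  have hR : (𝔼 z, R (y z)) = 𝔼 u, R (productSample Ω u) := by
    simp only [R, Finset.expect_sum_comm, ← Finset.mul_expect, hy.expect_form_pow_four hTB]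
  have hR' : (𝔼 u, R (productSample Ω u)) =
      ∑ i, κ i * 𝔼 u, (∑ j ∈ T, productSample Ω u j * w i j) ^ 4 := by
    simp only [R, Finset.expect_sum_comm, ← Finset.mul_expect]
    refine Finset.sum_congr rfl fun i _ => ?_
    congr 1
    refine Finset.expect_congr rfl fun u _ => ?_
    congr 1
    rw [← Finset.sum_subset (Finset.subset_univ T)]
    · exact Finset.sum_congr rfl fun j hj => by simp [restr, hj]
    · intro j _ hj; simp [restr, hj]
  have h1 : |(𝔼 z, Ψ (p (y z)) (p (y z))) - 𝔼 z, P (y z)| ≤ 𝔼 z, R (y z) := by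
    rw [← Finset.expect_sub_distrib]
    exact (Finset.abs_expect_le _ _).trans (expect_mono fun z => hrem _)
  have h2 : |(𝔼 u, Ψ (p (productSample Ω u)) (p (productSample Ω u))) -
      𝔼 u, P (productSample Ω u)| ≤ 𝔼 u, R (productSample Ω u) := by
    rw [← Finset.expect_sub_distrib]
    exact (Finset.abs_expect_le _ _).trans (expect_mono fun z => hrem _)
  rw [hP, hR, hR'] at h1
  rw [hR'] at h2
  rw [abs_sub_comm] at h2
  refine (abs_sub_le _ _ _).trans ((add_le_add h1 h2).trans ?_)
  rw [two_mul]

variable [Nonempty σ]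

/-- Lindeberg's method with the buckets as blocks. -/
theorem lindeberg {t : ℕ} (h : Fin n → Fin t) (gen : Finset (Fin n) → σ → Fin n → ℝ)
    (hgen : ∀ H, IsKWise 5 Ω H (gen H)) {H : Finset (Fin n)}
    (hH : ∀ l, (bucket h l ∩ H).card ≤ 1)
    (Ψ : (Fin n → ℝ) → (Fin n → ℝ) → ℝ)
    (hdep : ∀ v v' : Fin n → ℝ, (∀ j ∈ H, v j = v' j) → Ψ v = Ψ v')
    (hsmooth : ∀ a, ContDiff ℝ 4 (Ψ a)) {m : Type} [Fintype m] (κ : m → ℝ)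
    (w : m → Fin n → ℝ)
    (hM : ∀ a x v, (∀ j ∈ H, v j = 0) →
      |iteratedFDeriv ℝ 4 (Ψ a) x (fun _ => v)| ≤ ∑ i, κ i * (∑ j, v j * w i j) ^ 4) :
    |(𝔼 z, Ψ (fillBuckets h gen z) (fillBuckets h gen z)) -
      𝔼 u, Ψ (productSample Ω u) (productSample Ω u)| ≤
      ∑ l, 2 * ∑ i, κ i * 𝔼 u, (∑ j ∈ bucket h l \ H, productSample Ω u j * w i j) ^ 4 :=
  expect_fillBuckets_sub_le h gen (fun v => Ψ v v) _ fun l base =>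
    (hgen (bucket h l)).lindeberg_step (hH l) Ψ hdep hsmooth κ w hM base

end Bucket

/-! ### Smoothing functions of signs -/

/-- The multi-affine extension of a function on the cube. -/
def multiAffine : (d : ℕ) → ((Fin d → Bool) → ℝ) → (Fin d → ℝ) → ℝ
  | 0, f, _ => f Fin.elim0
  | d + 1, f, p =>
    p 0 * multiAffine d (fun σ => f (Fin.cons true σ)) (Fin.tail p) +
      (1 - p 0) * multiAffine d (fun σ => f (Fin.cons false σ)) (Fin.tail p)

theorem multiAffine_mem_Icc {d : ℕ} (f : (Fin d → Bool) → ℝ) (hf : ∀ σ, f σ ∈ Set.Icc 0 1)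
    (p : Fin d → ℝ) (hp : ∀ i, p i ∈ Set.Icc (0 : ℝ) 1) : multiAffine d f p ∈ Set.Icc 0 1 := by
  induction d with
  | zero => exact hf _
  | succ d ih =>
    have h1 := ih (fun σ => f (Fin.cons true σ)) (fun σ => hf _) (Fin.tail p) fun i => hp _
    have h2 := ih (fun σ => f (Fin.cons false σ)) (fun σ => hf _) (Fin.tail p) fun i => hp _
    have h0 := hp 0
    simp only [Set.mem_Icc] at h1 h2 h0 ⊢
    simp only [multiAffine]
    constructor
    · have := mul_nonneg h0.1 h1.1
      have := mul_nonneg (sub_nonneg.2 h0.2) h2.1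
      linarith
    · have := mul_le_mul_of_nonneg_left h1.2 h0.1
      have := mul_le_mul_of_nonneg_left h2.2 (sub_nonneg.2 h0.2)
      linarith

theorem multiAffine_bool {d : ℕ} (f : (Fin d → Bool) → ℝ) (σ : Fin d → Bool) :
    multiAffine d f (fun i => if σ i then 1 else 0) = f σ := by
  induction d with
  | zero => simp only [multiAffine]; congr 1; ext i; exact i.elim0
  | succ d ih =>
    have h1 := ih (fun τ => f (Fin.cons (σ 0) τ)) (Fin.tail σ)
    rw [Fin.cons_self_tail] at h1
    rw [← h1]
    simp only [multiAffine]
    cases h : σ 0 <;> simp [Fin.tail_def] <;> congr!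

theorem contDiff_multiAffine {E : Type*} [NormedAddCommGroup E] [NormedSpace ℝ E] {N : ℕ} {d : ℕ}
    (f : (Fin d → Bool) → ℝ) (p : Fin d → E → ℝ) (hp : ∀ i, ContDiff ℝ N (p i)) :
    ContDiff ℝ N (fun y => multiAffine d f (fun i => p i y)) := by
  induction d with
  | zero => exact contDiff_const
  | succ d ih =>
    simp only [multiAffine, Fin.tail_def]
    exact ((hp 0).mul (ih _ (fun i => p i.succ) fun i => hp _)).add
      ((contDiff_const.sub (hp 0)).mul (ih _ (fun i => p i.succ) fun i => hp _))

/-- Peel off one variable as g0 + p0 (g1 - g0) and apply Leibniz. The bounds recombine by the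
binomial theorem into a power of ∑ b, avoiding a factor exponential in d. -/
theorem abs_iteratedDeriv_multiAffine_le {N d : ℕ} (f : (Fin d → Bool) → ℝ) {M C : ℝ}
    (hf : ∀ σ, |f σ| ≤ M) (hC : 1 ≤ 2 * C) (p : Fin d → ℝ → ℝ) (hp : ∀ i, ContDiff ℝ N (p i))
    (hp01 : ∀ i t, p i t ∈ Set.Icc (0 : ℝ) 1) (b : Fin d → ℝ) (hb : ∀ i, 0 ≤ b i)
    (hpb : ∀ i k t, 1 ≤ k → k ≤ N → |iteratedDeriv k (p i) t| ≤ C * b i ^ k) {k : ℕ} (hk : k ≤ N)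
    (t : ℝ) :
    |iteratedDeriv k (fun t => multiAffine d f (fun i => p i t)) t| ≤
      (2 * C) ^ k * M * (∑ i, b i) ^ k := by
  induction d generalizing k with
  | zero =>
    have : (fun t => multiAffine 0 f (fun i => p i t)) = fun _ => f Fin.elim0 := rfl
    rw [this, iteratedDeriv_const]
    rcases Nat.eq_zero_or_pos k with rfl | h
    · simpa using hf _
    · simp [h.ne']
  | succ d ih =>
    set g1 : ℝ → ℝ := fun t => multiAffine d (fun σ => f (Fin.cons true σ)) (fun i => p i.succ t)
      with hg1
    set g0 : ℝ → ℝ := fun t => multiAffine d (fun σ => f (Fin.cons false σ)) (fun i => p i.succ t)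
      with hg0
    have hM : 0 ≤ M := (abs_nonneg _).trans (hf fun _ => true)
    set B := ∑ i : Fin d, b i.succ with hB
    have hB0 : 0 ≤ B := Finset.sum_nonneg fun i _ => hb _
    have h1 : ∀ {k}, k ≤ N → |iteratedDeriv k g1 t| ≤ (2 * C) ^ k * M * B ^ k := fun {k} hk =>
      ih (fun σ => f (Fin.cons true σ)) (fun σ => hf _) (fun i => p i.succ) (fun i => hp _)
        (fun i => hp01 _) (fun i => b i.succ) (fun i => hb _) (fun i => hpb _) hk
    have h0 : ∀ {k}, k ≤ N → |iteratedDeriv k g0 t| ≤ (2 * C) ^ k * M * B ^ k := fun {k} hk =>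
      ih (fun σ => f (Fin.cons false σ)) (fun σ => hf _) (fun i => p i.succ) (fun i => hp _)
        (fun i => hp01 _) (fun i => b i.succ) (fun i => hb _) (fun i => hpb _) hk
    have hc1 : ContDiff ℝ N g1 := contDiff_multiAffine _ (fun i => p i.succ) fun i => hp _
    have hc0 : ContDiff ℝ N g0 := contDiff_multiAffine _ (fun i => p i.succ) fun i => hp _
    have hk' : ∀ {k : ℕ}, k ≤ N → ((k : ℕ) : WithTop ℕ∞) ≤ (N : WithTop ℕ∞) := fun h => by
      exact_mod_cast h
    have hg : (fun t => multiAffine (d + 1) f (fun i => p i t)) = g0 + p 0 * (g1 - g0) := by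
      ext t
      simp only [multiAffine, Fin.tail_def, Pi.add_apply, Pi.mul_apply, Pi.sub_apply, hg1, hg0]
      ring
    have hcp : ContDiffAt ℝ k (p 0) t := ((hp 0).of_le (hk' hk)).contDiffAt
    have hcq : ContDiffAt ℝ k (g1 - g0) t := ((hc1.sub hc0).of_le (hk' hk)).contDiffAt
    have hcpq : ContDiffAt ℝ k (p 0 * (g1 - g0)) t := hcp.mul hcq
    rw [hg, iteratedDeriv_add (hc0.of_le (hk' hk)).contDiffAt hcpq,
      iteratedDeriv_mul hcp hcq, Finset.sum_range_succ']
    have hq : ∀ {j}, j ≤ N →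
        iteratedDeriv j (g1 - g0) t = iteratedDeriv j g1 t - iteratedDeriv j g0 t := fun {j} hj =>
      iteratedDeriv_sub (hc1.of_le (hk' hj)).contDiffAt (hc0.of_le (hk' hj)).contDiffAt
    simp only [Nat.choose_zero_right, Nat.cast_one, one_mul, iteratedDeriv_zero, Nat.sub_zero]
    -- The term in which p0 is not differentiated is a convex combination, so no factor 2 is lost
    -- here; such a loss would accumulate to 2^d.
    have hmain : |iteratedDeriv k g0 t + p 0 t * iteratedDeriv k (g1 - g0) t| ≤
        (2 * C) ^ k * M * B ^ k := by
      rw [hq hk]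
      have e : iteratedDeriv k g0 t + p 0 t * (iteratedDeriv k g1 t - iteratedDeriv k g0 t) =
          p 0 t * iteratedDeriv k g1 t + (1 - p 0 t) * iteratedDeriv k g0 t := by ring
      rw [e]
      have hp0 := hp01 0 t
      refine (abs_add_le _ _).trans ?_
      rw [abs_mul, abs_mul, abs_of_nonneg hp0.1, abs_of_nonneg (sub_nonneg.2 hp0.2)]
      have := mul_le_mul_of_nonneg_left (h1 hk) hp0.1
      have := mul_le_mul_of_nonneg_left (h0 hk) (sub_nonneg.2 hp0.2)
      linarith
    have hrest : |∑ a ∈ Finset.range k, ((k.choose (a + 1) : ℕ) : ℝ) * iteratedDeriv (a + 1) (p 0) t *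
        iteratedDeriv (k - (a + 1)) (g1 - g0) t| ≤
        ∑ a ∈ Finset.range k, (2 * C) ^ k * M *
          (b 0 ^ (a + 1) * B ^ (k - (a + 1)) * ((k.choose (a + 1) : ℕ) : ℝ)) := by
      refine (Finset.abs_sum_le_sum_abs _ _).trans (Finset.sum_le_sum fun a ha => ?_)
      have hak : a + 1 ≤ k := Finset.mem_range.1 ha
      have hj : k - (a + 1) ≤ N := (Nat.sub_le _ _).trans hk
      rw [abs_mul, abs_mul, Nat.abs_cast, hq hj]
      have h2 := hpb 0 (a + 1) t (by omega) (hak.trans hk)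
      have h3 : |iteratedDeriv (k - (a + 1)) g1 t - iteratedDeriv (k - (a + 1)) g0 t| ≤
          2 * ((2 * C) ^ (k - (a + 1)) * M * B ^ (k - (a + 1))) := by
        refine (abs_sub _ _).trans ?_
        have := h1 hj
        have := h0 hj
        linarith
      have h4 : (2 * C) * (2 * C) ^ (k - (a + 1)) ≤ (2 * C) ^ k := by
        rw [← pow_succ']
        exact pow_le_pow_right₀ hC (by omega)
      have hC0 : 0 ≤ C := by linarith
      have hb0 := hb 0
      calc _ ≤ ((k.choose (a + 1) : ℕ) : ℝ) * (C * b 0 ^ (a + 1)) *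
            (2 * ((2 * C) ^ (k - (a + 1)) * M * B ^ (k - (a + 1)))) := by gcongr
        _ = ((2 * C) * (2 * C) ^ (k - (a + 1))) * M *
            (b 0 ^ (a + 1) * B ^ (k - (a + 1)) * ((k.choose (a + 1) : ℕ) : ℝ)) := by ring
        _ ≤ _ := by gcongr
    have hfin : (2 * C) ^ k * M * (∑ i, b i) ^ k = (∑ a ∈ Finset.range k, (2 * C) ^ k * M *
          (b 0 ^ (a + 1) * B ^ (k - (a + 1)) * ((k.choose (a + 1) : ℕ) : ℝ))) +
          (2 * C) ^ k * M * B ^ k := by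
      rw [Fin.sum_univ_succ, ← hB, add_pow, Finset.sum_range_succ', ← Finset.mul_sum]
      simp
      ring
    rw [hfin]
    calc _ = |(∑ a ∈ Finset.range k, ((k.choose (a + 1) : ℕ) : ℝ) * iteratedDeriv (a + 1) (p 0) t *
        iteratedDeriv (k - (a + 1)) (g1 - g0) t) +
          (iteratedDeriv k g0 t + p 0 t * iteratedDeriv k (g1 - g0) t)| := by congr 1; ring
      _ ≤ _ := (abs_add_le _ _).trans (add_le_add hrest hmain)

/-- The derivatives are continuous on [0, 1], and the function is locally constant off this
interval. -/
theorem exists_bound_smoothTransition : ∃ C : ℝ, 1 ≤ C ∧ ∀ k, 1 ≤ k → k ≤ 4 → ∀ t,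
    |iteratedDeriv k Real.smoothTransition t| ≤ C := by
  have hsmooth : ∀ n : ℕ, ContDiff ℝ n Real.smoothTransition := fun n =>
    Real.smoothTransition.contDiff (n := (n : ℕ∞))
  have hone : ∀ k, 1 ≤ k → ∃ C : ℝ, ∀ t, |iteratedDeriv k Real.smoothTransition t| ≤ C := by
    intro k hk
    have hcont : Continuous (iteratedDeriv k Real.smoothTransition) :=
      (hsmooth k).continuous_iteratedDeriv k le_rfl
    obtain ⟨C, hC⟩ := (isCompact_Icc (a := (0 : ℝ)) (b := 1)).exists_bound_of_continuousOn
      hcont.continuousOn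
    have hC0 : 0 ≤ C := (norm_nonneg _).trans (hC 0 (by simp))
    refine ⟨C, fun t => ?_⟩
    by_cases ht : t ∈ Set.Icc (0 : ℝ) 1
    · exact hC t ht
    have hloc : ∃ c : ℝ, Real.smoothTransition =ᶠ[nhds t] fun _ => c := by
      rw [Set.mem_Icc, not_and_or, not_le, not_le] at ht
      rcases ht with ht | ht
      · exact ⟨0, Filter.mem_of_superset (Iio_mem_nhds ht) fun s hs =>
          Real.smoothTransition.zero_of_nonpos (le_of_lt hs)⟩
      · exact ⟨1, Filter.mem_of_superset (Ioi_mem_nhds ht) fun s hs =>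
          Real.smoothTransition.one_of_one_le (le_of_lt hs)⟩
    obtain ⟨c, hc⟩ := hloc
    rw [(hc.iteratedDeriv k).eq_of_nhds, iteratedDeriv_const]
    simpa [show k ≠ 0 by omega] using hC0
  choose! C hC using hone
  refine ⟨1 + ∑ k ∈ Finset.Icc 1 4, |C k|, ?_, fun k h1 h4 t => ?_⟩
  · have : 0 ≤ ∑ k ∈ Finset.Icc 1 4, |C k| := Finset.sum_nonneg fun _ _ => abs_nonneg _
    linarith
  · have := Finset.single_le_sum (f := fun k => |C k|) (fun k _ => abs_nonneg _)
      (Finset.mem_Icc.2 ⟨h1, h4⟩)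
    have h5 := (hC k h1 t).trans (le_abs_self _)
    linarith

theorem iteratedDeriv_comp_line {E : Type*} [NormedAddCommGroup E] [NormedSpace ℝ E] {f : E → ℝ}
    {N : ℕ} (hf : ContDiff ℝ N f) (x v : E) {k : ℕ} (hk : k ≤ N) :
    iteratedDeriv k (fun t : ℝ => f (x + t • v)) =
      fun t => iteratedFDeriv ℝ k f (x + t • v) (fun _ => v) := by
  induction k with
  | zero => ext t; simp
  | succ k ih =>
    rw [iteratedDeriv_succ, ih (by omega)]
    ext t
    exact ContDiffAt.deriv_fderiv_add_smul
      (hf.of_le (by exact_mod_cast hk)).contDiffAt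

theorem iteratedDeriv_comp_affine {f : ℝ → ℝ} (hf : ∀ n : ℕ, ContDiff ℝ n f) (a b : ℝ) (k : ℕ) (t : ℝ) :
    iteratedDeriv k (fun t => f (a + b * t)) t = b ^ k * iteratedDeriv k f (a + b * t) := by
  have h : ContDiff ℝ k (fun s => f (a + s)) := (hf k).comp (contDiff_const.add contDiff_id)
  rw [iteratedDeriv_comp_const_mul (f := fun s => f (a + s)) h b, iteratedDeriv_comp_const_add]

/-- A smooth upper bound for the indicator of `[0, 1)`. -/
def smoothBump (u : ℝ) : ℝ := Real.smoothTransition (u + 1) - Real.smoothTransition (u - 1)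

theorem contDiff_smoothTransition (n : ℕ) : ContDiff ℝ n Real.smoothTransition :=
  Real.smoothTransition.contDiff (n := (n : ℕ∞))

theorem contDiff_smoothBump (n : ℕ) : ContDiff ℝ n smoothBump :=
  ((contDiff_smoothTransition n).comp (contDiff_id.add contDiff_const)).sub
    ((contDiff_smoothTransition n).comp (contDiff_id.sub contDiff_const))

theorem smoothBump_nonneg (u : ℝ) : 0 ≤ smoothBump u :=
  sub_nonneg.2 (Real.smoothTransition.monotone (by linarith))

theorem one_le_smoothBump {u : ℝ} (h0 : 0 ≤ u) (h1 : u ≤ 1) : 1 ≤ smoothBump u := by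
  rw [smoothBump, Real.smoothTransition.one_of_one_le (by linarith),
    Real.smoothTransition.zero_of_nonpos (by linarith), sub_zero]

/-- The bump vanishes outside [-1, 2], where exp(-u²/2) ≥ exp(-2) > 1/9. The Gaussian majorant is
what the Fourier estimate controls. -/
theorem smoothBump_le (u : ℝ) : smoothBump u ≤ 9 * Real.exp (-u ^ 2 / 2) := by
  have hpos := Real.exp_pos (-u ^ 2 / 2)
  rcases lt_or_ge u (-1) with h | h
  · rw [smoothBump, Real.smoothTransition.zero_of_nonpos (by linarith),
      Real.smoothTransition.zero_of_nonpos (by linarith)]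
    linarith
  rcases lt_or_ge 2 u with h2 | h2
  · rw [smoothBump, Real.smoothTransition.one_of_one_le (by linarith),
      Real.smoothTransition.one_of_one_le (by linarith)]
    linarith
  have h3 : smoothBump u ≤ 1 := by
    have := Real.smoothTransition.le_one (u + 1)
    have := Real.smoothTransition.nonneg (u - 1)
    rw [smoothBump]; linarith
  have h4 : Real.exp (-2) ≤ Real.exp (-u ^ 2 / 2) := Real.exp_le_exp.2 (by nlinarith)
  have h5 : (1 : ℝ) / 9 ≤ Real.exp (-2) := by
    rw [Real.exp_neg, ← one_div]
    refine one_div_le_one_div_of_le (Real.exp_pos _) ?_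
    have := Real.exp_one_lt_d9
    have h6 : Real.exp 2 = Real.exp 1 * Real.exp 1 := by rw [← Real.exp_add]; norm_num
    have := Real.exp_pos 1
    rw [h6]; nlinarith
  linarith

theorem abs_iteratedDeriv_smoothBump_le {C : ℝ}
    (hC : ∀ k, 1 ≤ k → k ≤ 4 → ∀ t, |iteratedDeriv k Real.smoothTransition t| ≤ C) (u : ℝ) :
    |iteratedDeriv 4 smoothBump u| ≤ 2 * C := by
  have h1 : ContDiff ℝ (4 : ℕ) (fun u => Real.smoothTransition (u + 1)) :=
    (contDiff_smoothTransition 4).comp (contDiff_id.add contDiff_const)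
  have h2 : ContDiff ℝ (4 : ℕ) (fun u => Real.smoothTransition (u - 1)) :=
    (contDiff_smoothTransition 4).comp (contDiff_id.sub contDiff_const)
  have e : smoothBump = (fun u => Real.smoothTransition (u + 1)) -
    (fun u => Real.smoothTransition (u - 1)) := rfl
  rw [e, iteratedDeriv_sub h1.contDiffAt h2.contDiffAt, iteratedDeriv_comp_add_const,
    iteratedDeriv_comp_sub_const]
  refine (abs_sub _ _).trans ?_
  have := hC 4 (by norm_num) le_rfl (u + 1)
  have := hC 4 (by norm_num) le_rfl (u - 1)
  linarith

/-! ### One halfspace -/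

section Halfspace

variable {n b : ℕ} {Ω : Fin n → Bits b → ℝ} {η : ℝ}

theorem expect_form_pow_four_le (hx : ∀ j, IsHC η (Ω j)) (hη : 0 < η) (hη1 : η < 1)
    (w : Fin n → ℝ) (S : Finset (Fin n)) :
    (𝔼 u, (∑ j ∈ S, productSample Ω u j * w j) ^ 4) ≤ (∑ j ∈ S, wvar Ω w j) ^ 2 / η ^ 4 := by
  have := expect_add_sum_pow_four_le hx hη hη1 w S 0
  rw [le_div_iff₀ (by positivity), mul_comm]
  simpa [productSample] using this

/-- The fourth moments are at most squared variances over η⁴. The η⁴ in the regularity threshold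
cancels this loss, giving the quartic hypothesis of `regular_small_ball`; then 72 = 9 · 8. -/
theorem expect_smoothBump_le (hx : ∀ j, IsHC η (Ω j)) (hη : 0 < η) (w : Fin n → ℝ) (θ : ℝ)
    {H : Finset (Fin n)} {δ ε : ℝ} (hε : 0 < ε) (hε1 : ε ≤ 1) (hδ : 16 * δ ≤ ε ^ 4)
    (hT : 0 < tailSum (wvar Ω w) H)
    (hreg : ∀ j ∉ H, wvar Ω w j ≤ η ^ 4 * δ * tailSum (wvar Ω w) H) :
    (𝔼 u, smoothBump (((∑ j, productSample Ω u j * w j) - θ) /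
      (ε * √(tailSum (wvar Ω w) H)))) ≤ 72 * ε := by
  set T := tailSum (wvar Ω w) H with hTdef
  have hq : ∑ j ∈ Hᶜ, w j ^ 4 * (𝔼 a, Ω j a ^ 4) ≤ δ * T ^ 2 := by
    have h1 : ∀ j ∈ Hᶜ, w j ^ 4 * (𝔼 a, Ω j a ^ 4) ≤ δ * T * wvar Ω w j := by
      intro j hj
      have hη4 : 0 < η ^ 4 := by positivity
      refine le_of_mul_le_mul_left ?_ hη4
      have h2 := (hx j).fourth_moment_le
      have h3 := hreg j (mem_compl.1 hj)
      have h4 := wvar_nonneg Ω w j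
      have h5 : 0 ≤ w j ^ 4 := by positivity
      calc η ^ 4 * (w j ^ 4 * 𝔼 a, Ω j a ^ 4) = w j ^ 4 * (η ^ 4 * 𝔼 a, Ω j a ^ 4) := by ring
        _ ≤ w j ^ 4 * (𝔼 a, Ω j a ^ 2) ^ 2 := by gcongr
        _ = wvar Ω w j * wvar Ω w j := by rw [wvar]; ring
        _ ≤ (η ^ 4 * δ * T) * wvar Ω w j := by gcongr
        _ = _ := by ring
    refine (Finset.sum_le_sum h1).trans ?_
    rw [← Finset.mul_sum]
    exact le_of_eq (by rw [hTdef, tailSum]; ring)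
  have := regular_small_ball hx w Hᶜ hT rfl hq hε hε1 hδ (-θ)
  calc _ ≤ 𝔼 u : Fin n → Bits b, 9 * Real.exp (-((-θ + ∑ j, Ω j (u j) * w j) / (ε * √T)) ^ 2 / 2) := by
        refine expect_mono fun u => (smoothBump_le _).trans (le_of_eq ?_)
        rw [neg_add_eq_sub]
        rfl
    _ ≤ _ := by rw [← Finset.mul_expect]; linarith

/-- A linear form whose weights decay outside of a short head has the sign of its head with high
probability. -/
theorem expect_ind_sgn_ne_le (hx : ∀ j, IsHC η (Ω j)) (hη : 0 < η) (hη1 : η < 1)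
    (w : Fin n → ℝ) (θ : ℝ) {H : Finset (Fin n)} {s ε : ℝ} {r : ℕ} (hs : 0 < s)
    (hsε : 1 / s ^ 2 ≤ ε) (hr : (1 - η ^ 4 / 2) ^ r ≤ ε) (hε : 0 < ε)
    (hH : tailSum (wvar Ω w) H = 0 ∨ Decays (wvar Ω w) (1 / (1 + 16 * s ^ 2)) r ∅ H)
    {β : Type} [Fintype β] (y : β → Fin n → ℝ)
    (h1 : ∀ Q : (Fin n → ℝ) → ℝ, (∀ v v' : Fin n → ℝ, (∀ j ∈ H, v j = v' j) → Q v = Q v') →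
      (𝔼 z, Q (y z)) = 𝔼 u, Q (productSample Ω u))
    (h2 : ∀ i j : Fin n, (𝔼 z, y z i * y z j) = 𝔼 u, productSample Ω u i * productSample Ω u j) :
    (𝔼 z, ind (sgn ((∑ j, y z j * w j) - θ) ≠ sgn ((∑ j ∈ H, y z j * w j) - θ))) ≤ 3 * ε := by
  have hsplit : ∀ z, (∑ j, y z j * w j) = (∑ j ∈ H, y z j * w j) + ∑ j ∈ Hᶜ, y z j * w j :=
    fun z => (Finset.sum_add_sum_compl H _).symm
  have hTn := tailSum_nonneg (wvar_nonneg Ω w) H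
  rcases hTn.eq_or_lt with hT0 | hT
  · have hw : ∀ j ∈ Hᶜ, w j = 0 := by
      have := (Finset.sum_eq_zero_iff_of_nonneg fun j _ => wvar_nonneg Ω w j).1 hT0.symm
      intro j hj
      have h3 := this j hj
      rw [wvar, mul_eq_zero] at h3
      rcases h3 with h3 | h3
      · exact pow_eq_zero_iff (two_ne_zero) |>.1 h3
      · exact absurd h3 (hx j).second_moment_pos.ne'
    have h3 : ∀ z, ∑ j ∈ Hᶜ, y z j * w j = 0 := fun z =>
      Finset.sum_eq_zero fun j hj => by rw [hw j hj, mul_zero]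
    have h4 : ∀ z, ind (sgn ((∑ j, y z j * w j) - θ) ≠ sgn ((∑ j ∈ H, y z j * w j) - θ)) = 0 :=
      fun z => ind_of_not (by rw [hsplit, h3, add_zero]; simp)
    simp only [h4, Finset.expect_const_zero]
    positivity
  have hdec := hH.resolve_left hT.ne'
  set T := tailSum (wvar Ω w) H with hTdef
  -- The tail can flip the sign only if it is at least as large as the distance of the head from θ:
  -- either that distance is at most s√T or the tail reaches s√T.
  have hpt : ∀ z, ind (sgn ((∑ j, y z j * w j) - θ) ≠ sgn ((∑ j ∈ H, y z j * w j) - θ)) ≤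
      ind ((-θ + ∑ j ∈ H, y z j * w j) ^ 2 ≤ s ^ 2 * T) +
        ind (s ^ 2 * T ≤ (∑ j ∈ Hᶜ, y z j * w j) ^ 2) := by
    intro z
    by_cases ha : (-θ + ∑ j ∈ H, y z j * w j) ^ 2 ≤ s ^ 2 * T
    · rw [ind_of ha]
      exact (ind_le_one _).trans (le_add_of_nonneg_right (ind_nonneg _))
    by_cases hb : s ^ 2 * T ≤ (∑ j ∈ Hᶜ, y z j * w j) ^ 2
    · rw [ind_of hb]
      exact (ind_le_one _).trans (le_add_of_nonneg_left (ind_nonneg _))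
    rw [ind_of_not]
    · exact add_nonneg (ind_nonneg _) (ind_nonneg _)
    rw [not_not, hsplit]
    have hlt := sq_lt_sq.1 ((not_le.1 hb).trans (not_le.1 ha))
    unfold sgn
    split_ifs with h3 h4 h4
    · rfl
    · exfalso
      rw [abs_of_neg (by linarith : -θ + ∑ j ∈ H, y z j * w j < 0)] at hlt
      have := le_abs_self (∑ j ∈ Hᶜ, y z j * w j)
      linarith
    · exfalso
      rw [abs_of_nonneg (by linarith : 0 ≤ -θ + ∑ j ∈ H, y z j * w j)] at hlt
      have := neg_abs_le (∑ j ∈ Hᶜ, y z j * w j)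
      linarith
    · rfl
  refine (expect_mono hpt).trans ?_
  rw [Finset.expect_add_distrib]
  have e1 : (𝔼 z, ind ((-θ + ∑ j ∈ H, y z j * w j) ^ 2 ≤ s ^ 2 * T)) ≤ 2 * ε := by
    rw [h1 (fun v => ind ((-θ + ∑ j ∈ H, v j * w j) ^ 2 ≤ s ^ 2 * T))]
    · have := hdec.small_ball hx hη hη1 w hs (-θ)
      rw [Finset.sdiff_empty] at this
      refine this.trans ?_
      linarith
    · intro v v' hv
      have : ∑ j ∈ H, v j * w j = ∑ j ∈ H, v' j * w j :=
        Finset.sum_congr rfl fun j hj => by rw [hv j hj]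
      simp only [this]
  have hexp : ∀ v : Fin n → ℝ, (∑ j ∈ Hᶜ, v j * w j) ^ 2 =
      ∑ i ∈ Hᶜ, ∑ j ∈ Hᶜ, (w i * w j) * (v i * v j) := by
    intro v
    rw [sq, Finset.sum_mul_sum]
    exact Finset.sum_congr rfl fun i _ => Finset.sum_congr rfl fun j _ => by ring
  -- Matching second moments, assumed in `h2`, transfer the tail variance to the law of y.
  have e2 : (𝔼 z, (∑ j ∈ Hᶜ, y z j * w j) ^ 2) = T := by
    have h3 := expect_sum_sq hx w Hᶜ
    have h4 : (𝔼 u : Fin n → Bits b, (∑ j ∈ Hᶜ, productSample Ω u j * w j) ^ 2) = T := h3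
    rw [← h4]
    simp only [hexp, Finset.expect_sum_comm, ← Finset.mul_expect, h2]
  have e3 : (𝔼 z, ind (s ^ 2 * T ≤ (∑ j ∈ Hᶜ, y z j * w j) ^ 2)) ≤ ε := by
    refine (expect_ind_le (f := fun z => (∑ j ∈ Hᶜ, y z j * w j) ^ 2) _ (c := s ^ 2 * T)
      (by positivity) (fun z => sq_nonneg _) fun z hz => hz).trans ?_
    rw [e2]
    refine le_trans (le_of_eq ?_) hsε
    field_simp
  linarith

end Halfspace

/-! ### Functions of halfspaces for a fixed hash function -/

section Smoothed

variable {n d : ℕ}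

/-- A smoothed function of halfspaces. The halfspaces in `R` are smoothed at scale `lam`, the others
are replaced by their heads. The vector `a` provides the coordinates in `H`. -/
def smoothed (H : Finset (Fin n)) (R : Finset (Fin d)) (W : Fin n → Fin d → ℝ) (Θ : Fin d → ℝ)
    (lam : Fin d → ℝ) (f : (Fin d → ℤˣ) → Bool) (a y : Fin n → ℝ) : ℝ :=
  multiAffine d (fun σ => ind (f (fun i => if σ i then 1 else -1) = true)) fun i =>
    if i ∈ R then
      Real.smoothTransition (((∑ j ∈ H, a j * W j i) + (∑ j ∈ Hᶜ, y j * W j i) - Θ i) / lam i)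
    else if 0 ≤ (∑ j ∈ H, a j * W j i) - Θ i then 1 else 0

variable (H : Finset (Fin n)) (R : Finset (Fin d)) (W : Fin n → Fin d → ℝ) (Θ : Fin d → ℝ)
    (lam : Fin d → ℝ) (f : (Fin d → ℤˣ) → Bool)

theorem contDiff_smoothed (a : Fin n → ℝ) : ContDiff ℝ (4 : ℕ) (smoothed H R W Θ lam f a) := by
  refine contDiff_multiAffine (N := 4) (E := Fin n → ℝ) _ (fun i y => if i ∈ R then
      Real.smoothTransition (((∑ j ∈ H, a j * W j i) + (∑ j ∈ Hᶜ, y j * W j i) - Θ i) / lam i)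
    else if 0 ≤ (∑ j ∈ H, a j * W j i) - Θ i then 1 else 0) fun i => ?_
  by_cases hi : i ∈ R
  · simp only [hi, if_true]
    refine (contDiff_smoothTransition 4).comp ?_
    fun_prop
  · simp only [hi, if_false]
    exact contDiff_const

/-- Along a line in direction v each smoothed sign is a fixed function of an affine parameter, with
slope the i-th form of v over lam i; the replaced signs are constant because they see only the head.
-/
theorem abs_iteratedFDeriv_smoothed_le {C : ℝ} (hC1 : 1 ≤ C)
    (hC : ∀ k, 1 ≤ k → k ≤ 4 → ∀ t, |iteratedDeriv k Real.smoothTransition t| ≤ C)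
    (a x v : Fin n → ℝ) (hv : ∀ j ∈ H, v j = 0) :
    |iteratedFDeriv ℝ 4 (smoothed H R W Θ lam f a) x (fun _ => v)| ≤
      ∑ i, (if i ∈ R then (2 * C) ^ 4 * (d : ℝ) ^ 3 / lam i ^ 4 else 0) *
        (∑ j, v j * W j i) ^ 4 := by
  have hline := congrFun (iteratedDeriv_comp_line (contDiff_smoothed H R W Θ lam f a) x v le_rfl) 0
  rw [zero_smul, add_zero] at hline
  rw [← hline]
  set p : Fin d → ℝ → ℝ := fun i t => if i ∈ R then
      Real.smoothTransition ((((∑ j ∈ H, a j * W j i) + (∑ j ∈ Hᶜ, x j * W j i) - Θ i) / lam i) +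
        ((∑ j, v j * W j i) / lam i) * t)
    else if 0 ≤ (∑ j ∈ H, a j * W j i) - Θ i then 1 else 0 with hp
  have he : (fun t : ℝ => smoothed H R W Θ lam f a (x + t • v)) = fun t => multiAffine d
      (fun σ => ind (f (fun i => if σ i then 1 else -1) = true)) (fun i => p i t) := by
    ext t
    rw [smoothed]
    congr 1
    ext i
    simp only [hp]
    split_ifs
    · congr 1
      have h1 : ∑ j, v j * W j i = ∑ j ∈ Hᶜ, v j * W j i := by
        rw [← Finset.sum_add_sum_compl H, Finset.sum_eq_zero, zero_add]
        exact fun j hj => by rw [hv j hj, zero_mul]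
      have h2 : ∑ j ∈ Hᶜ, (x + t • v) j * W j i =
          (∑ j ∈ Hᶜ, x j * W j i) + t * ∑ j ∈ Hᶜ, v j * W j i := by
        rw [Finset.mul_sum, ← Finset.sum_add_distrib]
        exact Finset.sum_congr rfl fun j _ => by simp; ring
      rw [h1, h2]
      ring
    · rfl
    · rfl
  rw [he]
  set c : Fin d → ℝ := fun i => if i ∈ R then |(∑ j, v j * W j i) / lam i| else 0 with hc
  have hc0 : ∀ i, 0 ≤ c i := fun i => by
    simp only [hc]; split_ifs
    · exact abs_nonneg _
    · exact le_rfl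
  have h4 := abs_iteratedDeriv_multiAffine_le (N := 4)
    (fun σ => ind (f (fun i => if σ i then 1 else -1) = true)) (M := 1) (C := C)
    (fun σ => by rw [abs_of_nonneg (ind_nonneg _)]; exact ind_le_one _) (by linarith) p
    (fun i => ?_) (fun i t => ?_) c hc0 (fun i k t hk hk4 => ?_) le_rfl 0
  · refine h4.trans ?_
    rw [mul_one]
    -- The power mean inequality separates the halfspaces, at the price d³, into the fourth powers
    -- that Lindeberg's method requires.
    have h5 : (∑ i, c i) ^ 4 ≤ (d : ℝ) ^ 3 * ∑ i, c i ^ 4 := by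
      simpa using pow_sum_le_card_mul_sum_pow (s := univ) (fun i _ => hc0 i) 3
    calc (2 * C) ^ 4 * (∑ i, c i) ^ 4 ≤ (2 * C) ^ 4 * ((d : ℝ) ^ 3 * ∑ i, c i ^ 4) := by
          gcongr
      _ = _ := by
          rw [Finset.mul_sum, Finset.mul_sum]
          refine Finset.sum_congr rfl fun i _ => ?_
          simp only [hc]
          split_ifs
          · rw [pow_abs, abs_of_nonneg (by positivity), div_pow]; ring
          · simp
  · simp only [hp]
    by_cases hi : i ∈ R
    · simp only [hi, if_true]
      exact (contDiff_smoothTransition 4).comp (by fun_prop)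
    · simp only [hi, if_false]
      exact contDiff_const
  · simp only [hp]
    split_ifs
    · exact ⟨Real.smoothTransition.nonneg _, Real.smoothTransition.le_one _⟩
    · simp
    · simp
  · by_cases hi : i ∈ R
    · simp only [hp, hc, hi, if_true]
      rw [iteratedDeriv_comp_affine contDiff_smoothTransition, abs_mul, abs_pow, mul_comm]
      gcongr
      exact hC k hk hk4 _
    · simp only [hp, hc, hi, if_false]
      rw [iteratedDeriv_const]
      simp [show k ≠ 0 by omega]

theorem smoothed_mem_Icc (a y : Fin n → ℝ) : smoothed H R W Θ lam f a y ∈ Set.Icc 0 1 := by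
  refine multiAffine_mem_Icc _ (fun σ => ⟨ind_nonneg _, ind_le_one _⟩) _ fun i => ?_
  split_ifs
  · exact ⟨Real.smoothTransition.nonneg _, Real.smoothTransition.le_one _⟩
  · simp
  · simp

/-- If some error term reaches 1, the bound is trivial for values in [0, 1]. Otherwise every
argument of the multi-affine extension is exactly the 0/1 value of its sign, and the extension
agrees with f. -/
theorem abs_ind_sub_smoothed_le (hlam : ∀ i ∈ R, 0 < lam i) (y : Fin n → ℝ) :
    |ind (f (fun i => sgn ((∑ j, y j * W j i) - Θ i)) = true) - smoothed H R W Θ lam f y y| ≤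
      ∑ i, if i ∈ R then smoothBump (((∑ j, y j * W j i) - Θ i) / lam i)
        else ind (sgn ((∑ j, y j * W j i) - Θ i) ≠ sgn ((∑ j ∈ H, y j * W j i) - Θ i)) := by
  have hterm : ∀ i, 0 ≤ if i ∈ R then smoothBump (((∑ j, y j * W j i) - Θ i) / lam i)
        else ind (sgn ((∑ j, y j * W j i) - Θ i) ≠ sgn ((∑ j ∈ H, y j * W j i) - Θ i)) := by
    intro i; split_ifs
    · exact smoothBump_nonneg _
    · exact ind_nonneg _
  by_cases hbad : ∃ i, 1 ≤ if i ∈ R then smoothBump (((∑ j, y j * W j i) - Θ i) / lam i)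
        else ind (sgn ((∑ j, y j * W j i) - Θ i) ≠ sgn ((∑ j ∈ H, y j * W j i) - Θ i))
  · obtain ⟨i, hi⟩ := hbad
    refine le_trans ?_ (hi.trans (Finset.single_le_sum (fun i _ => hterm i) (mem_univ i)))
    have h1 := smoothed_mem_Icc H R W Θ lam f y y
    have h2 := ind_nonneg (f (fun i => sgn ((∑ j, y j * W j i) - Θ i)) = true)
    have h3 := ind_le_one (f (fun i => sgn ((∑ j, y j * W j i) - Θ i)) = true)
    rw [abs_le]
    constructor <;> linarith [h1.1, h1.2]
  · push Not at hbad
    refine le_trans (le_of_eq ?_) (Finset.sum_nonneg fun i _ => hterm i)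
    rw [abs_eq_zero, sub_eq_zero, smoothed]
    have hp : (fun i => if i ∈ R then
        Real.smoothTransition (((∑ j ∈ H, y j * W j i) + (∑ j ∈ Hᶜ, y j * W j i) - Θ i) / lam i)
        else if 0 ≤ (∑ j ∈ H, y j * W j i) - Θ i then 1 else 0) =
        fun i => if (decide (0 ≤ (∑ j, y j * W j i) - Θ i)) then (1 : ℝ) else 0 := by
      ext i
      have hi := hbad i
      simp only [decide_eq_true_eq]
      rw [Finset.sum_add_sum_compl]
      by_cases hiR : i ∈ R
      · simp only [hiR, if_true] at hi ⊢
        have hl := hlam i hiR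
        split_ifs with h0
        · refine Real.smoothTransition.one_of_one_le ?_
          by_contra! hlt
          exact hi.not_ge (one_le_smoothBump (div_nonneg h0 hl.le) hlt.le)
        · exact Real.smoothTransition.zero_of_nonpos (div_nonpos_of_nonpos_of_nonneg
            (not_le.1 h0).le hl.le)
      · simp only [hiR, if_false] at hi ⊢
        have hs : sgn ((∑ j, y j * W j i) - Θ i) = sgn ((∑ j ∈ H, y j * W j i) - Θ i) := by
          by_contra hne
          rw [ind_of hne] at hi
          exact lt_irrefl _ hi
        unfold sgn at hs
        split_ifs at hs ⊢ <;> first | rfl | (exfalso; revert hs; decide)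
    rw [hp, multiAffine_bool]
    congr 3
    ext i
    simp [sgn]

end Smoothed

/-! ### Error for a hash function that separates the head -/

section FixedHash

variable {n b t : ℕ} {Ω : Fin n → Bits b → ℝ} {η : ℝ}

/-- The sum over the buckets of the squared fractions of the weight outside `H`. -/
def bucketEnergy (v : Fin n → ℝ) (H : Finset (Fin n)) (h : Fin n → Fin t) : ℝ :=
  (∑ l, (∑ j ∈ bucket h l \ H, v j) ^ 2) / tailSum v H ^ 2

theorem sum_form_pow_four_le (hx : ∀ j, IsHC η (Ω j)) (hη : 0 < η) (hη1 : η < 1)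
    (w : Fin n → ℝ) {H : Finset (Fin n)} (h : Fin n → Fin t) {ε : ℝ} (hε : 0 < ε)
    (hT : 0 < tailSum (wvar Ω w) H) :
    ∑ l, (𝔼 u, (∑ j ∈ bucket h l \ H, productSample Ω u j * w j) ^ 4) /
        (ε * √(tailSum (wvar Ω w) H)) ^ 4 ≤
      1 / (ε ^ 4 * η ^ 4) * bucketEnergy (wvar Ω w) H h := by
  set T := tailSum (wvar Ω w) H with hTdef
  have h4 : (ε * √T) ^ 4 = ε ^ 4 * T ^ 2 := by
    rw [mul_pow, show √T ^ 4 = (√T ^ 2) ^ 2 by ring, Real.sq_sqrt hT.le]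
  rw [h4, bucketEnergy, ← Finset.sum_div, ← hTdef]
  have h5 : ∑ l, (𝔼 u, (∑ j ∈ bucket h l \ H, productSample Ω u j * w j) ^ 4) ≤
      (∑ l, (∑ j ∈ bucket h l \ H, wvar Ω w j) ^ 2) / η ^ 4 := by
    rw [Finset.sum_div]
    exact Finset.sum_le_sum fun l _ => expect_form_pow_four_le hx hη hη1 w _
  calc _ ≤ ((∑ l, (∑ j ∈ bucket h l \ H, wvar Ω w j) ^ 2) / η ^ 4) / (ε ^ 4 * T ^ 2) := by gcongr
    _ = _ := by field_simp

/-- The smoothed indicator of a strip, as a function of the head `a` and of the whole vector. -/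
def stripBump (H : Finset (Fin n)) (w : Fin n → ℝ) (θ lam : ℝ) (a y : Fin n → ℝ) : ℝ :=
  smoothBump (((∑ j ∈ H, a j * w j) + (∑ j ∈ Hᶜ, y j * w j) - θ) / lam)

theorem contDiff_stripBump (H : Finset (Fin n)) (w : Fin n → ℝ) (θ lam : ℝ) (a : Fin n → ℝ) :
    ContDiff ℝ (4 : ℕ) (stripBump H w θ lam a) :=
  (contDiff_smoothBump 4).comp (by fun_prop)

theorem abs_iteratedFDeriv_stripBump_le (H : Finset (Fin n)) (w : Fin n → ℝ) (θ lam : ℝ) {C : ℝ}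
    (hC : ∀ k, 1 ≤ k → k ≤ 4 → ∀ t, |iteratedDeriv k Real.smoothTransition t| ≤ C)
    (a x v : Fin n → ℝ) (hv : ∀ j ∈ H, v j = 0) :
    |iteratedFDeriv ℝ 4 (stripBump H w θ lam a) x (fun _ => v)| ≤
      2 * C / lam ^ 4 * (∑ j, v j * w j) ^ 4 := by
  have hline := congrFun (iteratedDeriv_comp_line (contDiff_stripBump H w θ lam a) x v le_rfl) 0
  rw [zero_smul, add_zero] at hline
  rw [← hline]
  have he : (fun t : ℝ => stripBump H w θ lam a (x + t • v)) = fun t => smoothBump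
      ((((∑ j ∈ H, a j * w j) + (∑ j ∈ Hᶜ, x j * w j) - θ) / lam) +
      ((∑ j, v j * w j) / lam) * t) := by
    ext t
    rw [stripBump]
    congr 1
    have h1 : ∑ j, v j * w j = ∑ j ∈ Hᶜ, v j * w j := by
      rw [← Finset.sum_add_sum_compl H, Finset.sum_eq_zero, zero_add]
      exact fun j hj => by rw [hv j hj, zero_mul]
    have h2 : ∑ j ∈ Hᶜ, (x + t • v) j * w j =
        (∑ j ∈ Hᶜ, x j * w j) + t * ∑ j ∈ Hᶜ, v j * w j := by
      rw [Finset.mul_sum, ← Finset.sum_add_distrib]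
      exact Finset.sum_congr rfl fun j _ => by simp; ring
    rw [h1, h2]
    ring
  rw [he, iteratedDeriv_comp_affine contDiff_smoothBump, abs_mul, abs_of_nonneg (by positivity),
    div_pow]
  have h3 := abs_iteratedDeriv_smoothBump_le hC
    ((((∑ j ∈ H, a j * w j) + (∑ j ∈ Hᶜ, x j * w j) - θ) / lam) + ((∑ j, v j * w j) / lam) * 0)
  have h4 : 0 ≤ (∑ j, v j * w j) ^ 4 / lam ^ 4 := by positivity
  refine (mul_le_mul_of_nonneg_left h3 h4).trans (le_of_eq ?_)
  ring

variable {σ : Type} [Fintype σ] [Nonempty σ]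

/-- Anticoncentration of the generator's output is inherited: the strip majorant is smooth, so
Lindeberg's method compares it with the product law at the cost of the bucket energy. -/
theorem expect_smoothBump_fillBuckets_le (hx : ∀ j, IsHC η (Ω j)) (hη : 0 < η) (hη1 : η < 1)
    (w : Fin n → ℝ) (θ : ℝ) {H : Finset (Fin n)} {δ ε C : ℝ} (hε : 0 < ε) (hε1 : ε ≤ 1)
    (hδ : 16 * δ ≤ ε ^ 4)
    (hC : ∀ k, 1 ≤ k → k ≤ 4 → ∀ t, |iteratedDeriv k Real.smoothTransition t| ≤ C)
    (hT : 0 < tailSum (wvar Ω w) H)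
    (hreg : ∀ j ∉ H, wvar Ω w j ≤ η ^ 4 * δ * tailSum (wvar Ω w) H)
    (h : Fin n → Fin t) (gen : Finset (Fin n) → σ → Fin n → ℝ)
    (hgen : ∀ H, IsKWise 5 Ω H (gen H)) (hH : ∀ l, (bucket h l ∩ H).card ≤ 1) :
    (𝔼 z, smoothBump (((∑ j, fillBuckets h gen z j * w j) - θ) /
      (ε * √(tailSum (wvar Ω w) H)))) ≤
      72 * ε + 4 * C * (1 / (ε ^ 4 * η ^ 4) * bucketEnergy (wvar Ω w) H h) := by
  have hX := expect_smoothBump_le hx hη w θ hε hε1 hδ hT hreg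
  have hsum := sum_form_pow_four_le hx hη hη1 w h hε hT
  set lam := ε * √(tailSum (wvar Ω w) H) with hlam
  have hC0 : 0 ≤ C := (abs_nonneg _).trans (hC 1 le_rfl (by norm_num) 0)
  have hL := lindeberg (Ω := Ω) h gen hgen hH (stripBump H w θ lam) (fun v v' hv => by
      have : ∑ j ∈ H, v j * w j = ∑ j ∈ H, v' j * w j :=
        Finset.sum_congr rfl fun j hj => by rw [hv j hj]
      ext y
      simp only [stripBump, this])
    (fun a => by exact_mod_cast contDiff_stripBump H w θ lam a) (m := Unit)
    (fun _ => 2 * C / lam ^ 4) (fun _ => w)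
    (fun a x v hv => by
      rw [Fintype.sum_unique]
      exact abs_iteratedFDeriv_stripBump_le H w θ lam hC a x v hv)
  have h1 : ∀ y : Fin n → ℝ, stripBump H w θ lam y y = smoothBump (((∑ j, y j * w j) - θ) / lam) :=
    fun y => by rw [stripBump, Finset.sum_add_sum_compl]
  simp only [h1, Fintype.sum_unique] at hL
  have h2 : ∑ l, 2 * (2 * C / lam ^ 4 *
      (𝔼 u, (∑ j ∈ bucket h l \ H, productSample Ω u j * w j) ^ 4)) =
      4 * C * ∑ l, (𝔼 u, (∑ j ∈ bucket h l \ H, productSample Ω u j * w j) ^ 4) / lam ^ 4 := by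
    rw [Finset.mul_sum]
    exact Finset.sum_congr rfl fun l _ => by ring
  rw [h2] at hL
  have h3 := mul_le_mul_of_nonneg_left hsum (by positivity : 0 ≤ 4 * C)
  have := (le_abs_self _).trans hL
  linarith

/-- Three comparisons: smoothing under the product law, Lindeberg for the smoothed function,
smoothing under the generator. Each smoothing costs 72ε per halfspace, giving 144; the energy
constant 36 is 2·2⁴ from the smoothed function plus 4 from the strip bumps. -/
theorem fixed_hash_error_le {d : ℕ} (hx : ∀ j, IsHC η (Ω j)) (hη : 0 < η) (hη1 : η < 1)
    (W : Fin n → Fin d → ℝ) (Θ : Fin d → ℝ) (f : (Fin d → ℤˣ) → Bool) {H : Finset (Fin n)}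
    {δ ε s C : ℝ} {r : ℕ} (hε : 0 < ε) (hε1 : ε ≤ 1)
    (hδ : 16 * δ ≤ ε ^ 4) (hC1 : 1 ≤ C)
    (hC : ∀ k, 1 ≤ k → k ≤ 4 → ∀ t, |iteratedDeriv k Real.smoothTransition t| ≤ C)
    (hs : 0 < s) (hsε : 1 / s ^ 2 ≤ ε) (hr : (1 - η ^ 4 / 2) ^ r ≤ ε) {R : Finset (Fin d)}
    (hR : ∀ i ∈ R, 0 < tailSum (wvar Ω fun j => W j i) H ∧
      ∀ j ∉ H, wvar Ω (fun j => W j i) j ≤ η ^ 4 * δ * tailSum (wvar Ω fun j => W j i) H)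
    (hnR : ∀ i ∉ R, tailSum (wvar Ω fun j => W j i) H = 0 ∨
      Decays (wvar Ω fun j => W j i) (1 / (1 + 16 * s ^ 2)) r ∅ H)
    (h : Fin n → Fin t) (gen : Finset (Fin n) → σ → Fin n → ℝ)
    (hgen : ∀ H, IsKWise 5 Ω H (gen H)) (hH : ∀ l, (bucket h l ∩ H).card ≤ 1) :
    |(𝔼 u, ind (f (fun i => sgn ((∑ j, productSample Ω u j * W j i) - Θ i)) = true)) -
      𝔼 z, ind (f (fun i => sgn ((∑ j, fillBuckets h gen z j * W j i) - Θ i)) = true)| ≤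
      144 * d * ε + 36 * C ^ 4 * d ^ 3 / (ε ^ 4 * η ^ 4) *
        ∑ i ∈ R, bucketEnergy (wvar Ω fun j => W j i) H h := by
  rcases Nat.eq_zero_or_pos d with rfl | hd
  · have : R = ∅ := Finset.eq_empty_of_isEmpty R
    have e : ∀ g : Fin 0 → ℤˣ, f g = f Fin.elim0 := fun g => by congr 1; ext i; exact i.elim0
    have hb : Nonempty (Fin n → Bits b) := inferInstance
    simp only [e, Fintype.expect_const, this]
    simp
  set T : Fin d → ℝ := fun i => tailSum (wvar Ω fun j => W j i) H with hT
  set lam : Fin d → ℝ := fun i => ε * √(T i) with hlam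
  set F : (Fin n → ℝ) → ℝ := fun y => ind (f (fun i => sgn ((∑ j, y j * W j i) - Θ i)) = true)
  set E : Fin d → ℝ := fun i => bucketEnergy (wvar Ω fun j => W j i) H h with hE
  have hE0 : ∀ i, 0 ≤ E i := fun i => by
    refine div_nonneg (Finset.sum_nonneg fun l _ => sq_nonneg _) (sq_nonneg _)
  have hlam0 : ∀ i ∈ R, 0 < lam i := fun i hi => by
    have := (hR i hi).1
    simp only [hlam]; positivity
  have hpt := abs_ind_sub_smoothed_le H R W Θ lam f hlam0
  set G : (Fin n → ℝ) → ℝ := fun y => smoothed H R W Θ lam f y y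
  set err : Fin d → (Fin n → ℝ) → ℝ := fun i y =>
    if i ∈ R then smoothBump (((∑ j, y j * W j i) - Θ i) / lam i)
        else ind (sgn ((∑ j, y j * W j i) - Θ i) ≠ sgn ((∑ j ∈ H, y j * W j i) - Θ i)) with herr
  set D := 1 / (ε ^ 4 * η ^ 4) with hD
  have hD0 : 0 < D := by positivity
  have hXerr : ∀ i, (𝔼 u, err i (productSample Ω u)) ≤ 72 * ε := by
    intro i
    by_cases hi : i ∈ R
    · simp only [herr, hi, if_true, hlam]
      exact expect_smoothBump_le hx hη _ _ hε hε1 hδ (hR i hi).1 (hR i hi).2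
    · simp only [herr, hi, if_false]
      have := expect_ind_sgn_ne_le hx hη hη1 (fun j => W j i) (Θ i) hs hsε hr hε (hnR i hi)
        (productSample Ω) (fun _ _ => rfl) (fun _ _ => rfl)
      linarith
  have hYerr : ∀ i, (𝔼 z, err i (fillBuckets h gen z)) ≤
      72 * ε + if i ∈ R then 4 * C * (D * E i) else 0 := by
    intro i
    by_cases hi : i ∈ R
    · simp only [herr, hi, if_true, hlam]
      exact expect_smoothBump_fillBuckets_le hx hη hη1 _ _ hε hε1 hδ hC (hR i hi).1 (hR i hi).2
        h gen hgen hH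
    · simp only [herr, hi, if_false]
      have := expect_ind_sgn_ne_le hx hη hη1 (fun j => W j i) (Θ i) hs hsε hr hε (hnR i hi)
        (fillBuckets h gen)
        (fun Q hQ => expect_fillBuckets_eq h gen hgen H (fun l => (hH l).trans (by norm_num)) Q hQ)
        (fun i j => expect_fillBuckets_eq h gen hgen {i, j} (fun l =>
          (Finset.card_le_card Finset.inter_subset_right).trans
            ((Finset.card_le_two).trans (by norm_num)))
          (fun y => y i * y j) (fun v v' hv => by rw [hv i (by simp), hv j (by simp)]))
      linarith
  have hsm := contDiff_smoothed H R W Θ lam f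
  have hL := lindeberg (Ω := Ω) h gen hgen hH (smoothed H R W Θ lam f)
    (fun v v' hv => by
      have : ∀ i, ∑ j ∈ H, v j * W j i = ∑ j ∈ H, v' j * W j i := fun i =>
        Finset.sum_congr rfl fun j hj => by rw [hv j hj]
      ext y
      simp only [smoothed, this])
    (fun a => by exact_mod_cast hsm a) _ _
    (fun a x v hv => abs_iteratedFDeriv_smoothed_le H R W Θ lam f hC1 hC a x v hv)
  have hL' : |(𝔼 z, G (fillBuckets h gen z)) - 𝔼 u, G (productSample Ω u)| ≤
      32 * C ^ 4 * d ^ 3 * D * ∑ i ∈ R, E i := by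
    refine hL.trans ?_
    calc _ = ∑ i ∈ R, 32 * C ^ 4 * d ^ 3 * ∑ l,
          (𝔼 u, (∑ j ∈ bucket h l \ H, productSample Ω u j * W j i) ^ 4) / lam i ^ 4 := by
          simp only [Finset.mul_sum]
          rw [Finset.sum_comm, ← Finset.sum_subset (Finset.subset_univ R)]
          · refine Finset.sum_congr rfl fun i hi => Finset.sum_congr rfl fun l _ => ?_
            rw [if_pos hi]; ring
          · intro i _ hi
            exact Finset.sum_eq_zero fun l _ => by rw [if_neg hi]; ring
      _ ≤ ∑ i ∈ R, 32 * C ^ 4 * d ^ 3 * (D * E i) := by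
          refine Finset.sum_le_sum fun i hi => ?_
          have := sum_form_pow_four_le hx hη hη1 (fun j => W j i) h hε (hR i hi).1
          gcongr
      _ = _ := by rw [Finset.mul_sum]; exact Finset.sum_congr rfl fun i _ => by ring
  have hX : |(𝔼 u, F (productSample Ω u)) - 𝔼 u, G (productSample Ω u)| ≤ d * (72 * ε) := by
    rw [← Finset.expect_sub_distrib]
    refine (Finset.abs_expect_le _ _).trans ((expect_mono fun u => hpt _).trans ?_)
    rw [Finset.expect_sum_comm]
    refine (Finset.sum_le_sum fun i _ => hXerr i).trans (by simp)
  have hY : |(𝔼 z, F (fillBuckets h gen z)) - 𝔼 z, G (fillBuckets h gen z)| ≤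
      d * (72 * ε) + 4 * C * D * ∑ i ∈ R, E i := by
    rw [← Finset.expect_sub_distrib]
    refine (Finset.abs_expect_le _ _).trans ((expect_mono fun u => hpt _).trans ?_)
    rw [Finset.expect_sum_comm]
    refine (Finset.sum_le_sum fun i _ => hYerr i).trans (le_of_eq ?_)
    rw [Finset.sum_add_distrib, Finset.sum_ite_mem, Finset.univ_inter, Finset.mul_sum]
    simp [mul_assoc]
  have hS : 0 ≤ D * ∑ i ∈ R, E i := mul_nonneg hD0.le (Finset.sum_nonneg fun i _ => hE0 i)
  -- This absorbs the energy of the strip bumps into that of the smoothed function; it needs d ≥ 1,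
  -- whence the separate case d = 0.
  have hCd : C ≤ C ^ 4 * d ^ 3 := by
    have h1 : (1 : ℝ) ≤ (d : ℝ) ^ 3 := one_le_pow₀ (by exact_mod_cast hd)
    have h2 : C ≤ C ^ 4 := le_self_pow₀ hC1 (by norm_num)
    nlinarith
  have hfin : 36 * C ^ 4 * d ^ 3 / (ε ^ 4 * η ^ 4) * ∑ i ∈ R, E i =
      32 * C ^ 4 * d ^ 3 * D * (∑ i ∈ R, E i) + 4 * (C ^ 4 * d ^ 3) * (D * ∑ i ∈ R, E i) := by
    rw [hD]; ring
  rw [hfin]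
  have h5 := mul_le_mul_of_nonneg_right hCd hS
  rw [abs_le] at hX hY hL' ⊢
  constructor <;> nlinarith [hX.1, hX.2, hY.1, hY.2, hL'.1, hL'.2]

end FixedHash

/-! ### Averaging over the hash function -/

section Hashing

variable {n t : ℕ} {κ : Type} [Fintype κ] {hash : κ → Fin n → Fin t}

theorem sum_bucket_sq (v : Fin n → ℝ) (H : Finset (Fin n)) (h : Fin n → Fin t) :
    ∑ l, (∑ j ∈ bucket h l \ H, v j) ^ 2 =
      ∑ i ∈ Hᶜ, ∑ j ∈ Hᶜ, v i * v j * ind (h i = h j) := by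
  have h1 : ∀ l, ∑ j ∈ bucket h l \ H, v j = ∑ j ∈ Hᶜ, v j * ind (h j = l) := by
    intro l
    have : bucket h l \ H = Hᶜ.filter (fun j => h j = l) := by
      ext j; simp [mem_bucket, and_comm]
    rw [this, Finset.sum_filter]
    refine Finset.sum_congr rfl fun j _ => ?_
    split_ifs with hj
    · rw [ind_of hj, mul_one]
    · rw [ind_of_not hj, mul_zero]
  simp only [h1, sq, Finset.sum_mul_sum]
  rw [Finset.sum_comm]
  refine Finset.sum_congr rfl fun i _ => ?_
  rw [Finset.sum_comm]
  refine Finset.sum_congr rfl fun j _ => ?_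
  rw [Finset.sum_eq_single (h i)]
  · rw [ind_of rfl]
    by_cases hij : h i = h j
    · rw [ind_of hij, ind_of hij.symm]; ring
    · rw [ind_of_not hij, ind_of_not (Ne.symm hij)]; ring
  · intro l _ hl
    rw [ind_of_not hl.symm]; ring
  · simp

/-- Expand the squares over pairs sharing a bucket. Diagonal pairs contribute ∑ v² ≤ ρT² by
regularity, off-diagonal ones at most T²/t by the collision bound. -/
theorem expect_bucketEnergy_le [Nonempty κ] (hh : IsCollisionPreserving 1 hash) {v : Fin n → ℝ}
    (hv : ∀ j, 0 ≤ v j) {H : Finset (Fin n)} {ρ : ℝ} (hT : 0 < tailSum v H)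
    (hreg : ∀ j ∉ H, v j ≤ ρ * tailSum v H) :
    (𝔼 k, bucketEnergy v H (hash k)) ≤ ρ + 1 / t := by
  simp only [bucketEnergy]
  rw [← Finset.expect_div, div_le_iff₀ (by positivity)]
  simp only [sum_bucket_sq, Finset.expect_sum_comm, ← Finset.mul_expect]
  have hcol : ∀ i j, (𝔼 k, ind (hash k i = hash k j)) ≤ (if i = j then 1 else 0) + 1 / t := by
    intro i j
    by_cases hij : i = j
    · rw [if_pos hij]
      have : (0 : ℝ) ≤ 1 / t := by positivity
      have := expect_le_of_le fun k => ind_le_one (hash k i = hash k j)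
      linarith
    · rw [if_neg hij, zero_add]
      have := hh.2 i j hij
      rwa [prob_eq_expect] at this
  calc _ ≤ ∑ i ∈ Hᶜ, ∑ j ∈ Hᶜ, v i * v j * ((if i = j then 1 else 0) + 1 / t) := by
        refine Finset.sum_le_sum fun i _ => Finset.sum_le_sum fun j _ => ?_
        exact mul_le_mul_of_nonneg_left (hcol i j) (mul_nonneg (hv i) (hv j))
    _ = (∑ i ∈ Hᶜ, v i * v i) + tailSum v H ^ 2 * (1 / t) := by
        simp only [mul_add, Finset.sum_add_distrib, mul_ite, mul_one, mul_zero]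
        congr 1
        · refine Finset.sum_congr rfl fun i hi => ?_
          rw [Finset.sum_ite_eq, if_pos hi]
        · simp only [← Finset.sum_mul]
          rw [sq, tailSum, Finset.sum_mul_sum]
    _ ≤ (∑ i ∈ Hᶜ, ρ * tailSum v H * v i) + tailSum v H ^ 2 * (1 / t) := by
        gcongr with i hi
        · exact hv i
        · exact hreg i (mem_compl.1 hi)
    _ = _ := by
        rw [← Finset.mul_sum]
        have : ∑ i ∈ Hᶜ, v i = tailSum v H := rfl
        rw [this]; ring

/-- Union bound over ordered pairs of distinct head coordinates. -/
theorem expect_not_separated_le (hh : IsCollisionPreserving 1 hash) (H : Finset (Fin n)) :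
    (𝔼 k, ind (¬∀ l, (bucket (hash k) l ∩ H).card ≤ 1)) ≤ (H.card : ℝ) ^ 2 / t := by
  have hpt : ∀ k, ind (¬∀ l, (bucket (hash k) l ∩ H).card ≤ 1) ≤
      ∑ i ∈ H, ∑ j ∈ H, if i = j then 0 else ind (hash k i = hash k j) := by
    intro k
    have h0 : ∀ i j : Fin n, 0 ≤ if i = j then 0 else ind (hash k i = hash k j) := by
      intro i j; split_ifs
      · exact le_rfl
      · exact ind_nonneg _
    by_cases hs : ∀ l, (bucket (hash k) l ∩ H).card ≤ 1
    · rw [ind_of_not (not_not.2 hs)]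
      exact Finset.sum_nonneg fun i _ => Finset.sum_nonneg fun j _ => h0 i j
    · rw [ind_of hs]
      push Not at hs
      obtain ⟨l, hl⟩ := hs
      obtain ⟨i, hi, j, hj, hij⟩ := Finset.one_lt_card.1 hl
      rw [mem_inter, mem_bucket] at hi hj
      calc (1 : ℝ) = if i = j then 0 else ind (hash k i = hash k j) := by
            rw [if_neg hij, ind_of (hi.1.trans hj.1.symm)]
        _ ≤ ∑ j ∈ H, if i = j then 0 else ind (hash k i = hash k j) :=
            Finset.single_le_sum (f := fun j => if i = j then 0 else ind (hash k i = hash k j))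
              (fun j _ => h0 i j) hj.2
        _ ≤ _ := Finset.single_le_sum
              (f := fun i => ∑ j ∈ H, if i = j then 0 else ind (hash k i = hash k j))
              (fun i _ => Finset.sum_nonneg fun j _ => h0 i j) hi.2
  refine (expect_mono hpt).trans ?_
  simp only [Finset.expect_sum_comm]
  have hcol : ∀ i j, (𝔼 k, if i = j then 0 else ind (hash k i = hash k j)) ≤ 1 / t := by
    intro i j
    by_cases hij : i = j
    · simp [hij]
    · simp only [hij, if_false]
      have := hh.2 i j hij
      rwa [prob_eq_expect] at this
  refine (Finset.sum_le_sum fun i _ => Finset.sum_le_sum fun j _ => hcol i j).trans (le_of_eq ?_)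
  simp
  ring

end Hashing

/-! ### Parameters -/

section Params

variable {d : ℕ} {ε η : ℝ}

theorem paramδ_pos (hd : 1 ≤ d) (hε : 0 < ε) (hη : 0 < η) : 0 < paramδ d ε η := by
  have : (0 : ℝ) < d := by exact_mod_cast hd
  unfold paramδ; positivity

/-- The left side is, up to a constant, the averaged Lindeberg error over all halfspaces. -/
theorem pow_four_mul_paramδ_le (hd : 1 ≤ d) (hε : 0 < ε) (hη1 : η < 1) (hη : 0 < η) :
    (d : ℝ) ^ 4 * paramδ d ε η / ε ^ 4 ≤ ε ^ 4 := by
  have hd' : (1 : ℝ) ≤ d := by exact_mod_cast hd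
  have hd0 : (0 : ℝ) < d := by linarith
  have e : (d : ℝ) ^ 4 * paramδ d ε η / ε ^ 4 = η ^ 4 * ε ^ 4 / (d : ℝ) ^ 3 := by
    unfold paramδ; field_simp
  rw [e, div_le_iff₀ (by positivity)]
  have h1 : η ^ 4 ≤ 1 := pow_le_one₀ hη.le hη1.le
  have h2 : (1 : ℝ) ≤ (d : ℝ) ^ 3 := one_le_pow₀ hd'
  have h3 : 0 < ε ^ 4 := by positivity
  nlinarith

theorem sixteen_mul_paramδ_le (hd : 1 ≤ d) (hε : 0 < ε) (hε2 : ε < 1 / 2) (hη : 0 < η)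
    (hη1 : η < 1) : 16 * paramδ d ε η ≤ ε ^ 4 := by
  have h1 := pow_four_mul_paramδ_le hd hε hη1 hη
  have hd' : (1 : ℝ) ≤ (d : ℝ) ^ 4 := one_le_pow₀ (by exact_mod_cast hd)
  have hδ := paramδ_pos hd hε hη
  rw [div_le_iff₀ (by positivity)] at h1
  have h3 : 0 < ε ^ 4 := by positivity
  have h2 : ε ^ 4 ≤ 1 / 16 := by
    calc ε ^ 4 ≤ (1 / 2) ^ 4 := by gcongr
      _ = 1 / 16 := by norm_num
  nlinarith

theorem paramS_pos (hε : 0 < ε) (hη : 0 < η) : 0 < paramS ε η := by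
  unfold paramS; positivity

theorem paramS_sq (hε : 0 < ε) (η : ℝ) : paramS ε η ^ 2 = 1 / (η ^ 4 * ε) := by
  rw [paramS, div_pow, mul_pow, Real.sq_sqrt hε.le]
  ring

theorem one_le_log_paramS (hε : 0 < ε) (hε2 : ε < 1 / 2) (hη : 0 < η) (hη1 : η < 1) :
    1 ≤ Real.log (1 + 16 * paramS ε η ^ 2) := by
  rw [Real.le_log_iff_exp_le (by positivity), paramS_sq hε]
  have h1 : η ^ 4 * ε ≤ 1 := mul_le_one₀ (pow_le_one₀ hη.le hη1.le) hε.le (by linarith)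
  have h2 : 1 ≤ 1 / (η ^ 4 * ε) := (one_le_div (by positivity)).2 h1
  have := Real.exp_one_lt_d9
  linarith

theorem one_sub_pow_le_exp_neg {a : ℝ} (ha : a ≤ 1) (r : ℕ) {x : ℝ} (hx : x ≤ a * r) :
    (1 - a) ^ r ≤ Real.exp (-x) := by
  have h1 : 1 - a ≤ Real.exp (-a) := by
    have := Real.add_one_le_exp (-a); linarith
  calc (1 - a) ^ r ≤ Real.exp (-a) ^ r := pow_le_pow_left₀ (by linarith) h1 r
    _ = Real.exp (-(a * r)) := by rw [← Real.exp_nat_mul]; congr 1; ring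
    _ ≤ _ := Real.exp_le_exp.2 (by linarith)

theorem one_div_le_paramL (hd : 1 ≤ d) (hε : 0 < ε) (hε2 : ε < 1 / 2) (hη : 0 < η) (hη1 : η < 1) :
    1 / (η ^ 4 * paramδ d ε η) ≤ paramL d ε η := by
  have hδ := paramδ_pos hd hε hη
  have hlog := one_le_log_paramS hε hε2 hη hη1
  have h1 : 1 / (η ^ 4 * paramδ d ε η) ≤
      (⌈1 / (η ^ 4 * paramδ d ε η) * Real.log (1 + 16 * paramS ε η ^ 2)⌉₊ : ℕ) :=
    (le_mul_of_one_le_right (by positivity) hlog).trans (Nat.le_ceil _)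
  have h2 : 1 ≤ ⌈2 / η ^ 4 * Real.log (1 / ε)⌉₊ := by
    rw [Nat.one_le_ceil_iff]
    have : 0 < Real.log (1 / ε) := Real.log_pos (by rw [lt_div_iff₀ hε]; linarith)
    positivity
  have h3 : (1 : ℝ) ≤ (⌈2 / η ^ 4 * Real.log (1 / ε)⌉₊ : ℕ) := by exact_mod_cast h2
  rw [paramL, Nat.cast_mul]
  exact h1.trans (le_mul_of_one_le_left (Nat.cast_nonneg _) h3)

theorem minBuckets_eq (hd : 1 ≤ d) (hε : 0 < ε) :
    minBuckets d ε η = d * (paramL d ε η : ℝ) ^ 2 / ε := by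
  have : (d : ℝ) ≠ 0 := by exact_mod_cast (by omega : d ≠ 0)
  unfold minBuckets; field_simp

/-- Makes the collision term 1/t no larger than the regularity threshold η⁴δ. -/
theorem one_div_le_minBuckets (hd : 1 ≤ d) (hε : 0 < ε) (hε2 : ε < 1 / 2) (hη : 0 < η)
    (hη1 : η < 1) : 1 / (η ^ 4 * paramδ d ε η) ≤ minBuckets d ε η := by
  have hL := one_div_le_paramL hd hε hε2 hη hη1
  have hδ := paramδ_pos hd hε hη
  have hpos : (0 : ℝ) < paramL d ε η := lt_of_lt_of_le (by positivity) hL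
  have h1 : (1 : ℝ) ≤ paramL d ε η := by
    have : 0 < paramL d ε η := by exact_mod_cast hpos
    exact_mod_cast this
  have hd' : (1 : ℝ) ≤ d := by exact_mod_cast hd
  refine hL.trans ?_
  rw [minBuckets_eq hd hε, le_div_iff₀ hε]
  calc (paramL d ε η : ℝ) * ε ≤ paramL d ε η * 1 := by gcongr; linarith
    _ ≤ 1 * (paramL d ε η * paramL d ε η) := by nlinarith
    _ ≤ d * (paramL d ε η : ℝ) ^ 2 := by rw [sq]; gcongr

end Params

/-! ### The generator fools functions of halfspaces -/

theorem exists_fools : ∃ K : ℝ, 0 < K ∧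
    ∀ (d n b : ℕ) (ε η : ℝ) (Ω : Fin n → Bits b → ℝ),
      1 ≤ d → 1 ≤ n → 0 < ε → ε < 1 / 2 → (∀ j, IsHC η (Ω j)) →
      ∀ t : ℕ, minBuckets d ε η ≤ t →
        ∀ (κ σ : Type) [Fintype κ] [Nonempty κ] [Fintype σ] [Nonempty σ]
          (hash : κ → Fin n → Fin t) (gen : Finset (Fin n) → σ → Fin n → ℝ),
          IsCollisionPreserving 1 hash →
          (∀ H : Finset (Fin n), IsKWise 5 Ω H (gen H)) →
          ∀ F : (Fin n → ℝ) → Bool, IsFunctionOfHalfspaces d F →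
            Fools Ω (mzGenerator hash gen) (K * d * ε) F := by
  obtain ⟨C, hC1, hC⟩ := exists_bound_smoothTransition
  -- The parts are 1 for hash functions not separating the head, 144 for smoothing and 72C⁴ for the
  -- averaged energy.
  refine ⟨145 + 72 * C ^ 4, by positivity, ?_⟩
  intro d n b ε η Ω hd hn hε hε2 hx t ht κ σ _ _ _ _ hash gen hhash hgen F hF
  obtain ⟨W, Θ, f, hF⟩ := hF
  have hη : 0 < η := (hx ⟨0, hn⟩).1
  have hη1 : η < 1 := (hx ⟨0, hn⟩).2.1
  have hη4 : η ^ 4 ≤ 1 := pow_le_one₀ hη.le hη1.le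
  set δ := paramδ d ε η with hδdef
  set s := paramS ε η with hsdef
  set r := ⌈2 / η ^ 4 * Real.log (1 / ε)⌉₊ with hrdef
  set m := ⌈1 / (η ^ 4 * δ) * Real.log (1 + 16 * s ^ 2)⌉₊ with hmdef
  have hL : paramL d ε η = r * m := rfl
  have hδ : 0 < δ := paramδ_pos hd hε hη
  have hδε : 16 * δ ≤ ε ^ 4 := sixteen_mul_paramδ_le hd hε hε2 hη hη1
  have hs : 0 < s := paramS_pos hε hη
  have hsε : 1 / s ^ 2 ≤ ε := by
    rw [hsdef, paramS_sq hε, one_div_one_div]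
    exact mul_le_of_le_one_left hε.le hη4
  have hlog := one_le_log_paramS hε hε2 hη hη1
  have hr : (1 - η ^ 4 / 2) ^ r ≤ ε := by
    have h1 : 2 / η ^ 4 * Real.log (1 / ε) ≤ r := Nat.le_ceil _
    have h2 : Real.log (1 / ε) ≤ η ^ 4 / 2 * r := by
      have := mul_le_mul_of_nonneg_left h1 (by positivity : 0 ≤ η ^ 4 / 2)
      refine le_trans (le_of_eq ?_) this
      field_simp
    refine (one_sub_pow_le_exp_neg (by linarith) r h2).trans (le_of_eq ?_)
    rw [one_div, Real.log_inv, neg_neg, Real.exp_log hε]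
  have hρ1 : η ^ 4 * δ ≤ 1 := by
    have : ε ^ 4 ≤ 1 := pow_le_one₀ hε.le (by linarith)
    exact mul_le_one₀ hη4 hδ.le (by linarith)
  have hm0 : 0 < m := by
    rw [hmdef, Nat.ceil_pos]; positivity
  have hm : (1 - η ^ 4 * δ) ^ m ≤ 1 / (1 + 16 * s ^ 2) := by
    have h1 : 1 / (η ^ 4 * δ) * Real.log (1 + 16 * s ^ 2) ≤ m := Nat.le_ceil _
    have h2 : Real.log (1 + 16 * s ^ 2) ≤ η ^ 4 * δ * m := by
      have := mul_le_mul_of_nonneg_left h1 (by positivity : 0 ≤ η ^ 4 * δ)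
      refine le_trans (le_of_eq ?_) this
      field_simp
    refine (one_sub_pow_le_exp_neg hρ1 m h2).trans (le_of_eq ?_)
    rw [Real.exp_neg, Real.exp_log (by positivity), one_div]
  have hd1 : (1 : ℝ) ≤ d := by exact_mod_cast hd
  have ht1 : 1 / (η ^ 4 * δ) ≤ t := (one_div_le_minBuckets hd hε hε2 hη hη1).trans ht
  have ht0 : (0 : ℝ) < t := lt_of_lt_of_le (by positivity) ht1
  have htinv : 1 / (t : ℝ) ≤ η ^ 4 * δ := by
    rw [div_le_iff₀ (by positivity)] at ht1 ⊢
    linarith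
  set v : Fin d → Fin n → ℝ := fun i => wvar Ω fun j => W j i with hv
  obtain ⟨H, hHcard, hH⟩ := exists_regular_or_decays v (fun i j => wvar_nonneg _ _ j)
    (ρ := η ^ 4 * δ) (by positivity) hρ1 (r * m)
  classical
  set R : Finset (Fin d) := univ.filter fun i => 0 < tailSum (v i) H ∧
    ∀ j ∉ H, v i j ≤ η ^ 4 * δ * tailSum (v i) H with hRdef
  have hR : ∀ i ∈ R, 0 < tailSum (v i) H ∧ ∀ j ∉ H, v i j ≤ η ^ 4 * δ * tailSum (v i) H :=
    fun i hi => (Finset.mem_filter.1 hi).2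
  have hnR : ∀ i ∉ R, tailSum (v i) H = 0 ∨ Decays (v i) (1 / (1 + 16 * s ^ 2)) r ∅ H := by
    intro i hi
    by_cases hT : tailSum (v i) H = 0
    · exact Or.inl hT
    right
    have hT' : 0 < tailSum (v i) H :=
      lt_of_le_of_ne (tailSum_nonneg (fun j => wvar_nonneg _ _ j) H) (Ne.symm hT)
    rcases hH i with h | h
    · exact absurd (Finset.mem_filter.2 ⟨mem_univ i, hT', h⟩) hi
    · exact h.group (fun j => wvar_nonneg _ _ j) (by linarith) hm0 hm
  set X := 𝔼 u, ind (F (productSample Ω u) = true) with hX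
  set D := 36 * C ^ 4 * (d : ℝ) ^ 3 / (ε ^ 4 * η ^ 4) with hD
  have hD0 : 0 ≤ D := by positivity
  have hE0 : ∀ k i, 0 ≤ bucketEnergy (v i) H (hash k) := fun k i =>
    div_nonneg (Finset.sum_nonneg fun l _ => sq_nonneg _) (sq_nonneg _)
  have hpt : ∀ k, |X - 𝔼 z, ind (F (fillBuckets (hash k) gen z) = true)| ≤
      ind (¬∀ l, (bucket (hash k) l ∩ H).card ≤ 1) + 144 * d * ε +
        D * ∑ i ∈ R, bucketEnergy (v i) H (hash k) := by
    intro k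
    have hS : 0 ≤ D * ∑ i ∈ R, bucketEnergy (v i) H (hash k) :=
      mul_nonneg hD0 (Finset.sum_nonneg fun i _ => hE0 k i)
    by_cases hsep : ∀ l, (bucket (hash k) l ∩ H).card ≤ 1
    · rw [ind_of_not (not_not.2 hsep), zero_add]
      have := fixed_hash_error_le hx hη hη1 W Θ f hε (by linarith) hδε hC1 hC hs hsε hr hR hnR
        (hash k) gen hgen hsep
      simp only [hX, hF]
      exact this
    · rw [ind_of hsep]
      have hX0 : 0 ≤ X := Finset.expect_nonneg fun _ _ => ind_nonneg _
      have hX1 : X ≤ 1 := expect_le_of_le fun _ => ind_le_one _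
      have hY0 : 0 ≤ 𝔼 z, ind (F (fillBuckets (hash k) gen z) = true) :=
        Finset.expect_nonneg fun _ _ => ind_nonneg _
      have hY1 : (𝔼 z, ind (F (fillBuckets (hash k) gen z) = true)) ≤ 1 :=
        expect_le_of_le fun _ => ind_le_one _
      have : 0 ≤ 144 * d * ε := by positivity
      rw [abs_le]
      constructor <;> linarith
  have hY : prob (fun z : κ × (Fin t → σ) => F (mzGenerator hash gen z) = true) =
      𝔼 k, 𝔼 z, ind (F (fillBuckets (hash k) gen z) = true) := by
    rw [prob_eq_expect, expect_prod]
    rfl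
  have hsepar : (𝔼 k, ind (¬∀ l, (bucket (hash k) l ∩ H).card ≤ 1)) ≤ d * ε := by
    refine (expect_not_separated_le hhash H).trans ?_
    rw [div_le_iff₀ ht0]
    have h1 : (H.card : ℝ) ^ 2 ≤ ((d : ℝ) * paramL d ε η) ^ 2 := by
      gcongr
      rw [hL]
      exact_mod_cast hHcard
    unfold minBuckets at ht
    rw [div_le_iff₀ (by positivity)] at ht
    linarith
  have henergy : (𝔼 k, D * ∑ i ∈ R, bucketEnergy (v i) H (hash k)) ≤ 72 * C ^ 4 * d * ε := by
    rw [← Finset.mul_expect, Finset.expect_sum_comm]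
    have h1 : ∑ i ∈ R, (𝔼 k, bucketEnergy (v i) H (hash k)) ≤ d * (2 * (η ^ 4 * δ)) := by
      calc _ ≤ ∑ _i ∈ R, 2 * (η ^ 4 * δ) := by
            refine Finset.sum_le_sum fun i hi => ?_
            have := expect_bucketEnergy_le hhash (fun j => wvar_nonneg _ _ j) (hR i hi).1 (hR i hi).2
            linarith
        _ = (R.card : ℝ) * (2 * (η ^ 4 * δ)) := by simp
        _ ≤ _ := by
            gcongr
            exact_mod_cast (Finset.card_le_univ R).trans (by simp)
    have h2 := pow_four_mul_paramδ_le hd hε hη1 hη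
    have h3 : ε ^ 4 ≤ d * ε := by
      have : ε ^ 4 ≤ ε := pow_le_of_le_one hε.le (by linarith) (by norm_num)
      nlinarith
    calc D * ∑ i ∈ R, (𝔼 k, bucketEnergy (v i) H (hash k)) ≤ D * (d * (2 * (η ^ 4 * δ))) := by gcongr
      _ = 72 * C ^ 4 * ((d : ℝ) ^ 4 * δ / ε ^ 4) := by rw [hD]; field_simp; ring
      _ ≤ 72 * C ^ 4 * (d * ε) := by gcongr; exact h2.trans h3
      _ = _ := by ring
  unfold Fools
  rw [prob_eq_expect, hY, ← hX, ← Fintype.expect_const (ι := κ) X, ← Finset.expect_sub_distrib]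
  refine (Finset.abs_expect_le _ _).trans ((expect_mono hpt).trans ?_)
  rw [Finset.expect_add_distrib, Finset.expect_add_distrib, Fintype.expect_const]
  linarith

/-! ### Explicit hash functions and samplers -/

/-- A surjective homomorphism of finite groups maps the uniform distribution to the uniform
distribution. -/
theorem expect_comp_of_surjective {G M : Type*} [AddCommGroup G] [Fintype G] [AddCommGroup M]
    [Fintype M] (f : G → M) (hadd : ∀ a b, f (a + b) = f a + f b) (hf : Function.Surjective f)
    (g : M → ℝ) : (𝔼 a, g (f a)) = 𝔼 m, g m := by
  -- By surjectivity the law of f is translation invariant, so a uniform independent shift can be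
  -- inserted and the two averages exchanged.
  have h1 : ∀ m, (𝔼 a, g (f a)) = 𝔼 a, g (f a + m) := by
    intro m
    obtain ⟨b, rfl⟩ := hf m
    exact (Fintype.expect_equiv (Equiv.addRight b) _ _ fun a => by simp [hadd]).symm
  calc (𝔼 a, g (f a)) = 𝔼 _m : M, 𝔼 a, g (f a) := (Fintype.expect_const _).symm
    _ = 𝔼 m, 𝔼 a, g (f a + m) := Finset.expect_congr rfl fun m _ => h1 m
    _ = 𝔼 a, 𝔼 m, g (f a + m) := Finset.expect_comm _ _ _
    _ = 𝔼 _a : G, 𝔼 m, g m := Finset.expect_congr rfl fun a _ =>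
        Fintype.expect_equiv (Equiv.addLeft (f a)) _ _ fun m => rfl
    _ = _ := Fintype.expect_const _

theorem expect_ind_eq_le {M β : Type*} [Fintype M] (g : M → β)
    (hg : Function.Injective g) (b : β) : (𝔼 m, ind (g m = b)) ≤ 1 / Fintype.card M := by
  classical
  rw [Fintype.expect_eq_sum_div_card]
  gcongr
  by_cases h : ∃ m, g m = b
  · obtain ⟨m, rfl⟩ := h
    rw [Finset.sum_eq_single_of_mem m (mem_univ m), ind_of rfl]
    intro m' _ hne
    exact ind_of_not fun h => hne (hg h)
  · push Not at h
    rw [Finset.sum_eq_zero fun m _ => ind_of_not (h m)]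
    exact zero_le_one

theorem card_bits (m : ℕ) : Fintype.card (Bits m) = 2 ^ m := by simp

theorem bitsToNat_eq {m : ℕ} (v : Bits m) :
    bitsToNat v = (finFunctionFinEquiv (m := 2) (n := m) v : Fin (2 ^ m)).val :=
  (finFunctionFinEquiv_apply (m := 2) (n := m) v).symm

theorem bitsToNat_injective (m : ℕ) : Function.Injective (bitsToNat (m := m)) := by
  intro v v' h
  rw [bitsToNat_eq, bitsToNat_eq] at h
  exact finFunctionFinEquiv.injective (Fin.ext h)

theorem bitsToNat_lt {m : ℕ} (v : Bits m) : bitsToNat v < 2 ^ m := by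
  rw [bitsToNat_eq]; exact Fin.is_lt _

/-- The low-order bits. -/
def lowBits {τ m : ℕ} (h : τ ≤ m) (v : Bits m) : Bits τ := fun i => v (Fin.castLE h i)

/-- Reduction modulo a power of two keeps the low bits, which makes the hash value additive in its
seed although it is defined through natural numbers. -/
theorem bitsToNat_mod {τ m : ℕ} (h : τ ≤ m) (v : Bits m) :
    bitsToNat v % 2 ^ τ = bitsToNat (lowBits h v) := by
  obtain ⟨k, rfl⟩ := Nat.exists_eq_add_of_le h
  have : bitsToNat v = bitsToNat (lowBits h v) +
      2 ^ τ * ∑ i : Fin k, (v (Fin.natAdd τ i)).val * 2 ^ (i : ℕ) := by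
    rw [bitsToNat, Fin.sum_univ_add, bitsToNat, Finset.mul_sum]
    congr 1
    refine Finset.sum_congr rfl fun i _ => ?_
    rw [Fin.val_natAdd, pow_add]
    ring
  rw [this, Nat.add_mul_mod_self_left, Nat.mod_eq_of_lt (bitsToNat_lt _)]

theorem lowBits_add {τ m : ℕ} (h : τ ≤ m) (v v' : Bits m) :
    lowBits h (v + v') = lowBits h v + lowBits h v' := rfl

theorem lowBits_surjective {τ m : ℕ} (h : τ ≤ m) : Function.Surjective (lowBits h) := by
  intro w
  refine ⟨fun i => if hi : (i : ℕ) < τ then w ⟨i, hi⟩ else 0, ?_⟩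
  ext i
  simp [lowBits]

theorem natToBits_injOn {m x y : ℕ} (hx : x < 2 ^ m) (hy : y < 2 ^ m)
    (h : natToBits m x = natToBits m y) : x = y := by
  refine Nat.eq_of_testBit_eq fun i => ?_
  by_cases hi : i < m
  · have := congrFun h ⟨i, hi⟩
    simp only [natToBits] at this
    cases h1 : x.testBit i <;> cases h2 : y.testBit i <;> simp [h1, h2] at this ⊢
  · have hle : 2 ^ m ≤ 2 ^ i := Nat.pow_le_pow_right (by norm_num) (not_lt.1 hi)
    rw [Nat.testBit_lt_two_pow (hx.trans_le hle), Nat.testBit_lt_two_pow (hy.trans_le hle)]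

theorem natToBits_zero (m : ℕ) : natToBits m 0 = 0 := by
  ext i; simp [natToBits]

/-! ### Collision bounds for multiplicative hashing -/

section Hash

variable {n τ : ℕ}

theorem le_hashBits (n τ : ℕ) : τ ≤ hashBits n τ := le_max_left _ _

theorem le_two_pow_hashBits (n τ : ℕ) : n + 1 ≤ 2 ^ hashBits n τ :=
  (Nat.le_pow_clog (by norm_num) _).trans
    (Nat.pow_le_pow_right (by norm_num) (le_max_right _ _))

/-- Multiplication by a field element, followed by the extraction of the low-order bits. -/
def mulLowBits (e : Coords (hashBits n τ)) (x : GF (hashBits n τ)) (a : Bits (hashBits n τ)) :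
    Bits τ := lowBits (le_hashBits n τ) (e (e.symm a * x))

theorem mulLowBits_surjective (e : Coords (hashBits n τ)) {x : GF (hashBits n τ)} (hx : x ≠ 0) :
    Function.Surjective (mulLowBits e x) := by
  intro w
  obtain ⟨v, rfl⟩ := lowBits_surjective (le_hashBits n τ) w
  refine ⟨e (e.symm v * x⁻¹), ?_⟩
  rw [mulLowBits, e.symm_apply_apply, inv_mul_cancel_right₀ hx, e.apply_symm_apply]

theorem mulLowBits_add (e : Coords (hashBits n τ)) (x : GF (hashBits n τ))
    (a a' : Bits (hashBits n τ)) :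
    mulLowBits e x (a + a') = mulLowBits e x a + mulLowBits e x a' := by
  rw [mulLowBits, map_add, add_mul, map_add, lowBits_add]
  rfl

theorem mzHash_val (e : Coords (hashBits n τ)) (a : Bits (hashBits n τ)) (j : Fin n) :
    (mzHash n τ e a j : ℕ) =
      bitsToNat (mulLowBits e (e.symm (natToBits _ ((j : ℕ) + 1))) a) :=
  bitsToNat_mod _ _

theorem isCollisionPreserving_mzHash (e : Coords (hashBits n τ)) :
    IsCollisionPreserving 1 (mzHash n τ e) := by
  have hpow := le_two_pow_hashBits n τ
  have hcard : ((2 ^ τ : ℕ) : ℝ) = Fintype.card (Bits τ) := by rw [card_bits]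
  constructor
  · intro i l
    -- The indices start at 1, so that no index is represented by zero, whose hash value would be
    -- constant.
    have hx : e.symm (natToBits (hashBits n τ) ((i : ℕ) + 1)) ≠ 0 := by
      rw [Ne, LinearEquiv.map_eq_zero_iff, ← natToBits_zero]
      intro h
      have := natToBits_injOn (by have := i.isLt; omega) (by positivity) h
      omega
    rw [prob_eq_expect, hcard]
    have h1 : ∀ a, ind (mzHash n τ e a i = l) =
        ind (bitsToNat (mulLowBits e (e.symm (natToBits _ ((i : ℕ) + 1))) a) = (l : ℕ)) := by
      intro a; rw [← mzHash_val, Fin.ext_iff]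
    simp only [h1]
    rw [expect_comp_of_surjective _ (mulLowBits_add e _) (mulLowBits_surjective e hx)
      (fun w => ind (bitsToNat w = (l : ℕ)))]
    exact expect_ind_eq_le _ (bitsToNat_injective τ) _
  · intro i j hij
    set xi := e.symm (natToBits (hashBits n τ) ((i : ℕ) + 1)) with hxi
    set xj := e.symm (natToBits (hashBits n τ) ((j : ℕ) + 1)) with hxj
    -- By additivity a collision means that the low bits of a(xi - xj) vanish, and multiplication by
    -- xi - xj is invertible.
    have hx : xi - xj ≠ 0 := by
      rw [sub_ne_zero, hxi, hxj, e.symm.injective.ne_iff]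
      intro h
      have := natToBits_injOn (by have := i.isLt; omega) (by have := j.isLt; omega) h
      exact hij (Fin.ext (by omega))
    rw [prob_eq_expect, hcard]
    have h1 : ∀ a, ind (mzHash n τ e a i = mzHash n τ e a j) =
        ind (mulLowBits e (xi - xj) a = 0) := by
      intro a
      have h2 : mulLowBits e (xi - xj) a = mulLowBits e xi a - mulLowBits e xj a := by
        rw [mulLowBits, mul_sub, map_sub]
        rfl
      rw [h2, sub_eq_zero, Fin.ext_iff, mzHash_val, mzHash_val,
        (bitsToNat_injective τ).eq_iff]
    simp only [h1]
    rw [expect_comp_of_surjective _ (mulLowBits_add e _) (mulLowBits_surjective e hx)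
      (fun w => ind (w = 0))]
    exact expect_ind_eq_le (fun w => w) Function.injective_id _

end Hash

/-! ### Five-wise independence from random polynomials -/

section Sampler

variable {n b : ℕ}

theorem le_genBits (n b : ℕ) : b ≤ genBits n b := le_max_left _ _

theorem le_two_pow_genBits (n b : ℕ) : n ≤ 2 ^ genBits n b :=
  (Nat.le_pow_clog (by norm_num) _).trans
    (Nat.pow_le_pow_right (by norm_num) (le_max_right _ _))

/-- The low-order bits of the values of a polynomial with coefficients `c` at the points `x j`. -/
def polyLowBits (e : Coords (genBits n b)) {S : Type} (x : S → GF (genBits n b))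
    (c : Fin 5 → Bits (genBits n b)) (j : S) : Bits b :=
  lowBits (le_genBits n b) (e (∑ k : Fin 5, e.symm (c k) * x j ^ (k : ℕ)))

theorem polyLowBits_add (e : Coords (genBits n b)) {S : Type} (x : S → GF (genBits n b))
    (c c' : Fin 5 → Bits (genBits n b)) :
    polyLowBits e x (c + c') = polyLowBits e x c + polyLowBits e x c' := by
  ext1 j
  simp only [polyLowBits, Pi.add_apply, map_add, add_mul, Finset.sum_add_distrib, lowBits_add]

/-- Lagrange interpolation: a polynomial of degree less than 5 takes prescribed values at any five
or fewer distinct points. -/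
theorem polyLowBits_surjective (e : Coords (genBits n b)) {S : Type} [Fintype S]
    (hS : Fintype.card S ≤ 5) {x : S → GF (genBits n b)} (hx : Function.Injective x) :
    Function.Surjective (polyLowBits e x) := by
  classical
  intro w
  choose v hv using fun j => lowBits_surjective (le_genBits n b) (w j)
  set p := Lagrange.interpolate univ x (fun j => e.symm (v j)) with hp
  have hdeg : p.degree < (5 : ℕ) :=
    (Lagrange.degree_interpolate_lt _ hx.injOn).trans_le (by
      rw [Finset.card_univ]; exact_mod_cast hS)
  refine ⟨fun k => e (p.coeff k), ?_⟩
  ext1 j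
  rw [polyLowBits]
  have heval : ∑ k : Fin 5, e.symm (e (p.coeff k)) * x j ^ (k : ℕ) = e.symm (v j) := by
    have h1 := Lagrange.eval_interpolate_at_node (fun j => e.symm (v j)) hx.injOn (mem_univ j)
    rw [← hp] at h1
    have hnat : p.natDegree < 5 := by
      by_cases h0 : p = 0
      · simp [h0]
      · exact (Polynomial.natDegree_lt_iff_degree_lt h0).2 hdeg
    rw [← h1, Polynomial.eval_eq_sum_range' hnat,
      ← Fin.sum_univ_eq_sum_range (fun k => p.coeff k * x j ^ k)]
    simp
  rw [heval, e.apply_symm_apply]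
  exact hv j

theorem isKWise_mzSampler (Ω : Fin n → Bits b → ℝ) (e : Coords (genBits n b))
    (H : Finset (Fin n)) : IsKWise 5 Ω H (mzSampler Ω e) := by
  classical
  intro S _ hS v
  let x : S → GF (genBits n b) := fun j => e.symm (natToBits _ ((j : Fin n) : ℕ))
  have hpow := le_two_pow_genBits n b
  have hx : Function.Injective x := by
    intro i j h
    have h1 := natToBits_injOn (by have := i.1.isLt; omega) (by have := j.1.isLt; omega)
      (e.symm.injective h)
    exact Subtype.ext (Fin.ext h1)
  rw [prob_eq_expect]
  have h1 : ∀ c, ind (∀ j ∈ S, mzSampler Ω e c j = v j) =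
      ∏ j : S, ind (Ω j (polyLowBits e x c j) = v j) := by
    intro c
    have hval : ∀ j : S, mzSampler Ω e c j = Ω j (polyLowBits e x c j) := fun j => rfl
    by_cases h : ∀ j ∈ S, mzSampler Ω e c j = v j
    · rw [ind_of h]
      exact (Finset.prod_eq_one fun j _ => ind_of (by rw [← hval]; exact h j j.2)).symm
    · rw [ind_of_not h]
      push Not at h
      obtain ⟨j, hj, hne⟩ := h
      exact (Finset.prod_eq_zero (mem_univ (⟨j, hj⟩ : S))
        (ind_of_not (by rw [← hval]; exact hne))).symm
  simp only [h1]
  rw [expect_comp_of_surjective _ (polyLowBits_add e x)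
    (polyLowBits_surjective e (by simpa using hS) hx)
    (fun w : S → Bits b => ∏ j : S, ind (Ω j (w j) = v j)),
    expect_pi_prod (fun (j : S) a => ind (Ω j a = v j))]
  simp only [← prob_eq_expect]
  exact Finset.prod_coe_sort S (fun j => prob fun a => Ω j a = v j)

end Sampler

/-! ### Seed length -/

/-- A constant variable with mean zero vanishes, contradicting positive variance. Hence the sample
space has at least two points and the logarithm in the seed bound is bounded away from 0. -/
theorem IsHC.one_le_bits {b : ℕ} {η : ℝ} {x : Bits b → ℝ} (h : IsHC η x) : 1 ≤ b := by
  by_contra hb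
  obtain rfl : b = 0 := by omega
  have hx : ∀ a, x a = x 0 := fun a => congrArg x (Subsingleton.elim _ _)
  have h1 := h.mean_eq_zero
  have h2 := h.second_moment_pos
  simp only [hx, Fintype.expect_const] at h1 h2
  rw [h1] at h2
  norm_num at h2

theorem seedLength_eq (n b τ : ℕ) :
    seedLength (MZSeed n b τ) = hashBits n τ + 2 ^ τ * (5 * genBits n b) := by
  have : Fintype.card (MZSeed n b τ) = 2 ^ (hashBits n τ + genBits n b * (5 * 2 ^ τ)) := by
    simp only [Fintype.card_prod, Fintype.card_fun, ZMod.card, Fintype.card_fin]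
    rw [← pow_mul, ← pow_mul, ← pow_add]
  rw [seedLength, this]
  push_cast
  rw [Real.logb_pow, Real.logb_self_eq_one (by norm_num)]
  push_cast
  ring

theorem clog_le_logb_add_one {x : ℕ} (hx : 1 ≤ x) : (Nat.clog 2 x : ℝ) ≤ Real.logb 2 x + 1 := by
  have h := Real.natCeil_logb_natCast 2 x
  rw [← h]
  refine (Nat.ceil_lt_add_one ?_).le
  exact Real.logb_nonneg (by norm_num) (by exact_mod_cast hx)

theorem seedLength_le {n b : ℕ} (τ : ℕ) (hn : 1 ≤ n) (hb : 1 ≤ b) :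
    seedLength (MZSeed n b τ) ≤ 28 * (2 : ℝ) ^ τ * Real.log (max (n : ℝ) ((2 : ℝ) ^ b)) := by
  set N := max (n : ℝ) ((2 : ℝ) ^ b) with hN
  have hn1 : (1 : ℝ) ≤ n := by exact_mod_cast hn
  have hN2 : 2 ≤ N := (le_self_pow₀ (by norm_num) (by omega)).trans (le_max_right _ _)
  set l := Real.logb 2 N with hl
  have hl1 : 1 ≤ l := by
    rw [hl, Real.le_logb_iff_rpow_le (by norm_num) (by linarith)]; simpa using hN2
  have hbl : (b : ℝ) ≤ l := by
    rw [hl, Real.le_logb_iff_rpow_le (by norm_num) (by linarith), Real.rpow_natCast]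
    exact le_max_right _ _
  have hnl : Real.logb 2 n ≤ l :=
    Real.logb_le_logb_of_le (by norm_num) (by linarith) (le_max_left _ _)
  have hn1l : Real.logb 2 ((n + 1 : ℕ) : ℝ) ≤ l + 1 := by
    have h1 : l + 1 = Real.logb 2 (N * 2) := by
      rw [Real.logb_mul (by linarith) (by norm_num), Real.logb_self_eq_one (by norm_num)]
    rw [h1]
    refine Real.logb_le_logb_of_le (by norm_num) (by positivity) ?_
    have := le_max_left (n : ℝ) ((2 : ℝ) ^ b)
    push_cast
    linarith
  have hτ : (τ : ℝ) ≤ 2 ^ τ := by exact_mod_cast (Nat.lt_two_pow_self).le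
  have ht1 : (1 : ℝ) ≤ 2 ^ τ := one_le_pow₀ (by norm_num)
  have hh : (hashBits n τ : ℝ) ≤ 2 ^ τ + (l + 2) := by
    have := clog_le_logb_add_one (x := n + 1) (by omega)
    rw [hashBits, Nat.cast_max]
    refine max_le (by linarith) (by linarith)
  have hg : (genBits n b : ℝ) ≤ l + 1 := by
    have := clog_le_logb_add_one hn
    rw [genBits, Nat.cast_max]
    refine max_le (by linarith) (by linarith)
  have hlog : l ≤ 2 * Real.log N := by
    rw [hl, Real.logb, div_le_iff₀ (Real.log_pos (by norm_num))]
    have := Real.log_two_gt_d9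
    have : 0 ≤ Real.log N := Real.log_nonneg (by linarith)
    nlinarith
  rw [seedLength_eq]
  calc (hashBits n τ : ℝ) + 2 ^ τ * (5 * genBits n b)
      ≤ (2 ^ τ + (l + 2)) + 2 ^ τ * (5 * (l + 1)) := by gcongr
    -- Every summand is at most a multiple of 2^τ · l since both factors are at least 1; the
    -- coefficients are 1 + 1 + 2 + 5 + 5. The next factor 2 bounds 1/ln 2.
    _ ≤ 14 * 2 ^ τ * l := by nlinarith
    _ ≤ 14 * 2 ^ τ * (2 * Real.log N) := by gcongr
    _ = _ := by ring

theorem minBuckets_le_two_pow_bucketBits (d : ℕ) (ε η : ℝ) :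
    minBuckets d ε η ≤ (2 : ℝ) ^ bucketBits d ε η := by
  refine (Nat.le_ceil _).trans ?_
  exact_mod_cast Nat.le_pow_clog (by norm_num) _

/-! ### Seed length in terms of d, ε, η and n -/

section Asymptotics

variable {d : ℕ} {ε η : ℝ}

/-- Rounding up to an integer and then to a power of two each cost at most a factor 2. -/
theorem two_pow_bucketBits_le (h : 1 ≤ minBuckets d ε η) :
    (2 : ℝ) ^ bucketBits d ε η ≤ 4 * minBuckets d ε η := by
  set x := ⌈minBuckets d ε η⌉₊ with hx
  have hx1 : 1 ≤ x := by rw [hx, Nat.one_le_ceil_iff]; linarith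
  have hxm : (x : ℝ) ≤ minBuckets d ε η + 1 := (Nat.ceil_lt_add_one (by linarith)).le
  rcases hx1.eq_or_lt with h1 | h1
  · rw [bucketBits, ← hx, ← h1]
    simp
    linarith
  · have h2 := Nat.pow_pred_clog_lt_self (b := 2) (by norm_num) h1
    have h3 : 0 < Nat.clog 2 x := Nat.clog_pos (by norm_num) h1
    have h4 : 2 ^ Nat.clog 2 x ≤ 2 * x := by
      obtain ⟨k, hk⟩ := Nat.exists_eq_succ_of_ne_zero h3.ne'
      rw [hk] at h2 ⊢
      rw [Nat.pred_succ] at h2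
      rw [pow_succ]
      omega
    have h5 : (2 : ℝ) ^ Nat.clog 2 x ≤ 2 * x := by exact_mod_cast h4
    rw [bucketBits, ← hx]
    linarith

theorem half_le_log (hε : 0 < ε) (hε2 : ε < 1 / 2) (hη : 0 < η) (hη1 : η < 1) :
    1 / 2 ≤ Real.log (1 / (ε * η)) := by
  have h1 : Real.log 2 ≤ Real.log (1 / (ε * η)) := by
    refine Real.log_le_log (by norm_num) ?_
    rw [le_div_iff₀ (by positivity)]
    nlinarith
  have := Real.log_two_gt_d9
  linarith

theorem paramL_le (hd : 1 ≤ d) (hε : 0 < ε) (hε2 : ε < 1 / 2) (hη : 0 < η) (hη1 : η < 1) :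
    (paramL d ε η : ℝ) ≤
      48 * ((d : ℝ) ^ 7 / (η ^ 12 * ε ^ 8)) * Real.log (1 / (ε * η)) ^ 2 := by
  have hΛ := half_le_log hε hε2 hη hη1
  set Λ := Real.log (1 / (ε * η)) with hΛdef
  have hη4 : η ^ 4 ≤ 1 := pow_le_one₀ hη.le hη1.le
  have hδ := paramδ_pos hd hε hη
  have hd1 : (1 : ℝ) ≤ d := by exact_mod_cast hd
  have hΛeq : Λ = Real.log (1 / ε) + Real.log (1 / η) := by
    rw [hΛdef, ← Real.log_mul (by positivity) (by positivity)]
    congr 1; field_simp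
  have hlogη : 0 ≤ Real.log (1 / η) :=
    Real.log_nonneg (by rw [le_div_iff₀ hη]; linarith)
  have hlogε : 0 ≤ Real.log (1 / ε) :=
    Real.log_nonneg (by rw [le_div_iff₀ hε]; linarith)
  have hr : (⌈2 / η ^ 4 * Real.log (1 / ε)⌉₊ : ℝ) ≤ 4 / η ^ 4 * Λ := by
    refine (Nat.ceil_lt_add_one (by positivity)).le.trans ?_
    have h1 : 1 ≤ 2 / η ^ 4 * Λ := by
      have : 2 ≤ 2 / η ^ 4 := by rw [le_div_iff₀ (by positivity)]; linarith
      nlinarith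
    have h2 : 2 / η ^ 4 * Real.log (1 / ε) ≤ 2 / η ^ 4 * Λ := by gcongr; linarith
    have h3 : 4 / η ^ 4 * Λ = 2 / η ^ 4 * Λ + 2 / η ^ 4 * Λ := by ring
    linarith
  set A := 1 / (η ^ 4 * paramδ d ε η) with hA
  have hAeq : A = (d : ℝ) ^ 7 / (η ^ 8 * ε ^ 8) := by
    rw [hA, paramδ]; field_simp
  have hA1 : 1 ≤ A := by
    rw [hA, le_div_iff₀ (by positivity), one_mul]
    have := sixteen_mul_paramδ_le hd hε hε2 hη hη1
    have : ε ^ 4 ≤ 1 := pow_le_one₀ hε.le (by linarith)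
    exact mul_le_one₀ hη4 hδ.le (by linarith)
  -- Here ln 17 ≤ 3 ≤ 6Λ because Λ ≥ 1/2, and 4 ln(1/η) + ln(1/ε) ≤ 4Λ.
  have hlogs : Real.log (1 + 16 * paramS ε η ^ 2) ≤ 10 * Λ := by
    have h1 : 1 + 16 * paramS ε η ^ 2 ≤ 17 * (1 / (η ^ 4 * ε)) := by
      rw [paramS_sq hε]
      have h2 : 1 ≤ 1 / (η ^ 4 * ε) := by
        rw [le_div_iff₀ (by positivity), one_mul]
        exact mul_le_one₀ hη4 hε.le (by linarith)
      linarith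
    refine (Real.log_le_log (by positivity) h1).trans ?_
    have h17 : Real.log 17 ≤ 3 := by
      rw [Real.log_le_iff_le_exp (by norm_num)]
      have := Real.exp_one_gt_d9
      have h6 : Real.exp 3 = Real.exp 1 ^ 3 := by rw [← Real.exp_nat_mul]; norm_num
      rw [h6]
      calc (17 : ℝ) ≤ 2.7 ^ 3 := by norm_num
        _ ≤ _ := by gcongr; linarith
    have h3 : 1 / (η ^ 4 * ε) = (1 / η) ^ 4 * (1 / ε) := by field_simp
    rw [Real.log_mul (by norm_num) (by positivity), h3, Real.log_mul (by positivity) (by positivity),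
      Real.log_pow]
    push_cast
    linarith
  have hm : (⌈A * Real.log (1 + 16 * paramS ε η ^ 2)⌉₊ : ℝ) ≤ 12 * A * Λ := by
    have h0 : 0 ≤ Real.log (1 + 16 * paramS ε η ^ 2) :=
      zero_le_one.trans (one_le_log_paramS hε hε2 hη hη1)
    refine (Nat.ceil_lt_add_one (by positivity)).le.trans ?_
    have h1 : A * Real.log (1 + 16 * paramS ε η ^ 2) ≤ A * (10 * Λ) := by gcongr
    have h2 : 1 ≤ 2 * A * Λ := by nlinarith
    linarith
  rw [paramL, Nat.cast_mul]
  calc _ ≤ (4 / η ^ 4 * Λ) * (12 * A * Λ) := by gcongr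
    _ = _ := by rw [hAeq]; field_simp; ring

theorem minBuckets_le (hd : 1 ≤ d) (hε : 0 < ε) (hε2 : ε < 1 / 2) (hη : 0 < η) (hη1 : η < 1) :
    minBuckets d ε η ≤
      2304 * ((d : ℝ) ^ 15 * Real.log (1 / (ε * η)) ^ 4 / (η ^ 24 * ε ^ 17)) := by
  rw [minBuckets_eq hd hε]
  have := paramL_le hd hε hε2 hη hη1
  calc d * (paramL d ε η : ℝ) ^ 2 / ε ≤
      d * (48 * ((d : ℝ) ^ 7 / (η ^ 12 * ε ^ 8)) * Real.log (1 / (ε * η)) ^ 2) ^ 2 / ε := by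
        gcongr
    _ = _ := by field_simp; ring

theorem log_max_le {n b A : ℕ} (hn : 1 ≤ n) (hε : 0 < ε) (hε2 : ε < 1 / 2) (hη : 0 < η)
    (hη1 : η < 1) (hb : (2 : ℝ) ^ b ≤ ((n : ℝ) / (ε * η)) ^ A) :
    Real.log (max (n : ℝ) ((2 : ℝ) ^ b)) ≤ (A + 1) * Real.log ((n : ℝ) / (ε * η)) := by
  have hn1 : (1 : ℝ) ≤ n := by exact_mod_cast hn
  have hεη : ε * η ≤ 1 := mul_le_one₀ (by linarith) hη.le hη1.le
  have hle : (n : ℝ) ≤ n / (ε * η) := by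
    rw [le_div_iff₀ (by positivity)]
    exact mul_le_of_le_one_right (by linarith) hεη
  have h0 : 0 ≤ Real.log ((n : ℝ) / (ε * η)) := Real.log_nonneg (hn1.trans hle)
  have hpow : (n : ℝ) / (ε * η) ≤ (n / (ε * η)) ^ (A + 1) :=
    le_self_pow₀ (hn1.trans hle) (by omega)
  have hpow' : ((n : ℝ) / (ε * η)) ^ A ≤ (n / (ε * η)) ^ (A + 1) :=
    pow_le_pow_right₀ (hn1.trans hle) (by omega)
  have hmax : max (n : ℝ) ((2 : ℝ) ^ b) ≤ (n / (ε * η)) ^ (A + 1) :=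
    max_le (hle.trans hpow) (hb.trans hpow')
  refine (Real.log_le_log (lt_max_of_lt_left (by linarith)) hmax).trans (le_of_eq ?_)
  rw [Real.log_pow]
  push_cast
  ring

end Asymptotics

end MZ

end

/-! ### Assembly of the fooling and seed length statements -/

theorem mainTheorem11 :
    ∃ K : ℝ, 0 < K ∧
      -- fooling, for every instantiation of the generator and for the explicit one
      (∀ (d n b : ℕ) (ε η : ℝ) (Ω : Fin n → MZ.Bits b → ℝ),
        1 ≤ d → 1 ≤ n → 0 < ε → ε < 1 / 2 → (∀ j, MZ.IsHC η (Ω j)) →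
        (∀ t : ℕ, MZ.minBuckets d ε η ≤ t →
          ∀ (κ σ : Type) [Fintype κ] [Nonempty κ] [Fintype σ] [Nonempty σ]
            (hash : κ → Fin n → Fin t) (gen : Finset (Fin n) → σ → Fin n → ℝ),
            MZ.IsCollisionPreserving 1 hash →
            (∀ H : Finset (Fin n), MZ.IsKWise 5 Ω H (gen H)) →
            ∀ F : (Fin n → ℝ) → Bool, MZ.IsFunctionOfHalfspaces d F →
              MZ.Fools Ω (MZ.mzGenerator hash gen) (K * d * ε) F) ∧
        (∀ τ : ℕ, MZ.minBuckets d ε η ≤ (2 : ℝ) ^ τ →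
          (∀ (e₀ : MZ.Coords (MZ.hashBits n τ)) (e : MZ.Coords (MZ.genBits n b)),
            MZ.IsCollisionPreserving 1 (MZ.mzHash n τ e₀) ∧
            (∀ H : Finset (Fin n), MZ.IsKWise 5 Ω H (MZ.mzSampler Ω e)) ∧
            ∀ F : (Fin n → ℝ) → Bool, MZ.IsFunctionOfHalfspaces d F →
              MZ.Fools Ω (MZ.mzExplicit τ Ω e₀ e) (K * d * ε) F) ∧
          MZ.seedLength (MZ.MZSeed n b τ)
            ≤ K * (2 : ℝ) ^ τ * Real.log (max (n : ℝ) ((2 : ℝ) ^ b)))) ∧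
      -- seed length with the least admissible number of buckets, for `|Ω j| = 2 ^ b` polynomial
      -- in `n / (ε η)`
      ∀ A : ℕ, ∃ C : ℝ, 0 < C ∧
        ∀ (d n b : ℕ) (ε η : ℝ) (Ω : Fin n → MZ.Bits b → ℝ),
          1 ≤ d → 1 ≤ n → 0 < ε → ε < 1 / 2 → (∀ j, MZ.IsHC η (Ω j)) →
          (2 : ℝ) ^ b ≤ ((n : ℝ) / (ε * η)) ^ A →
          MZ.minBuckets d ε η ≤ (2 : ℝ) ^ MZ.bucketBits d ε η ∧
          MZ.seedLength (MZ.MZSeed n b (MZ.bucketBits d ε η))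
            ≤ C * ((d : ℝ) ^ 15 * Real.log (1 / (ε * η)) ^ 4
                * Real.log ((n : ℝ) / (ε * η)) / (η ^ 24 * ε ^ 17)) := by

  obtain ⟨K, hK, hfool⟩ := MZ.exists_fools
  refine ⟨max K 28, lt_max_of_lt_left hK, ?_, ?_⟩
  · intro d n b ε η Ω hd hn hε hε2 hx
    have hgen : ∀ t : ℕ, MZ.minBuckets d ε η ≤ t →
        ∀ (κ σ : Type) [Fintype κ] [Nonempty κ] [Fintype σ] [Nonempty σ]
          (hash : κ → Fin n → Fin t) (gen : Finset (Fin n) → σ → Fin n → ℝ),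
          MZ.IsCollisionPreserving 1 hash →
          (∀ H : Finset (Fin n), MZ.IsKWise 5 Ω H (gen H)) →
          ∀ F : (Fin n → ℝ) → Bool, MZ.IsFunctionOfHalfspaces d F →
            MZ.Fools Ω (MZ.mzGenerator hash gen) (max K 28 * d * ε) F := by
      intro t ht κ σ _ _ _ _ hash gen hhash hgen F hF
      refine (hfool d n b ε η Ω hd hn hε hε2 hx t ht κ σ hash gen hhash hgen F hF).trans ?_
      gcongr
      exact le_max_left _ _
    refine ⟨hgen, fun τ hτ => ⟨fun e₀ e => ?_, ?_⟩⟩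
    · have h1 := MZ.isCollisionPreserving_mzHash e₀
      have h2 := MZ.isKWise_mzSampler Ω e
      exact ⟨h1, h2, hgen (2 ^ τ) (by exact_mod_cast hτ) _ _ _ _ h1 h2⟩
    · have hb := (hx ⟨0, hn⟩).one_le_bits
      refine (MZ.seedLength_le τ hn hb).trans ?_
      have hlog : 0 ≤ Real.log (max (n : ℝ) ((2 : ℝ) ^ b)) :=
        Real.log_nonneg (le_max_of_le_left (by exact_mod_cast hn))
      gcongr
      exact le_max_right _ _
  · intro A
    -- The factors come from the seed length, the rounding of the number of buckets, the size of
    -- `minBuckets`, and the logarithm of the polynomial bound on the sample space.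
    refine ⟨28 * 4 * 2304 * (A + 1), by positivity, ?_⟩
    intro d n b ε η Ω hd hn hε hε2 hx hA
    refine ⟨MZ.minBuckets_le_two_pow_bucketBits d ε η, ?_⟩
    have hb := (hx ⟨0, hn⟩).one_le_bits
    have hη : 0 < η := (hx ⟨0, hn⟩).1
    have hη1 : η < 1 := (hx ⟨0, hn⟩).2.1
    have hlog : 0 ≤ Real.log (max (n : ℝ) ((2 : ℝ) ^ b)) :=
      Real.log_nonneg (le_max_of_le_left (by exact_mod_cast hn))
    have hmin1 : 1 ≤ MZ.minBuckets d ε η := by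
      refine le_trans ?_ (MZ.one_div_le_minBuckets hd hε hε2 hη hη1)
      have hδ := MZ.paramδ_pos hd hε hη
      have h16 := MZ.sixteen_mul_paramδ_le hd hε hε2 hη hη1
      have hε4 : ε ^ 4 ≤ 1 := pow_le_one₀ hε.le (by linarith)
      rw [le_div_iff₀ (by positivity), one_mul]
      exact mul_le_one₀ (pow_le_one₀ hη.le hη1.le) hδ.le (by linarith)
    have h1 := MZ.two_pow_bucketBits_le hmin1
    have h2 := MZ.minBuckets_le hd hε hε2 hη hη1
    have h3 := MZ.log_max_le hn hε hε2 hη hη1 hA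
    refine (MZ.seedLength_le _ hn hb).trans ?_
    calc 28 * (2 : ℝ) ^ MZ.bucketBits d ε η * Real.log (max (n : ℝ) ((2 : ℝ) ^ b))
        ≤ 28 * (4 * (2304 * ((d : ℝ) ^ 15 * Real.log (1 / (ε * η)) ^ 4 / (η ^ 24 * ε ^ 17)))) *
          ((A + 1) * Real.log ((n : ℝ) / (ε * η))) := by
          gcongr
          exact h1.trans (by gcongr)
      _ = _ := by ring
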